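/- **Setting.** Let $V$ be a finite set, $K$ a non-negative matrix on $V$ with $\sum_yK(x,y)\le 1$ for all $x$ and no stochastic principal submatrix, $\lambda>0$, and $\nu$ a probability distribution on $V$ such that every $x\in V$ can be reached by the $K$-walk from some site of the support of $\nu$. In the activated random walk dynamics each site is empty, or holds one sleeping particle, or holds $k\ge 1$ active particles. Each active particle at $x$ jumps to $y$ at rate $K(x,y)$ and is killed at rate $1-\sum_yK(x,y)$; an active particle that is alone on its site falls asleep at rate $\lambda$; a sleeping particle becomes active when another particle arrives at its site. Started from any configuration with finitely many particles, the dynamics almost surely reaches a stable configuration (one without active particles). The $\mathrm{ARW}(K,\lambda,\nu)$ chain is the discrete-time Markov chain on the set $\mathcal X$ of stable configurations which at each step adds one active particle at a $\nu$-distributed site and then runs the dynamics until it is stable. Let $P$ be its transition matrix and $\pi$ its invariant probability distribution, and let $$d_{\mathrm{sep}}(t)=\max_{\eta,\eta'\in\mathcal X}\Bigl(1-\frac{P^t(\eta,\eta')}{\pi(\eta')}\Bigr),\qquad d_{\mathrm{TV}}(t)=\max_{\eta\in\mathcal X,\,A\subseteq\mathcal X}|P^t(\eta,A)-\pi(A)|,$$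 $$t_{\mathrm{sep}}(\varepsilon)=\min\{t\in\mathbb N: d_{\mathrm{sep}}(t)\le\varepsilon\},\qquad t_{\mathrm{mix}}(\varepsilon)=\min\{t\in\mathbb N: d_{\mathrm{TV}}(t)\le\varepsilon\},$$ $t_{\mathrm{sep}}=t_{\mathrm{sep}}(1/2)$ and $t_{\mathrm{mix}}=t_{\mathrm{mix}}(1/2)$. A sequence of chains has a *separation cutoff* if for each fixed $\alpha\ge0$, as $n\to\infty$, $d^{(n)}_{\mathrm{sep}}(\lfloor\alpha t^{(n)}_{\mathrm{sep}}\rfloor)$ tends to $1$ if $\alpha<1$ and to $0$ if $\alpha>1$; its *window is $O(w_n)$* if $t_{\mathrm{sep}}^{(n)}(\varepsilon)-t_{\mathrm{sep}}^{(n)}(1-\varepsilon)=O(w_n)$ for each fixed $\varepsilon\in(0,1/2)$. Total-variation cutoff and its window are defined in the same way with $d_{\mathrm{TV}}$ and $t_{\mathrm{mix}}$. For a graph $G$ whose vertices have finite degree and a finite set $V$ of vertices, $P_G[V]$ denotes the restriction to $V\times V$ of the transition matrix of simple random walk on $G$, and $\mathcal U(V)$ the uniform distribution on $V$. **Statement.**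 (0) Every $\mathrm{ARW}(K,\lambda,\nu)$ chain has exactly one invariant distribution, and for all $t\in\mathbb N$, $$|d_{\mathrm{sep}}(t)-d_{\mathrm{TV}}(t)|\le\frac{|V|}{1+\lambda}\,d_{\mathrm{sep}}(t),$$ that is, $\sup_t|1-d_{\mathrm{TV}}(t)/d_{\mathrm{sep}}(t)|\le |V|/(1+\lambda)$, with $0/0$ read as $1$. For $n\ge1$ consider the chains $\mathrm{ARW}(K_n,\lambda_n,\nu_n)$ with $\nu_n=\mathcal U(V_n)$ and $\lambda_n>0$, where $\lambda_n/|V_n|\to\infty$. In each of the four cases below there are both a separation cutoff and a total-variation cutoff, both with window $O(w_n)$ and with the same location, in the sense that $t^{(n)}_{\mathrm{mix}}-t^{(n)}_{\mathrm{sep}}=O(w_n)$; moreover $t_{\mathrm{mix}}^{(n)}$ satisfies the stated asymptotics. (1) Non-amenable graphs: $\mathbb G$ is an infinite graph with bounded degrees such that $\inf\{|\partial V|/|V|\}>0$, the infimum being over the finite non-empty sets $V$ of vertices and $\partial V$ being the set of vertices outside $V$ that have a neighbor in $V$; $V_n$ is an arbitrary set of $n$ vertices of $\mathbb G$ and $K_n=P_{\mathbb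 G}[V_n]$. Then $w_n=n\sqrt{\log n}$ and $t^{(n)}_{\mathrm{mix}}=\Theta(n\log n)$. (2) Transitive graphs with a sink: $G_n$ is a connected vertex-transitive graph on $n+1$ vertices, $V_n$ is obtained by removing one vertex, and $K_n=P_{G_n}[V_n]$. Then $w_n=\sqrt n$ and $t^{(n)}_{\mathrm{mix}}=n+o(n)$. (3) Wheel-like graphs: $d\in\mathbb N$ is fixed, $G_n$ is a graph on $n+1$ vertices with one vertex (the sink) of degree $n$ and all others of degree at most $d$, $V_n$ is obtained by removing the sink, and $K_n=P_{G_n}[V_n]$. Then $w_n=n\sqrt{\log n}$ and $t^{(n)}_{\mathrm{mix}}=\Theta(n\log n)$. (4) Discrete Euclidean balls: $d\ge1$ is fixed, $V_n=\{x\in\mathbb Z^d: x_1^2+\dots+x_d^2\le n^2\}$ and $K_n=P_{\mathbb Z^d}[V_n]$, where $\mathbb Z^d$ is the nearest-neighbor lattice. Then $w_n=\sqrt{n^d g_d(n)}$ with $g_1(n)=1$, $g_2(n)=n\log n$ and $g_d(n)=n^{d-1}$ for $d\ge3$, and $t^{(n)}_{\mathrm{mix}}=|V_n|+o(|V_n|)$.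 -/

import Mathlib

open Filter Topology Asymptotics

namespace ARW

/-- State of a site: empty, one sleeping particle, or active particles.
`active k` stands for `k + 1` active particles. -/
inductive SiteState
  | empty : SiteState
  | sleeping : SiteState
  | active (k : ℕ) : SiteState
  deriving DecidableEq

namespace SiteState

/-- Number of active particles at a site. -/
def activeCount : SiteState → ℕ
  | empty => 0
  | sleeping => 0
  | active k => k + 1

/-- Effect of the arrival of an active particle; it wakes up a sleeping particle. -/
def addActive : SiteState → SiteState
  | empty => active 0
  | sleeping => active 1
  | active k => active (k + 1)

/-- Effect of the departure of one active particle. -/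
def removeActive : SiteState → SiteState
  | empty => empty
  | sleeping => sleeping
  | active 0 => empty
  | active (k + 1) => active k

/-- The stable states: `false` is the empty site, `true` is a sleeping particle. -/
def ofBool : Bool → SiteState
  | false => empty
  | true => sleeping

end SiteState

noncomputable section

section Dynamics

variable {V : Type*} [Fintype V] [DecidableEq V]

/-- One active particle jumps from `x` to `y`. -/
def move (x y : V) (η : V → SiteState) : V → SiteState :=
  let ζ := Function.update η x (η x).removeActive
  Function.update ζ y (ζ y).addActive

/-- One active particle at `x` is killed. -/
def kill (x : V) (η : V → SiteState) : V → SiteState :=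
  Function.update η x (η x).removeActive

/-- The (lonely, active) particle at `x` falls asleep. -/
def fallAsleep (x : V) (η : V → SiteState) : V → SiteState :=
  Function.update η x SiteState.sleeping

/-- A configuration is stable if it has no active particle. -/
def IsStable (η : V → SiteState) : Prop := ∀ x, (η x).activeCount = 0

/-- Sum over all transitions `η → ζ` of the continuous-time activated random walk dynamics of
(rate of the transition) times `f ζ`: every active particle at `x` jumps to `y` at rate `K x y`
and is killed at rate `1 - ∑ y, K x y`; a particle that is active and alone on its site falls
asleep at rate `lam`. -/
def rateSum (K : V → V → ℝ) (lam : ℝ) (f : (V → SiteState) → ℝ) (η : V → SiteState) : ℝ :=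
  ∑ x, (((η x).activeCount : ℝ) *
      (∑ y, K x y * f (move x y η) + (1 - ∑ y, K x y) * f (kill x η))
    + if η x = SiteState.active 0 then lam * f (fallAsleep x η) else 0)

open Classical in
/-- `jumpLaw K lam n η ξ` is the probability that the jump chain of the continuous-time dynamics,
started from `η` (and stopped when it reaches a stable configuration), is at `ξ` after `n` jumps.
The jump chain chooses each transition with probability its rate divided by the total rate
`rateSum K lam 1 η`. -/
def jumpLaw (K : V → V → ℝ) (lam : ℝ) : ℕ → (V → SiteState) → (V → SiteState) → ℝ
  | 0, η, ξ => if η = ξ then 1 else 0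
  | n + 1, η, ξ =>
      if IsStable η then (if η = ξ then 1 else 0)
      else rateSum K lam (fun ζ => jumpLaw K lam n ζ ξ) η / rateSum K lam (fun _ => 1) η

/-- Probability that stabilization of `η` ends in the stable configuration `ξ`
(for stable `ξ` the sequence `jumpLaw K lam n η ξ` is nondecreasing in `n`). -/
def stabProb (K : V → V → ℝ) (lam : ℝ) (η ξ : V → SiteState) : ℝ :=
  ⨆ n, jumpLaw K lam n η ξ

/-- A stable configuration, seen as a configuration. -/
def ofStable (η : V → Bool) : V → SiteState := fun x => SiteState.ofBool (η x)

/-- Transition matrix of the `ARW(K, lam, ν)` chain on stable configurations: add an active particle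
at a `ν`-distributed site and stabilize. -/
def transitionMatrix (K : V → V → ℝ) (lam : ℝ) (ν : V → ℝ) :
    Matrix (V → Bool) (V → Bool) ℝ :=
  Matrix.of fun η ξ => ∑ x, ν x * stabProb K lam
    (Function.update (ofStable η) x (ofStable η x).addActive) (ofStable ξ)

/-- Standing assumptions on the parameters: `K` is substochastic and no principal submatrix
of it is stochastic, `lam` is positive, and `ν` is a probability distribution from which every site
can be reached by the `K`-walk. -/
structure IsAdmissible (K : V → V → ℝ) (lam : ℝ) (ν : V → ℝ) : Prop where
  kernel_nonneg : ∀ x y, 0 ≤ K x y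
  kernel_sum_le : ∀ x, ∑ y, K x y ≤ 1
  kernel_nondegenerate : ∀ S : Finset V, S.Nonempty → ∃ x ∈ S, ∑ y ∈ S, K x y ≠ 1
  rate_pos : 0 < lam
  law_nonneg : ∀ x, 0 ≤ ν x
  law_sum : ∑ x, ν x = 1
  law_reaches : ∀ x, ∃ y, 0 < ν y ∧ Relation.ReflTransGen (fun a b => 0 < K a b) y x

end Dynamics

section MarkovChain

variable {X : Type*} [Fintype X] [DecidableEq X]

/-- `μ` is an invariant probability distribution of the transition matrix `P`. -/
def IsInvariantLaw (P : Matrix X X ℝ) (μ : X → ℝ) : Prop :=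
  (∀ x, 0 ≤ μ x) ∧ ∑ x, μ x = 1 ∧ ∀ y, ∑ x, μ x * P x y = μ y

/-- The invariant probability distribution of `P` (meaningful when there is exactly one). -/
def invariantLaw (P : Matrix X X ℝ) : X → ℝ := Classical.epsilon (IsInvariantLaw P)

/-- Worst-case separation distance to equilibrium at time `t`. -/
def sepDistance (P : Matrix X X ℝ) (t : ℕ) : ℝ :=
  ⨆ p : X × X, (1 - (P ^ t) p.1 p.2 / invariantLaw P p.2)

/-- Worst-case total-variation distance to equilibrium at time `t`. -/
def tvDistance (P : Matrix X X ℝ) (t : ℕ) : ℝ :=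
  ⨆ p : X × Finset X, |∑ y ∈ p.2, (P ^ t) p.1 y - ∑ y ∈ p.2, invariantLaw P y|

end MarkovChain

/-- First time at which the distance `d` is at most `ε`. -/
def mixingTime (d : ℕ → ℝ) (ε : ℝ) : ℕ := sInf {t | d t ≤ ε}

/-- Cutoff for a sequence of distances to equilibrium: on the time scale `mixingTime (d n) (1/2)`,
the distance drops abruptly from `1` to `0`. -/
def HasCutoff (d : ℕ → ℕ → ℝ) : Prop :=
  ∀ α : ℝ, 0 ≤ α →
    (α < 1 → Tendsto (fun n => d n ⌊α * (mixingTime (d n) (1 / 2) : ℝ)⌋₊) atTop (𝓝 1)) ∧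
    (1 < α → Tendsto (fun n => d n ⌊α * (mixingTime (d n) (1 / 2) : ℝ)⌋₊) atTop (𝓝 0))

/-- The mixing window of the sequence of distances is `O(w)`. -/
def HasWindow (d : ℕ → ℕ → ℝ) (w : ℕ → ℝ) : Prop :=
  ∀ ε : ℝ, 0 < ε → ε < 1 / 2 →
    (fun n => (mixingTime (d n) ε : ℝ) - (mixingTime (d n) (1 - ε) : ℝ)) =O[atTop] w

/-- Both the separation distance and the total-variation distance of the sequence of chains `P`
exhibit a cutoff with window `O(w)`, and the two cutoffs have the same location up to `O(w)`. -/
def HasCommonCutoff {X : ℕ → Type*} [∀ n, Fintype (X n)] [∀ n, DecidableEq (X n)]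
    (P : ∀ n, Matrix (X n) (X n) ℝ) (w : ℕ → ℝ) : Prop :=
  HasCutoff (fun n => sepDistance (P n)) ∧ HasWindow (fun n => sepDistance (P n)) w ∧
  HasCutoff (fun n => tvDistance (P n)) ∧ HasWindow (fun n => tvDistance (P n)) w ∧
  (fun n => (mixingTime (tvDistance (P n)) (1 / 2) : ℝ)
    - (mixingTime (sepDistance (P n)) (1 / 2) : ℝ)) =O[atTop] w

section Graphs

variable {W : Type*} [DecidableEq W]

open Classical in
/-- Transition matrix of simple random walk on `G`, restricted to the finite set `S`. -/
def walkKernel (G : SimpleGraph W) (S : Finset W) (x y : S) : ℝ :=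
  if G.Adj x y then 1 / ((G.neighborSet (x : W)).ncard : ℝ) else 0

/-- Transition matrix of the ARW chain on `S` with walks of `G` killed outside `S`,
sleeping rate `lam` and uniform insertion. -/
def graphChain (G : SimpleGraph W) (S : Finset W) (lam : ℝ) : Matrix (S → Bool) (S → Bool) ℝ :=
  transitionMatrix (walkKernel G S) lam (fun _ => 1 / (S.card : ℝ))

/-- Outer vertex boundary. -/
def outerBoundary (G : SimpleGraph W) (S : Finset W) : Set W :=
  {y | y ∉ S ∧ ∃ x ∈ S, G.Adj x y}

/-- Non-amenability: positive isoperimetric constant. -/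
def NonAmenable (G : SimpleGraph W) : Prop :=
  0 < ⨅ S : {S : Finset W // S.Nonempty}, ((outerBoundary G S.1).ncard : ℝ) / (S.1.card : ℝ)

/-- Vertex-transitivity. -/
def VertexTransitive (G : SimpleGraph W) : Prop := ∀ x y, ∃ φ : G ≃g G, φ x = y

end Graphs

/-- The nearest-neighbour graph on `ℤ ^ d`. -/
def latticeGraph (d : ℕ) : SimpleGraph (Fin d → ℤ) where
  Adj x y := ∑ i, |x i - y i| = 1
  symm := ⟨fun x y h => by simpa only [abs_sub_comm] using h⟩
  loopless := ⟨fun x h => by simp at h⟩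

/-- The discrete Euclidean ball of radius `n` in `ℤ ^ d`. -/
def latticeBall (d n : ℕ) : Finset (Fin d → ℤ) :=
  (Finset.Icc (fun _ => -(n : ℤ)) (fun _ => (n : ℤ))).filter fun x => ∑ i, x i ^ 2 ≤ (n : ℤ) ^ 2

theorem mem_latticeBall (d n : ℕ) (x : Fin d → ℤ) :
    x ∈ latticeBall d n ↔ ∑ i, x i ^ 2 ≤ (n : ℤ) ^ 2 := by
  simp only [latticeBall, Finset.mem_filter, Finset.mem_Icc, and_iff_right_iff_imp]
  intro h
  have key : ∀ i, |x i| ≤ (n : ℤ) := fun i => by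
    have h1 : x i ^ 2 ≤ ∑ j, x j ^ 2 :=
      Finset.single_le_sum (f := fun j => x j ^ 2) (fun j _ => sq_nonneg _) (Finset.mem_univ i)
    exact abs_le_of_sq_le_sq (h1.trans h) (by positivity)
  exact ⟨fun i => (abs_le.mp (key i)).1, fun i => (abs_le.mp (key i)).2⟩

/-- The scale `g_d(n)`. -/
def ballScale (d n : ℕ) : ℝ :=
  if d = 1 then 1 else if d = 2 then (n : ℝ) * Real.log n else (n : ℝ) ^ (d - 1)

end

end ARW

/-!
The chain is compared with internal aggregation: particles are released one after the other at
`ν`-distributed sites, and each walks until it finds a vacant site, which it fills, or is killed.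
Let `vacantProb K ν t ∅` be the probability that some site is still vacant after `t` particles.

**Comparison.** By the abelian property (`act_comm`), the stable configuration that is reached does
not depend in law on the order in which active sites are toppled: the stabilization law is invariant
under topplings (`isTopplingInvariant_stabProb`). Hence all `t` particles may be inserted before
anything is stabilized (`transitionMatrix_pow`), and the inserted particles may be moved first until
they sit on distinct sites, which is internal aggregation
(`IsTopplingInvariant.iterate_insertStep_addOn`). Once every site is active, the stabilization law
is always the same law `fullStabLaw` (`IsTopplingInvariant.eq_of_forall_active`), so that the filling
time of aggregation acts as a strong stationary time, and it is optimal for the passage from the empty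
to the full configuration. Therefore the separation distance *equals* `vacantProb K ν t ∅`
(`IsAdmissible.sepDistance_eq`). The invariant probability of the full configuration is at least
`1 - |V| / (1 + lam)`, which bounds the total-variation distance from below
(`IsAdmissible.le_tvDistance`). As `lam / |V| → ∞`, both distances have the same cutoff.

**Concentration.** Two aggregation processes that differ in one filled site can be coupled so that
this persists until the discrepancy disappears. If every site is visited by the walk started from `ν`
with probability at least `1 / ρ`, then one more filled site changes the mean filling time by at most
`ρ` (`meanFill_diff`). So the Doob martingale of the filling time has conditional variances at most
`ρ`, the filling time has variance at most `ρ * m`, where `m` is its mean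
(`exists_fillTime_concentration`), and Chebyshev's inequality gives a cutoff at `m` with window
`√(ρ * m)` as soon as `ρ = o(m)` (`exists_location`).

**Location.** For uniform `ν` on `n` sites, `ρ = n` is always allowed. If the walk visits a bounded
number of sites on average, aggregation is a coupon collector's problem up to constants and `m` is of
order `n log n` (`cutoff_of_sum_meanHit_le`). This applies to wheel-like graphs, where each step leads
to the sink with probability at least `1 / d`, and to non-amenable graphs, where Cheeger's inequality
bounds the mean lifetime of the walk (`sum_lifetime_le`). If on the other hand `ρ log n = o(n)`, a
Chernoff bound shows that few more than `n` particles suffice, and `m` is asymptotic to `n`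
(`cutoff_of_meanHit_ge`). This applies to transitive graphs, where `ρ = 2` by symmetry
(`half_le_meanHit_of_transitive`), and to lattice balls, where a mean hitting probability is the ratio
of the mean lifetime of the walk, which is at least of the order of the radius, and the Green
function, times `1 / |V|` (`IsKilled.mul_lifetime_le`); explicit superharmonic functions bound the
latter (`exists_le_sum_hitProb`).
-/

set_option linter.unusedSectionVars false

namespace ARW

noncomputable section

/-! ### Killed walks on a finite set -/

section KilledWalk

variable {V : Type*} [Fintype V] [DecidableEq V] {K : V → V → ℝ}

/-- The kernel of a walk on a finite set that is eventually killed from every starting point. -/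
structure IsKilled (K : V → V → ℝ) : Prop where
  nonneg : ∀ x y, 0 ≤ K x y
  sum_le : ∀ x, ∑ y, K x y ≤ 1
  nondegenerate : ∀ S : Finset V, S.Nonempty → ∃ x ∈ S, ∑ y ∈ S, K x y ≠ 1

/-- A nonempty set contains a site from which the walk leaves the set or is killed. -/
theorem IsKilled.exists_leak (hK : IsKilled K) {S : Finset V} (hS : S.Nonempty) :
    ∃ x ∈ S, (∃ y ∉ S, 0 < K x y) ∨ ∑ y, K x y < 1 := by
  obtain ⟨x, hx, hne⟩ := hK.nondegenerate S hS
  refine ⟨x, hx, ?_⟩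
  by_contra! hcon
  obtain ⟨h1, h2⟩ := hcon
  apply hne
  have h3 : ∑ y ∈ S, K x y = ∑ y, K x y :=
    Finset.sum_subset (Finset.subset_univ _) fun y _ hy => le_antisymm (h1 y hy) (hK.nonneg x y)
  rw [h3]
  exact le_antisymm (hK.sum_le x) h2

/-- Maximum principle: a function that is subharmonic on `A` and nonpositive off `A` is
nonpositive. -/
theorem IsKilled.nonpos_of_le (hK : IsKilled K) {A : Finset V} {u : V → ℝ}
    (hu : ∀ y, u y ≤ if y ∈ A then ∑ w, K y w * u w else 0) (y : V) : u y ≤ 0 := by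
  by_contra! hy
  obtain ⟨y₀, -, hmax⟩ := Finset.exists_max_image Finset.univ u ⟨y, Finset.mem_univ y⟩
  have hM : 0 < u y₀ := hy.trans_le (hmax y (Finset.mem_univ y))
  obtain ⟨x, hx, hleak⟩ := hK.exists_leak (S := Finset.univ.filter fun z => u z = u y₀)
    ⟨y₀, by simp⟩
  simp only [Finset.mem_filter, Finset.mem_univ, true_and] at hx
  have hxA : u y₀ ≤ ∑ w, K x w * u w := by
    have := hu x
    split_ifs at this with h
    · rwa [hx] at this
    · rw [hx] at this; linarith
  have hle : ∀ w, K x w * u w ≤ K x w * u y₀ := fun w =>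
    mul_le_mul_of_nonneg_left (hmax w (Finset.mem_univ w)) (hK.nonneg x w)
  have hsum : (∑ w, K x w) * u y₀ ≤ u y₀ :=
    mul_le_of_le_one_left hM.le (hK.sum_le x)
  rcases hleak with ⟨w, hw, hKw⟩ | hlt
  · simp only [Finset.mem_filter, Finset.mem_univ, true_and] at hw
    have : ∑ w, K x w * u w < ∑ w, K x w * u y₀ :=
      Finset.sum_lt_sum (fun w _ => hle w) ⟨w, Finset.mem_univ w,
        mul_lt_mul_of_pos_left (lt_of_le_of_ne (hmax w (Finset.mem_univ w)) hw) hKw⟩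
    rw [← Finset.sum_mul] at this
    linarith
  · have : ∑ w, K x w * u w ≤ ∑ w, K x w * u y₀ := Finset.sum_le_sum fun w _ => hle w
    rw [← Finset.sum_mul] at this
    nlinarith

/-- Comparison of a subsolution and a supersolution of `u = 1_A K u + g`. -/
theorem IsKilled.le_of_sub_super (hK : IsKilled K) {A : Finset V} {u v g : V → ℝ}
    (hu : ∀ y, u y ≤ (if y ∈ A then ∑ w, K y w * u w else 0) + g y)
    (hv : ∀ y, (if y ∈ A then ∑ w, K y w * v w else 0) + g y ≤ v y) (y : V) : u y ≤ v y := by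
  have := hK.nonpos_of_le (A := A) (u := fun y => u y - v y) (fun y => by
    have h1 := hu y
    have h2 := hv y
    split_ifs at h1 h2 ⊢ with h
    · simp only [mul_sub, Finset.sum_sub_distrib]; linarith
    · linarith) y
  linarith

theorem IsKilled.exists_dirichlet (hK : IsKilled K) (A : Finset V) (g : V → ℝ) :
    ∃ u : V → ℝ, ∀ y, u y = (if y ∈ A then ∑ w, K y w * u w else 0) + g y := by
  let L : (V → ℝ) →ₗ[ℝ] (V → ℝ) :=
    { toFun := fun u y => u y - if y ∈ A then ∑ w, K y w * u w else 0
      map_add' := fun u v => by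
        funext y
        simp only [Pi.add_apply, mul_add, Finset.sum_add_distrib]
        split_ifs <;> ring
      map_smul' := fun c u => by
        funext y
        simp only [Pi.smul_apply, smul_eq_mul, RingHom.id_apply]
        split_ifs
        · rw [mul_sub, Finset.mul_sum]
          congr 1
          exact Finset.sum_congr rfl fun w _ => by ring
        · ring }
  have hinj : Function.Injective L := by
    rw [← LinearMap.ker_eq_bot, LinearMap.ker_eq_bot']
    intro u hu
    have hu' : ∀ y, u y - (if y ∈ A then ∑ w, K y w * u w else 0) = 0 := fun y => congrFun hu y
    funext y
    refine le_antisymm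
      (hK.le_of_sub_super (A := A) (u := u) (v := 0) (g := 0) (fun y => ?_) (fun y => ?_) y)
      (hK.le_of_sub_super (A := A) (u := 0) (v := u) (g := 0) (fun y => ?_) (fun y => ?_) y)
    · have := hu' y; simp only [Pi.zero_apply, add_zero]; linarith
    · simp
    · simp
    · have := hu' y; simp only [Pi.zero_apply, add_zero]; linarith
  obtain ⟨u, hu⟩ := LinearMap.injective_iff_surjective.mp hinj g
  refine ⟨u, fun y => ?_⟩
  have : u y - (if y ∈ A then ∑ w, K y w * u w else 0) = g y := congrFun hu y
  linarith

/-- The solution `u` of the Dirichlet problem `u = 1_A K u + g`. -/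
def dirichlet (K : V → V → ℝ) (A : Finset V) (g : V → ℝ) : V → ℝ :=
  Classical.epsilon fun u => ∀ y, u y = (if y ∈ A then ∑ w, K y w * u w else 0) + g y

theorem IsKilled.dirichlet_eq (hK : IsKilled K) (A : Finset V) (g : V → ℝ) (y : V) :
    dirichlet K A g y = (if y ∈ A then ∑ w, K y w * dirichlet K A g w else 0) + g y :=
  Classical.epsilon_spec (hK.exists_dirichlet A g) y

theorem IsKilled.le_dirichlet (hK : IsKilled K) {A : Finset V} {u g : V → ℝ}
    (hu : ∀ y, u y ≤ (if y ∈ A then ∑ w, K y w * u w else 0) + g y) (y : V) :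
    u y ≤ dirichlet K A g y :=
  hK.le_of_sub_super hu (fun y => (hK.dirichlet_eq A g y).ge) y

theorem IsKilled.dirichlet_le (hK : IsKilled K) {A : Finset V} {u g : V → ℝ}
    (hu : ∀ y, (if y ∈ A then ∑ w, K y w * u w else 0) + g y ≤ u y) (y : V) :
    dirichlet K A g y ≤ u y :=
  hK.le_of_sub_super (fun y => (hK.dirichlet_eq A g y).le) hu y

theorem IsKilled.eq_dirichlet (hK : IsKilled K) {A : Finset V} {u g : V → ℝ}
    (hu : ∀ y, u y = (if y ∈ A then ∑ w, K y w * u w else 0) + g y) :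
    u = dirichlet K A g :=
  funext fun y => le_antisymm (hK.le_dirichlet (fun y => (hu y).le) y)
    (hK.dirichlet_le (fun y => (hu y).ge) y)

theorem IsKilled.dirichlet_mono (hK : IsKilled K) {A : Finset V} {g g' : V → ℝ}
    (h : ∀ y, g y ≤ g' y) (y : V) : dirichlet K A g y ≤ dirichlet K A g' y :=
  hK.le_dirichlet (fun y => (hK.dirichlet_eq A g y).le.trans (by linarith [h y])) y

theorem IsKilled.dirichlet_nonneg (hK : IsKilled K) {A : Finset V} {g : V → ℝ}
    (h : ∀ y, 0 ≤ g y) (y : V) : 0 ≤ dirichlet K A g y :=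
  hK.le_dirichlet (u := 0) (fun y => by simpa using h y) y

theorem IsKilled.dirichlet_lin (hK : IsKilled K) {A : Finset V} {g g' : V → ℝ} (a b : ℝ) :
    dirichlet K A (fun y => a * g y + b * g' y)
      = fun y => a * dirichlet K A g y + b * dirichlet K A g' y := by
  refine (hK.eq_dirichlet fun y => ?_).symm
  rw [hK.dirichlet_eq A g y, hK.dirichlet_eq A g' y]
  split_ifs
  · simp only [mul_add, Finset.sum_add_distrib, Finset.mul_sum]
    rw [Finset.sum_congr rfl fun w _ => mul_left_comm a (K y w) _,
      Finset.sum_congr rfl fun w _ => mul_left_comm b (K y w) _]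
    ring
  · ring

/-- Probability that the walk started from a given site visits `x`. -/
def hitProb (K : V → V → ℝ) (x : V) : V → ℝ :=
  dirichlet K (Finset.univ.erase x) fun y => if y = x then 1 else 0

/-- Probability that the walk started from the law `ν` visits `x`. -/
def meanHit (K : V → V → ℝ) (ν : V → ℝ) (x : V) : ℝ := ∑ y, ν y * hitProb K x y

theorem IsKilled.hitProb_self (hK : IsKilled K) (x : V) : hitProb K x x = 1 := by
  rw [hitProb, hK.dirichlet_eq]; simp

theorem IsKilled.hitProb_of_ne (hK : IsKilled K) {x y : V} (h : y ≠ x) :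
    hitProb K x y = ∑ w, K y w * hitProb K x w := by
  rw [hitProb, hK.dirichlet_eq]; simp [h]

theorem IsKilled.hitProb_nonneg (hK : IsKilled K) (x y : V) : 0 ≤ hitProb K x y :=
  hK.dirichlet_nonneg (fun y => by split_ifs <;> norm_num) y

theorem IsKilled.hitProb_le_one (hK : IsKilled K) (x y : V) : hitProb K x y ≤ 1 := by
  refine hK.dirichlet_le (u := fun _ => 1) (fun y => ?_) y
  have := hK.sum_le y
  by_cases h : y = x
  · simp [h]
  · simpa [h] using this

theorem IsKilled.hitProb_pos (hK : IsKilled K) {x y : V}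
    (h : Relation.ReflTransGen (fun a b => 0 < K a b) y x) : 0 < hitProb K x y := by
  induction h using Relation.ReflTransGen.head_induction_on with
  | refl => rw [hK.hitProb_self]; norm_num
  | head hab _ ih =>
    rename_i a b _
    by_cases hax : a = x
    · rw [hax, hK.hitProb_self]; norm_num
    · rw [hK.hitProb_of_ne hax]
      exact Finset.sum_pos' (fun w _ => mul_nonneg (hK.nonneg _ _) (hK.hitProb_nonneg _ _))
        ⟨b, Finset.mem_univ b, mul_pos hab ih⟩

theorem IsKilled.meanHit_nonneg (hK : IsKilled K) {ν : V → ℝ} (hν : ∀ x, 0 ≤ ν x) (x : V) :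
    0 ≤ meanHit K ν x :=
  Finset.sum_nonneg fun y _ => mul_nonneg (hν y) (hK.hitProb_nonneg x y)

theorem IsKilled.meanHit_le_one (hK : IsKilled K) {ν : V → ℝ} (hν : ∀ x, 0 ≤ ν x)
    (hν1 : ∑ x, ν x = 1) (x : V) : meanHit K ν x ≤ 1 := by
  have : meanHit K ν x ≤ ∑ y, ν y * 1 := Finset.sum_le_sum fun y _ =>
    mul_le_mul_of_nonneg_left (hK.hitProb_le_one x y) (hν y)
  simpa only [mul_one, hν1] using this

/-- The expected number of visited sites is at most the expected lifetime: here `u` is any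
supersolution of the equation for the expected lifetime. -/
theorem IsKilled.sum_hitProb_le (hK : IsKilled K) {u : V → ℝ}
    (hu : ∀ y, 1 + ∑ w, K y w * u w ≤ u y) (y : V) : ∑ x, hitProb K x y ≤ u y := by
  refine hK.le_of_sub_super (A := Finset.univ) (g := fun _ => 1) (u := fun y => ∑ x, hitProb K x y)
    (fun y => ?_) (fun y => by simpa [add_comm] using hu y) y
  simp only [Finset.mem_univ, if_true, Finset.mul_sum]
  rw [Finset.sum_comm, add_comm]
  have h0 : (1 : ℝ) = ∑ x, if x = y then 1 else 0 := by simp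
  rw [h0, ← Finset.sum_add_distrib]
  refine Finset.sum_le_sum fun x _ => ?_
  have h1 : 0 ≤ ∑ w, K y w * hitProb K x w :=
    Finset.sum_nonneg fun w _ => mul_nonneg (hK.nonneg _ _) (hK.hitProb_nonneg _ _)
  by_cases h : x = y
  · subst h; rw [hK.hitProb_self, if_pos rfl]; linarith
  · rw [hK.hitProb_of_ne (Ne.symm h), if_neg h]; linarith

end KilledWalk

/-! ### Internal aggregation -/

section Aggregation

variable {V : Type*} [Fintype V] [DecidableEq V] {K : V → V → ℝ} {ν : V → ℝ}

/-- The expectation of `f` at the set of filled sites, after one particle has been released at `y`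
and has walked until it has found a site outside the set `A` of filled sites, which it then fills,
or until it has been killed. -/
def release (K : V → V → ℝ) (f : Finset V → ℝ) (A : Finset V) : V → ℝ :=
  dirichlet K A fun y => if y ∈ A then (1 - ∑ w, K y w) * f A else f (insert y A)

/-- The transition operator of internal aggregation with insertion law `ν`. -/
def aggStep (K : V → V → ℝ) (ν : V → ℝ) (f : Finset V → ℝ) (A : Finset V) : ℝ :=
  ∑ y, ν y * release K f A y

/-- Probability that some site is still vacant when `t` further particles have been released and
the set of filled sites was `A`. -/
def vacantProb (K : V → V → ℝ) (ν : V → ℝ) (t : ℕ) : Finset V → ℝ :=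
  (aggStep K ν)^[t] fun A => if A = Finset.univ then 0 else 1

/-- Supersolutions bound the law of the released particle from above. -/
theorem IsKilled.release_le (hK : IsKilled K) {f : Finset V → ℝ} {A : Finset V} {u : V → ℝ}
    (h1 : ∀ y ∈ A, ∑ w, K y w * u w + (1 - ∑ w, K y w) * f A ≤ u y)
    (h2 : ∀ y ∉ A, f (insert y A) ≤ u y) (y : V) : release K f A y ≤ u y :=
  hK.dirichlet_le (fun y => by
    by_cases h : y ∈ A
    · simpa [h] using h1 y h
    · simpa [h] using h2 y h) y

theorem IsKilled.le_release (hK : IsKilled K) {f : Finset V → ℝ} {A : Finset V} {u : V → ℝ}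
    (h1 : ∀ y ∈ A, u y ≤ ∑ w, K y w * u w + (1 - ∑ w, K y w) * f A)
    (h2 : ∀ y ∉ A, u y ≤ f (insert y A)) (y : V) : u y ≤ release K f A y :=
  hK.le_dirichlet (fun y => by
    by_cases h : y ∈ A
    · simpa [h] using h1 y h
    · simpa [h] using h2 y h) y

theorem IsKilled.eq_release (hK : IsKilled K) {f : Finset V → ℝ} {A : Finset V} {u : V → ℝ}
    (h1 : ∀ y ∈ A, u y = ∑ w, K y w * u w + (1 - ∑ w, K y w) * f A)
    (h2 : ∀ y ∉ A, u y = f (insert y A)) : u = release K f A :=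
  funext fun y => le_antisymm (hK.le_release (fun y h => (h1 y h).le) (fun y h => (h2 y h).le) y)
    (hK.release_le (fun y h => (h1 y h).ge) (fun y h => (h2 y h).ge) y)

theorem IsKilled.release_mem (hK : IsKilled K) (f : Finset V → ℝ) {A : Finset V} {y : V}
    (h : y ∈ A) :
    release K f A y = ∑ w, K y w * release K f A w + (1 - ∑ w, K y w) * f A := by
  rw [release, hK.dirichlet_eq]; simp [h]

theorem IsKilled.release_not_mem (hK : IsKilled K) (f : Finset V → ℝ) {A : Finset V} {y : V}
    (h : y ∉ A) : release K f A y = f (insert y A) := by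
  rw [release, hK.dirichlet_eq]; simp [h]

theorem IsKilled.release_mono (hK : IsKilled K) {f g : Finset V → ℝ} {A : Finset V}
    (h0 : f A ≤ g A) (h : ∀ y ∉ A, f (insert y A) ≤ g (insert y A)) (y : V) :
    release K f A y ≤ release K g A y :=
  hK.dirichlet_mono (fun y => by
    have := hK.sum_le y
    split_ifs with hy
    · exact mul_le_mul_of_nonneg_left h0 (by linarith)
    · exact h y hy) y

theorem IsKilled.release_lin (hK : IsKilled K) {f g : Finset V → ℝ} {A : Finset V} (a b : ℝ)
    (y : V) : release K (fun B => a * f B + b * g B) A y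
      = a * release K f A y + b * release K g A y := by
  have := congrFun (hK.dirichlet_lin (A := A)
    (g := fun y => if y ∈ A then (1 - ∑ w, K y w) * f A else f (insert y A))
    (g' := fun y => if y ∈ A then (1 - ∑ w, K y w) * g A else g (insert y A)) a b) y
  rw [release, release, release, ← this]
  congr 1
  funext y
  split_ifs <;> ring

theorem IsKilled.release_const (hK : IsKilled K) (c : ℝ) (A : Finset V) (y : V) :
    release K (fun _ => c) A y = c :=
  (congrFun (hK.eq_release (u := fun _ => c) (f := fun _ => c) (A := A)
    (fun y _ => by rw [← Finset.sum_mul]; ring) (fun _ _ => rfl)) y).symm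

theorem aggStep_mono (hK : IsKilled K) (hν : ∀ x, 0 ≤ ν x) {f g : Finset V → ℝ} {A : Finset V}
    (h0 : f A ≤ g A) (h : ∀ y ∉ A, f (insert y A) ≤ g (insert y A)) :
    aggStep K ν f A ≤ aggStep K ν g A :=
  Finset.sum_le_sum fun y _ => mul_le_mul_of_nonneg_left (hK.release_mono h0 h y) (hν y)

theorem aggStep_lin (hK : IsKilled K) {f g : Finset V → ℝ} {A : Finset V} (a b : ℝ) :
    aggStep K ν (fun B => a * f B + b * g B) A = a * aggStep K ν f A + b * aggStep K ν g A := by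
  simp only [aggStep, hK.release_lin, Finset.mul_sum, ← Finset.sum_add_distrib]
  exact Finset.sum_congr rfl fun y _ => by ring

theorem aggStep_const (hK : IsKilled K) (hν1 : ∑ x, ν x = 1) (c : ℝ) (A : Finset V) :
    aggStep K ν (fun _ => c) A = c := by
  simp only [aggStep, hK.release_const, ← Finset.sum_mul, hν1, one_mul]

theorem aggStep_smul (hK : IsKilled K) {f : Finset V → ℝ} {A : Finset V} (a : ℝ) :
    aggStep K ν (fun B => a * f B) A = a * aggStep K ν f A := by
  have := aggStep_lin (ν := ν) hK (f := f) (g := f) (A := A) a 0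
  simpa using this

theorem aggStep_sum (hK : IsKilled K) {ι : Type*} (s : Finset ι) (f : ι → Finset V → ℝ)
    (A : Finset V) : aggStep K ν (fun B => ∑ i ∈ s, f i B) A = ∑ i ∈ s, aggStep K ν (f i) A := by
  classical
  induction s using Finset.induction_on with
  | empty =>
    have := aggStep_smul (ν := ν) hK (f := fun _ => 0) (A := A) 0
    simpa using this
  | insert i s hi ih =>
    have := aggStep_lin (ν := ν) hK (f := f i) (g := fun B => ∑ i ∈ s, f i B) (A := A) 1 1
    simp only [one_mul] at this
    simp only [Finset.sum_insert hi, this, ih]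

theorem aggStep_univ (hK : IsKilled K) (hν1 : ∑ x, ν x = 1) (f : Finset V → ℝ) :
    aggStep K ν f Finset.univ = f Finset.univ := by
  have : release K f Finset.univ = fun _ => f Finset.univ :=
    (hK.eq_release (fun y _ => by rw [← Finset.sum_mul]; ring) (fun y h => by simp at h)).symm
  simp only [aggStep, this, ← Finset.sum_mul, hν1, one_mul]

theorem vacantProb_succ (t : ℕ) :
    vacantProb K ν (t + 1) = aggStep K ν (vacantProb K ν t) :=
  Function.iterate_succ_apply' _ _ _

end Aggregation

/-! ### The filling time of aggregation -/

section FillTime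

variable {V : Type*} [Fintype V] [DecidableEq V] {K : V → V → ℝ} {ν : V → ℝ}

theorem vacantProb_univ (hK : IsKilled K) (hν1 : ∑ x, ν x = 1) (t : ℕ) :
    vacantProb K ν t Finset.univ = 0 := by
  induction t with
  | zero => simp [vacantProb]
  | succ t ih => rw [vacantProb_succ, aggStep_univ hK hν1, ih]

theorem vacantProb_nonneg (hK : IsKilled K) (hν : ∀ x, 0 ≤ ν x) (hν1 : ∑ x, ν x = 1) (t : ℕ)
    (A : Finset V) : 0 ≤ vacantProb K ν t A := by
  induction t generalizing A with
  | zero => simp only [vacantProb, Function.iterate_zero, id]; split_ifs <;> norm_num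
  | succ t ih =>
    rw [vacantProb_succ, ← aggStep_const hK hν1 0 A]
    exact aggStep_mono hK hν (ih _) fun y _ => ih _

theorem vacantProb_le_one (hK : IsKilled K) (hν : ∀ x, 0 ≤ ν x) (hν1 : ∑ x, ν x = 1) (t : ℕ)
    (A : Finset V) : vacantProb K ν t A ≤ 1 := by
  induction t generalizing A with
  | zero => simp only [vacantProb, Function.iterate_zero, id]; split_ifs <;> norm_num
  | succ t ih =>
    rw [vacantProb_succ, ← aggStep_const hK hν1 1 A]
    exact aggStep_mono hK hν (ih _) fun y _ => ih _

theorem vacantProb_eq_one (hK : IsKilled K) (hν : ∀ x, 0 ≤ ν x) (hν1 : ∑ x, ν x = 1) (t : ℕ)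
    (A : Finset V) (h : A.card + t < Fintype.card V) : vacantProb K ν t A = 1 := by
  refine le_antisymm (vacantProb_le_one hK hν hν1 t A) ?_
  induction t generalizing A with
  | zero =>
    have : A ≠ Finset.univ := by rintro rfl; simp [Finset.card_univ] at h
    simp [vacantProb, this]
  | succ t ih =>
    rw [vacantProb_succ]
    calc (1 : ℝ) = aggStep K ν (fun _ => 1) A := (aggStep_const hK hν1 1 A).symm
      _ ≤ _ := aggStep_mono hK hν (ih _ (by omega)) fun y hy =>
        ih _ (by rw [Finset.card_insert_of_notMem hy]; omega)

/-- One more particle changes the expectation of `f` by at most as much as `f` may change when one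
more site is filled: the two aggregation processes, coupled through the same particles, keep
differing in at most one site. -/
theorem aggStep_diff (hK : IsKilled K) (hν : ∀ x, 0 ≤ ν x) (hν1 : ∑ x, ν x = 1)
    {f : Finset V → ℝ} {ρ : ℝ} (h0 : ∀ A x, f (insert x A) ≤ f A)
    (h1 : ∀ A x, f A ≤ f (insert x A) + ρ) (A : Finset V) (x : V) :
    aggStep K ν f (insert x A) ≤ aggStep K ν f A ∧
      aggStep K ν f A ≤ aggStep K ν f (insert x A) + ρ := by
  have hρ : 0 ≤ ρ := by linarith [h0 A x, h1 A x]
  by_cases hx : x ∈ A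
  · rw [Finset.insert_eq_of_mem hx]; exact ⟨le_rfl, by linarith⟩
  have hkill : ∀ y, 0 ≤ 1 - ∑ w, K y w := fun y => by linarith [hK.sum_le y]
  have hv1 : ∀ y, release K f (insert x A) y ≤ f (insert x A) :=
    hK.release_le (u := fun _ => f (insert x A))
      (fun y _ => by rw [← Finset.sum_mul]; linarith) fun y _ => h0 _ _
  have hv2 : ∀ y, f (insert x A) - ρ ≤ release K f (insert x A) y :=
    hK.le_release (u := fun _ => f (insert x A) - ρ)
      (fun y _ => by
        rw [← Finset.sum_mul]
        nlinarith [mul_nonneg (hkill y) hρ])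
      fun y _ => by linarith [h1 (insert x A) y]
  have hvu : ∀ y, release K f (insert x A) y ≤ release K f A y := by
    refine hK.le_release (fun y hy => ?_) fun y hy => ?_
    · rw [hK.release_mem f (Finset.mem_insert_of_mem hy)]
      linarith [mul_le_mul_of_nonneg_left (h0 A x) (hkill y)]
    · by_cases hyx : y = x
      · subst hyx; exact hv1 y
      · rw [hK.release_not_mem f (by simp [hyx, hy]), Finset.insert_comm]
        exact h0 _ _
  have huv : ∀ y, release K f A y ≤ release K f (insert x A) y + ρ := by
    refine hK.release_le (u := fun y => release K f (insert x A) y + ρ) (fun y hy => ?_)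
      fun y hy => ?_
    · rw [hK.release_mem f (Finset.mem_insert_of_mem hy)]
      simp only [mul_add, Finset.sum_add_distrib, ← Finset.sum_mul]
      linarith [mul_le_mul_of_nonneg_left (h1 A x) (hkill y)]
    · by_cases hyx : y = x
      · subst hyx; linarith [hv2 y]
      · rw [hK.release_not_mem f (by simp [hyx, hy]), Finset.insert_comm]
        exact h1 _ _
  refine ⟨Finset.sum_le_sum fun y _ => mul_le_mul_of_nonneg_left (hvu y) (hν y), ?_⟩
  calc aggStep K ν f A ≤ ∑ y, ν y * (release K f (insert x A) y + ρ) :=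
        Finset.sum_le_sum fun y _ => mul_le_mul_of_nonneg_left (huv y) (hν y)
    _ = _ := by simp only [mul_add, Finset.sum_add_distrib, ← Finset.sum_mul, hν1, aggStep, one_mul]

/-- If `x` is the only vacant site, the next particle fills it with probability `meanHit K ν x`. -/
theorem aggStep_of_insert_eq_univ (hK : IsKilled K) (hν1 : ∑ x, ν x = 1) {f : Finset V → ℝ}
    {A : Finset V} {x : V} (hx : x ∉ A) (h : insert x A = Finset.univ)
    (hf : f Finset.univ = 0) : aggStep K ν f A = (1 - meanHit K ν x) * f A := by
  have : (fun y => f A * (1 - hitProb K x y)) = release K f A := by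
    refine hK.eq_release (fun y hy => ?_) fun y hy => ?_
    · rw [hK.hitProb_of_ne (x := x) (y := y) (by rintro rfl; exact hx hy)]
      have : ∀ w, K y w * (f A * (1 - hitProb K x w))
          = K y w * f A - f A * (K y w * hitProb K x w) := fun w => by ring
      simp only [this, Finset.sum_sub_distrib, ← Finset.sum_mul, ← Finset.mul_sum]
      ring
    · have : y = x := by
        have := Finset.mem_univ y
        rw [← h, Finset.mem_insert] at this
        exact this.resolve_right hy
      subst this
      rw [h, hf, hK.hitProb_self]; ring
  rw [aggStep, ← this]
  have : ∀ y, ν y * (f A * (1 - hitProb K x y)) = ν y * f A - (ν y * hitProb K x y) * f A :=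
    fun y => by ring
  simp only [this, Finset.sum_sub_distrib, ← Finset.sum_mul, hν1, meanHit]
  ring

/-- Expected number of particles, among the next `t`, that are released before all sites are
filled. -/
def meanFill (K : V → V → ℝ) (ν : V → ℝ) (t : ℕ) (A : Finset V) : ℝ :=
  ∑ s ∈ Finset.range t, vacantProb K ν s A

theorem meanFill_succ (hK : IsKilled K) (t : ℕ) (A : Finset V) :
    meanFill K ν (t + 1) A
      = (if A = Finset.univ then 0 else 1) + aggStep K ν (meanFill K ν t) A := by
  induction t with
  | zero =>
    have h0 : meanFill K ν 0 = fun A => 0 * vacantProb K ν 0 A := by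
      funext B; simp [meanFill]
    rw [h0, aggStep_smul hK, zero_mul, add_zero]
    simp [meanFill, vacantProb]
  | succ t ih =>
    have h1 : meanFill K ν (t + 1) = fun A => 1 * meanFill K ν t A + 1 * vacantProb K ν t A := by
      funext B; simp [meanFill, Finset.sum_range_succ]
    have h2 : meanFill K ν (t + 1 + 1) A
        = meanFill K ν (t + 1) A + vacantProb K ν (t + 1) A := by
      simp [meanFill, Finset.sum_range_succ]
    rw [h2, ih, h1, aggStep_lin hK, vacantProb_succ]
    ring

theorem meanFill_univ (hK : IsKilled K) (hν1 : ∑ x, ν x = 1) (t : ℕ) :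
    meanFill K ν t Finset.univ = 0 :=
  Finset.sum_eq_zero fun s _ => vacantProb_univ hK hν1 s

/-- Filling one more site shortens the filling time by at most `ρ` on average, where `1 / ρ` is a
lower bound for the probabilities `meanHit K ν x`: in the coupling above, the discrepancy between
the two processes costs at most the time needed to fill a single last site. -/
theorem meanFill_diff (hK : IsKilled K) (hν : ∀ x, 0 ≤ ν x) (hν1 : ∑ x, ν x = 1) {ρ : ℝ}
    (hρ0 : 0 ≤ ρ) (hρ : ∀ x, 1 ≤ ρ * meanHit K ν x) (t : ℕ) :
    ∀ A x, meanFill K ν t (insert x A) ≤ meanFill K ν t A ∧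
      meanFill K ν t A ≤ meanFill K ν t (insert x A) + ρ := by
  induction t with
  | zero => intro A x; simp [meanFill, hρ0]
  | succ t ih =>
    intro A x
    have hd := aggStep_diff hK hν hν1 (fun A x => (ih A x).1) (fun A x => (ih A x).2) A x
    by_cases hx : x ∈ A
    · rw [Finset.insert_eq_of_mem hx]; exact ⟨le_rfl, by linarith⟩
    have hA : A ≠ Finset.univ := by rintro rfl; simp at hx
    rw [meanFill_succ hK, meanFill_succ hK, if_neg hA]
    split_ifs with hu
    · refine ⟨by linarith [hd.1], ?_⟩
      rw [hu, aggStep_univ hK hν1, meanFill_univ hK hν1]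
      rw [aggStep_of_insert_eq_univ hK hν1 hx hu (meanFill_univ hK hν1 t)]
      have h1 := (ih A x).2
      rw [hu, meanFill_univ hK hν1] at h1
      have h2 : 0 ≤ 1 - meanHit K ν x := by linarith [hK.meanHit_le_one hν hν1 x]
      have h3 := hρ x
      nlinarith [mul_le_mul_of_nonneg_left h1 h2]
    · exact ⟨by linarith [hd.1], by linarith [hd.2]⟩

theorem meanFill_le (hK : IsKilled K) (hν : ∀ x, 0 ≤ ν x) (hν1 : ∑ x, ν x = 1) {ρ : ℝ}
    (hρ0 : 0 ≤ ρ) (hρ : ∀ x, 1 ≤ ρ * meanHit K ν x) (t : ℕ) (A : Finset V) :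
    meanFill K ν t A ≤ Fintype.card V * ρ := by
  have key : ∀ B : Finset V, meanFill K ν t A ≤ meanFill K ν t (B ∪ A) + B.card * ρ := by
    intro B
    induction B using Finset.induction_on with
    | empty => simp
    | insert x B hx ih =>
      have := (meanFill_diff hK hν hν1 hρ0 hρ t (B ∪ A) x).2
      rw [Finset.insert_union, Finset.card_insert_of_notMem hx]
      push_cast
      linarith
  have := key Finset.univ
  rwa [Finset.union_eq_left.mpr (Finset.subset_univ A), meanFill_univ hK hν1, zero_add,
    Finset.card_univ] at this

/-- The properties of the expected filling time, as a function of the set of filled sites. -/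
theorem exists_meanFillTime (hK : IsKilled K) (hν : ∀ x, 0 ≤ ν x) (hν1 : ∑ x, ν x = 1) {ρ : ℝ}
    (hρ0 : 0 ≤ ρ) (hρ : ∀ x, 1 ≤ ρ * meanHit K ν x) :
    ∃ m : Finset V → ℝ, (∀ t A, meanFill K ν t A ≤ m A) ∧ m Finset.univ = 0 ∧
      (∀ A x, m (insert x A) ≤ m A ∧ m A ≤ m (insert x A) + ρ) ∧
      ∀ A, A ≠ Finset.univ → aggStep K ν m A = m A - 1 := by
  have hmono : ∀ A, Monotone fun t => meanFill K ν t A := fun A =>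
    monotone_nat_of_le_succ fun t => by
      simp only [meanFill, Finset.sum_range_succ]
      linarith [vacantProb_nonneg hK hν hν1 t A]
  have hbdd : ∀ A, BddAbove (Set.range fun t => meanFill K ν t A) := fun A =>
    ⟨Fintype.card V * ρ, by rintro _ ⟨t, rfl⟩; exact meanFill_le hK hν hν1 hρ0 hρ t A⟩
  let m : Finset V → ℝ := fun A => ⨆ t, meanFill K ν t A
  have htend : ∀ A, Tendsto (fun t => meanFill K ν t A) atTop (𝓝 (m A)) := fun A =>
    tendsto_atTop_ciSup (hmono A) (hbdd A)
  have hle : ∀ t A, meanFill K ν t A ≤ m A := fun t A => le_ciSup (hbdd A) t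
  refine ⟨m, hle, ?_, fun A x => ⟨?_, ?_⟩, fun A hA => le_antisymm ?_ ?_⟩
  · simp [m, meanFill_univ hK hν1]
  · exact le_of_tendsto_of_tendsto' (htend _) (htend _) fun t =>
      (meanFill_diff hK hν hν1 hρ0 hρ t A x).1
  · exact le_of_tendsto_of_tendsto' (htend _) ((htend _).add_const ρ) fun t =>
      (meanFill_diff hK hν hν1 hρ0 hρ t A x).2
  · refine le_of_forall_pos_le_add fun ε hε => ?_
    obtain ⟨t, ht⟩ : ∃ t, ∀ B, m B ≤ meanFill K ν t B + ε := by
      have : ∀ᶠ t in atTop, ∀ B, m B ≤ meanFill K ν t B + ε := by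
        rw [Filter.eventually_all]
        intro B
        filter_upwards [(htend B).eventually (lt_mem_nhds (show m B - ε < m B by linarith))]
          with t ht
        linarith
      exact this.exists
    have h1 : aggStep K ν m A ≤ aggStep K ν (fun B => 1 * meanFill K ν t B + ε * 1) A :=
      aggStep_mono hK hν (by linarith [ht A]) fun y _ => by linarith [ht (insert y A)]
    rw [aggStep_lin hK (g := fun _ => 1), aggStep_const hK hν1] at h1
    have h2 := meanFill_succ (ν := ν) hK t A
    rw [if_neg hA] at h2
    linarith [hle (t + 1) A]
  · have : m A ≤ 1 + aggStep K ν m A := by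
      refine ciSup_le fun t => ?_
      have h1 := hmono A (Nat.le_succ t)
      have h2 := meanFill_succ (ν := ν) hK t A
      rw [if_neg hA] at h2
      have h3 : aggStep K ν (meanFill K ν t) A ≤ aggStep K ν m A :=
        aggStep_mono hK hν (hle _ _) fun y _ => hle _ _
      simp only [Nat.succ_eq_add_one] at h1
      linarith
    linarith

/-- The variance of the filling time is at most `ρ` times its mean: the function below is
superharmonic for the space-time aggregation process. The compensated process
`m (A_t) + t` is a martingale whose increments have conditional variance at most `ρ`, as
`m (A_t) - m (A_{t+1})` takes values in `[0, ρ]` and has mean `1`. -/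
theorem aggStep_sq_le (hK : IsKilled K) (hν : ∀ x, 0 ≤ ν x) (hν1 : ∑ x, ν x = 1) {ρ : ℝ}
    {m : Finset V → ℝ} {A : Finset V} (hd : ∀ x, m (insert x A) ≤ m A ∧ m A ≤ m (insert x A) + ρ)
    (hρ0 : 0 ≤ ρ) (hm : aggStep K ν m A = m A - 1) (r : ℝ) :
    aggStep K ν (fun B => (m B + (r + 1)) ^ 2 + ρ * m B) A ≤ (m A + r) ^ 2 + ρ * m A := by
  set b : ℝ := (m A + r) ^ 2 + 2 * (m A + r) + 1 + m A * (-2 * (m A + r) - 2 + ρ)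
  have key : ∀ c : ℝ, c ≤ m A → m A ≤ c + ρ →
      (c + (r + 1)) ^ 2 + ρ * c ≤ (2 * (m A + r) + 2) * c + b * 1 := by
    intro c h1 h2
    have h3 : 0 ≤ (m A - c) * (ρ - (m A - c)) := mul_nonneg (by linarith) (by linarith)
    simp only [b]
    nlinarith
  have h1 : aggStep K ν (fun B => (m B + (r + 1)) ^ 2 + ρ * m B) A
      ≤ aggStep K ν (fun B => (2 * (m A + r) + 2) * m B + b * 1) A :=
    aggStep_mono hK hν (key _ le_rfl (by linarith)) fun y _ => key _ (hd y).1 (hd y).2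
  rw [aggStep_lin hK (g := fun _ => 1), aggStep_const hK hν1, hm] at h1
  simp only [b] at h1
  nlinarith

/-- Concentration of the filling time around its mean `m`. -/
theorem exists_fillTime_concentration (hK : IsKilled K) (hν : ∀ x, 0 ≤ ν x)
    (hν1 : ∑ x, ν x = 1) {ρ : ℝ} (hρ0 : 0 ≤ ρ) (hρ : ∀ x, 1 ≤ ρ * meanHit K ν x) :
    ∃ m : ℝ, (∀ t, ∑ s ∈ Finset.range t, vacantProb K ν s ∅ ≤ m) ∧
      (∀ t : ℕ, m ≤ t → vacantProb K ν t ∅ * (t - m) ^ 2 ≤ ρ * m) ∧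
      (∀ t : ℕ, t ≤ m → (1 - vacantProb K ν t ∅) * (t - m) ^ 2 ≤ ρ * m) := by
  obtain ⟨m, hm1, hm0, hmd, hmQ⟩ := exists_meanFillTime hK hν hν1 hρ0 hρ
  have hm_nonneg : ∀ A, 0 ≤ m A := fun A => by simpa [meanFill] using hm1 0 A
  have hU : ∀ A r, 0 ≤ (m A + r) ^ 2 + ρ * m A := fun A r => by
    have := mul_nonneg hρ0 (hm_nonneg A); positivity
  have hup : ∀ (t : ℕ) A r, 0 ≤ (t : ℝ) + r →
      vacantProb K ν t A * (t + r) ^ 2 ≤ (m A + r) ^ 2 + ρ * m A := by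
    intro t
    induction t with
    | zero =>
      intro A r hr
      have h1 := vacantProb_le_one hK hν hν1 0 A
      have h2 := mul_nonneg hρ0 (hm_nonneg A)
      have h3 := hm_nonneg A
      simp only [Nat.cast_zero, zero_add] at hr ⊢
      nlinarith [mul_le_mul_of_nonneg_right h1 (sq_nonneg r), mul_nonneg h3 hr]
    | succ t ih =>
      intro A r hr
      by_cases hA : A = Finset.univ
      · rw [hA, vacantProb_univ hK hν1, zero_mul]; exact hU _ _
      refine le_trans ?_ (aggStep_sq_le hK hν hν1 (hmd A) hρ0 (hmQ A hA) r)
      rw [vacantProb_succ, mul_comm, ← aggStep_smul hK]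
      push_cast at hr ⊢
      have : ∀ B, (t + 1 + r) ^ 2 * vacantProb K ν t B ≤ (m B + (r + 1)) ^ 2 + ρ * m B := by
        intro B
        have := ih B (r + 1) (by linarith)
        rw [mul_comm]
        convert this using 3; ring
      exact aggStep_mono hK hν (this _) fun y _ => this _
  have hlow : ∀ (t : ℕ) A r, (t : ℝ) + r ≤ 0 →
      (1 - vacantProb K ν t A) * (t + r) ^ 2 ≤ (m A + r) ^ 2 + ρ * m A := by
    intro t
    induction t with
    | zero =>
      intro A r hr
      by_cases hA : A = Finset.univ
      · subst hA; simp [vacantProb, hm0]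
      · simpa [vacantProb, hA] using hU A r
    | succ t ih =>
      intro A r hr
      push_cast at hr ⊢
      by_cases hA : A = Finset.univ
      · have ht : (0 : ℝ) ≤ t := Nat.cast_nonneg t
        rw [hA, vacantProb_univ hK hν1, hm0]
        nlinarith
      refine le_trans ?_ (aggStep_sq_le hK hν hν1 (hmd A) hρ0 (hmQ A hA) r)
      have h1 : aggStep K ν (fun B => (t + 1 + r) ^ 2 * 1
            + (-(t + 1 + r) ^ 2) * vacantProb K ν t B) A
          = (1 - vacantProb K ν (t + 1) A) * (t + 1 + r) ^ 2 := by
        rw [aggStep_lin hK (f := fun _ => 1), aggStep_const hK hν1, vacantProb_succ]; ring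
      rw [← h1]
      have : ∀ B, (t + 1 + r) ^ 2 * 1 + (-(t + 1 + r) ^ 2) * vacantProb K ν t B
          ≤ (m B + (r + 1)) ^ 2 + ρ * m B := by
        intro B
        have := ih B (r + 1) (by linarith)
        have h2 : (t + 1 + r) ^ 2 * 1 + (-(t + 1 + r) ^ 2) * vacantProb K ν t B
          = (1 - vacantProb K ν t B) * (t + (r + 1)) ^ 2 := by ring
        rwa [h2]
      exact aggStep_mono hK hν (this _) fun y _ => this _
  refine ⟨m ∅, fun t => hm1 t ∅, fun t ht => ?_, fun t ht => ?_⟩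
  · simpa [sub_eq_add_neg] using hup t ∅ (-m ∅) (by linarith)
  · simpa [sub_eq_add_neg] using hlow t ∅ (-m ∅) (by linarith)

/-- A union bound over the vacant sites `x`. If the walks of the particles were continued after they
have settled, `t * meanHit K ν x` of them would visit `x` on average; while `x` is vacant, only
continued walks can do so, and these contribute at most `∑ y, hitProb K x y` on average, as the
filled sites are distinct. The exponential supermartingale `Λ x` turns this into a Chernoff bound. -/
theorem vacantProb_le_sum_exp (hK : IsKilled K) (hν : ∀ x, 0 ≤ ν x) (hν1 : ∑ x, ν x = 1)
    (θ : ℝ) (hθ : 0 ≤ θ) (t : ℕ) :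
    vacantProb K ν t ∅ ≤ ∑ x, Real.exp (θ * ∑ y, hitProb K x y
      - t * (meanHit K ν x * (1 - Real.exp (-θ)))) := by
  set q : ℝ := 1 - Real.exp (-θ)
  have hq0 : 0 ≤ q := by
    have : Real.exp (-θ) ≤ 1 := Real.exp_le_one_iff.mpr (by linarith)
    simp only [q]; linarith
  let Λ : V → Finset V → ℝ := fun x A =>
    if x ∈ A then 0 else Real.exp (θ * (∑ y, hitProb K x y - ∑ y ∈ A, hitProb K x y))
  have hchord : ∀ h : ℝ, 0 ≤ h → h ≤ 1 → Real.exp (-θ * h) ≤ 1 - h * q := by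
    intro h h0 h1
    have := convexOn_exp.2 (Set.mem_univ (-θ)) (Set.mem_univ 0) h0 (sub_nonneg.mpr h1) (by ring)
    simp only [smul_eq_mul, mul_zero, add_zero, Real.exp_zero, mul_one] at this
    rw [mul_comm] at this
    simp only [q]
    linarith
  have hΛ0 : ∀ x A, 0 ≤ Λ x A := fun x A => by
    simp only [Λ]; split_ifs <;> positivity
  have hstep : ∀ x A, aggStep K ν (Λ x) A ≤ (1 - meanHit K ν x * q) * Λ x A := by
    intro x A
    have hrel : ∀ y, release K (Λ x) A y ≤ Λ x A * (1 - q * hitProb K x y) := by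
      by_cases hx : x ∈ A
      · have h0 : Λ x A = 0 := by simp [Λ, hx]
        rw [h0]
        simp only [zero_mul]
        refine hK.release_le (u := fun _ => 0) (fun y _ => by simp [h0]) fun y _ => ?_
        simp [Λ, hx]
      · refine hK.release_le (fun y hy => ?_) fun y hy => ?_
        · have hyx : y ≠ x := by rintro rfl; exact hx hy
          rw [hK.hitProb_of_ne hyx]
          have : ∀ w, K y w * (Λ x A * (1 - q * hitProb K x w))
              = K y w * Λ x A - Λ x A * q * (K y w * hitProb K x w) := fun w => by ring
          simp only [this, Finset.sum_sub_distrib, ← Finset.sum_mul, ← Finset.mul_sum]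
          apply le_of_eq; ring
        · have hA0 : 0 ≤ Λ x A * (1 - q * hitProb K x y) := by
            refine mul_nonneg (hΛ0 x A) ?_
            have h1 := hchord _ (hK.hitProb_nonneg x y) (hK.hitProb_le_one x y)
            have := Real.exp_pos (-θ * hitProb K x y)
            linarith
          by_cases hyx : y = x
          · subst hyx
            simpa [Λ] using hA0
          · have hxi : x ∉ insert y A := by simp [hx, Ne.symm hyx]
            have h1 := hchord _ (hK.hitProb_nonneg x y) (hK.hitProb_le_one x y)
            simp only [Λ, hx, hxi, if_false]
            rw [Finset.sum_insert hy]
            have : θ * (∑ z, hitProb K x z - (hitProb K x y + ∑ z ∈ A, hitProb K x z))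
              = θ * (∑ z, hitProb K x z - ∑ z ∈ A, hitProb K x z) + -θ * hitProb K x y := by ring
            rw [this, Real.exp_add]
            refine mul_le_mul_of_nonneg_left ?_ (Real.exp_pos _).le
            linarith
    calc aggStep K ν (Λ x) A ≤ ∑ y, ν y * (Λ x A * (1 - q * hitProb K x y)) :=
          Finset.sum_le_sum fun y _ => mul_le_mul_of_nonneg_left (hrel y) (hν y)
      _ = _ := by
        have : ∀ y, ν y * (Λ x A * (1 - q * hitProb K x y))
          = ν y * Λ x A - q * (ν y * hitProb K x y) * Λ x A := fun y => by ring
        simp only [this, Finset.sum_sub_distrib, ← Finset.sum_mul, ← Finset.mul_sum, hν1, meanHit]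
        ring
  have hβ : ∀ x, 0 ≤ 1 - meanHit K ν x * q := by
    intro x
    have h1 := hK.meanHit_le_one hν hν1 x
    have h2 : q ≤ 1 := by have := Real.exp_pos (-θ); simp only [q]; linarith
    have h3 := hK.meanHit_nonneg hν x
    nlinarith
  have hiter : ∀ A, vacantProb K ν t A ≤ ∑ x, (1 - meanHit K ν x * q) ^ t * Λ x A := by
    induction t with
    | zero =>
      intro A
      simp only [vacantProb, Function.iterate_zero, id, pow_zero, one_mul]
      split_ifs with hA
      · exact Finset.sum_nonneg fun x _ => hΛ0 x A
      · obtain ⟨x, hx⟩ : ∃ x, x ∉ A := by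
          by_contra! hcon
          exact hA (Finset.eq_univ_iff_forall.mpr hcon)
        refine le_trans ?_ (Finset.single_le_sum (fun x _ => hΛ0 x A) (Finset.mem_univ x))
        simp only [Λ, hx, if_false, Real.one_le_exp_iff]
        refine mul_nonneg hθ (sub_nonneg.mpr ?_)
        exact Finset.sum_le_sum_of_subset_of_nonneg (Finset.subset_univ _)
          fun y _ _ => hK.hitProb_nonneg x y
    | succ t ih =>
      intro A
      rw [vacantProb_succ]
      calc aggStep K ν (vacantProb K ν t) A
          ≤ aggStep K ν (fun B => ∑ x, (1 - meanHit K ν x * q) ^ t * Λ x B) A :=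
            aggStep_mono hK hν (ih _) fun y _ => ih _
        _ = ∑ x, (1 - meanHit K ν x * q) ^ t * aggStep K ν (Λ x) A := by
            rw [aggStep_sum hK]
            exact Finset.sum_congr rfl fun x _ => aggStep_smul hK _
        _ ≤ _ := Finset.sum_le_sum fun x _ => by
            rw [pow_succ, mul_assoc]
            exact mul_le_mul_of_nonneg_left (hstep x A) (pow_nonneg (hβ x) t)
  refine (hiter ∅).trans (Finset.sum_le_sum fun x _ => ?_)
  have h1 : (1 - meanHit K ν x * q) ^ t ≤ Real.exp (-(t * (meanHit K ν x * q))) := by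
    rw [← mul_neg, Real.exp_nat_mul]
    exact pow_le_pow_left₀ (hβ x) (Real.one_sub_le_exp_neg _) t
  simp only [Λ, Finset.notMem_empty, if_false, Finset.sum_empty, sub_zero]
  rw [sub_eq_add_neg (θ * _), Real.exp_add, mul_comm]
  exact mul_le_mul_of_nonneg_left h1 (Real.exp_pos _).le

/-- Lower bound for the filling time, as in the coupon collector's problem, when every single site of
`B` is hit with probability at most `c`: the harmonic number of the number of vacant sites of `B`
decreases by at most `c` per particle on average. -/
theorem le_vacantProb_of_meanHit_le (hK : IsKilled K) (hν : ∀ x, 0 ≤ ν x)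
    (hν1 : ∑ x, ν x = 1) {B : Finset V} {c : ℝ} (hc : 0 ≤ c)
    (hB : ∀ x ∈ B, meanHit K ν x ≤ c) (t : ℕ) :
    (harmonic B.card : ℝ) - c * t ≤ harmonic B.card * vacantProb K ν t ∅ := by
  set f : Finset V → ℝ := fun A => (harmonic (B \ A).card : ℝ)
  have hstep : ∀ A, f A - c ≤ aggStep K ν f A := by
    intro A
    set k : ℝ := ((B \ A).card : ℝ)
    have hk : (0 : ℝ) ≤ k⁻¹ := by positivity
    have hrel : ∀ y, f A - k⁻¹ * ∑ x ∈ B \ A, hitProb K x y ≤ release K f A y := by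
      refine hK.le_release (fun y hy => ?_) fun y hy => ?_
      · have h1 : ∑ x ∈ B \ A, hitProb K x y = ∑ w, K y w * ∑ x ∈ B \ A, hitProb K x w := by
          simp only [Finset.mul_sum]
          rw [Finset.sum_comm]
          refine Finset.sum_congr rfl fun x hx => hK.hitProb_of_ne ?_
          rintro rfl
          exact (Finset.mem_sdiff.mp hx).2 hy
        have h2 : ∀ w, K y w * (f A - k⁻¹ * ∑ x ∈ B \ A, hitProb K x w)
          = K y w * f A - k⁻¹ * (K y w * ∑ x ∈ B \ A, hitProb K x w) := fun w => by ring
        simp only [h2, Finset.sum_sub_distrib, ← Finset.sum_mul, ← Finset.mul_sum, ← h1]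
        apply le_of_eq; ring
      · by_cases hyB : y ∈ B
        · have hyBA : y ∈ B \ A := Finset.mem_sdiff.mpr ⟨hyB, hy⟩
          have h1 : 1 ≤ ∑ x ∈ B \ A, hitProb K x y := by
            rw [← hK.hitProb_self y]
            exact Finset.single_le_sum (f := fun x => hitProb K x y)
              (fun x _ => hK.hitProb_nonneg x y) hyBA
          have h2 : B \ insert y A = (B \ A).erase y := by
            ext z; simp only [Finset.mem_sdiff, Finset.mem_insert, Finset.mem_erase]; tauto
          have h3 : f A = f (insert y A) + k⁻¹ := by
            have hpos : 0 < (B \ A).card := Finset.card_pos.mpr ⟨y, hyBA⟩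
            simp only [f, k, h2, Finset.card_erase_of_mem hyBA]
            obtain ⟨j, hj⟩ := Nat.exists_eq_succ_of_ne_zero hpos.ne'
            rw [hj, Nat.succ_eq_add_one, Nat.add_sub_cancel, harmonic_succ]
            push_cast
            ring
          nlinarith
        · have h2 : B \ insert y A = B \ A := by
            ext z; simp only [Finset.mem_sdiff, Finset.mem_insert]
            constructor
            · rintro ⟨h1, h2⟩; exact ⟨h1, fun h => h2 (Or.inr h)⟩
            · rintro ⟨h1, h2⟩
              refine ⟨h1, fun h => h.elim (fun h => hyB (h ▸ h1)) h2⟩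
          have h3 : f (insert y A) = f A := by simp only [f, h2]
          rw [h3]
          have : 0 ≤ k⁻¹ * ∑ x ∈ B \ A, hitProb K x y :=
            mul_nonneg hk (Finset.sum_nonneg fun x _ => hK.hitProb_nonneg x y)
          linarith
    calc f A - c ≤ f A - k⁻¹ * ∑ x ∈ B \ A, meanHit K ν x := by
          have h1 : ∑ x ∈ B \ A, meanHit K ν x ≤ k * c := by
            have := Finset.sum_le_card_nsmul (B \ A) (meanHit K ν) c
              fun x hx => hB x (Finset.mem_sdiff.mp hx).1
            simpa [k] using this
          have h2 : k⁻¹ * k ≤ 1 := inv_mul_le_one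
          have h3 := mul_le_mul_of_nonneg_left h1 hk
          nlinarith
      _ = ∑ y, ν y * (f A - k⁻¹ * ∑ x ∈ B \ A, hitProb K x y) := by
          have h2 : ∀ y, ν y * (f A - k⁻¹ * ∑ x ∈ B \ A, hitProb K x y)
            = ν y * f A - k⁻¹ * (∑ x ∈ B \ A, ν y * hitProb K x y) := fun y => by
              rw [← Finset.mul_sum]; ring
          simp only [h2, Finset.sum_sub_distrib, ← Finset.sum_mul, ← Finset.mul_sum, hν1, meanHit]
          rw [Finset.sum_comm, one_mul]
          simp only [Finset.mul_sum]
      _ ≤ aggStep K ν f A :=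
          Finset.sum_le_sum fun y _ => mul_le_mul_of_nonneg_left (hrel y) (hν y)
  have hmono : Monotone fun j : ℕ => (harmonic j : ℝ) :=
    monotone_nat_of_le_succ fun j => by
      rw [harmonic_succ]; push_cast
      have : (0 : ℝ) ≤ ((j : ℝ) + 1)⁻¹ := by positivity
      linarith
  have hiter : ∀ A, f A - c * t ≤ harmonic B.card * vacantProb K ν t A := by
    induction t with
    | zero =>
      intro A
      by_cases hA : A = Finset.univ
      · have : B \ Finset.univ = ∅ := Finset.sdiff_eq_empty_iff_subset.mpr (Finset.subset_univ _)
        simp [vacantProb, hA, f, this]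
      · have := hmono (Finset.card_le_card (Finset.sdiff_subset (s := B) (t := A)))
        simpa [vacantProb, hA, f] using this
    | succ t ih =>
      intro A
      rw [vacantProb_succ, ← aggStep_smul hK]
      have h1 : aggStep K ν (fun A => 1 * f A + (-(c * t)) * 1) A
          ≤ aggStep K ν (fun A => harmonic B.card * vacantProb K ν t A) A :=
        aggStep_mono hK hν (by linarith [ih A]) fun y _ => by linarith [ih (insert y A)]
      rw [aggStep_lin hK (g := fun _ => 1), aggStep_const hK hν1] at h1
      have := hstep A
      push_cast
      linarith
  simpa [f] using hiter ∅

end FillTime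

/-! ### Topplings and the abelian property -/

namespace SiteState

/-- Effect of a sleep instruction: it has no effect unless there is exactly one active particle. -/
def trySleep : SiteState → SiteState
  | empty => empty
  | sleeping => sleeping
  | active 0 => sleeping
  | active (k + 1) => active (k + 1)

/-- Number of particles at a site, sleeping or active. -/
def count : SiteState → ℕ
  | empty => 0
  | sleeping => 1
  | active k => k + 1

theorem activeCount_addActive_pos (s : SiteState) : 0 < s.addActive.activeCount := by
  cases s <;> simp [addActive, activeCount]

theorem count_addActive (s : SiteState) : s.addActive.count = s.count + 1 := by
  cases s <;> simp [addActive, count]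

theorem count_removeActive {s : SiteState} (h : 0 < s.activeCount) :
    s.removeActive.count + 1 = s.count := by
  rcases s with _ | _ | _ | k <;> simp_all [removeActive, count, activeCount]

theorem count_trySleep (s : SiteState) : s.trySleep.count = s.count := by
  rcases s with _ | _ | _ | k <;> simp [trySleep, count]

theorem removeActive_addActive {s : SiteState} (h : 0 < s.activeCount) :
    s.addActive.removeActive = s := by
  rcases s with _ | _ | _ | k <;> simp_all [removeActive, addActive, activeCount]

theorem addActive_removeActive {s : SiteState} (h : 0 < s.activeCount) :
    s.removeActive.addActive = s := by
  rcases s with _ | _ | _ | k <;> simp_all [removeActive, addActive, activeCount]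

theorem trySleep_addActive {s : SiteState} (h : 0 < s.activeCount) :
    s.addActive.trySleep = s.trySleep.addActive := by
  rcases s with _ | _ | _ | k <;> simp_all [trySleep, addActive, activeCount]

end SiteState

section Toppling

variable {V : Type*} [Fintype V] [DecidableEq V] {K : V → V → ℝ} {lam : ℝ}

/-- Apply `f` to the state of the site `x`. -/
def modify (x : V) (f : SiteState → SiteState) (η : V → SiteState) : V → SiteState :=
  Function.update η x (f (η x))

theorem modify_self (x : V) (f : SiteState → SiteState) (η : V → SiteState) :
    modify x f η x = f (η x) := by simp [modify]

theorem modify_of_ne {x y : V} (h : y ≠ x) (f : SiteState → SiteState) (η : V → SiteState) :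
    modify x f η y = η y := by simp [modify, h]

theorem modify_comm {x y : V} {f g : SiteState → SiteState} {η : V → SiteState}
    (h : x = y → f (g (η x)) = g (f (η x))) :
    modify x f (modify y g η) = modify y g (modify x f η) := by
  funext z
  by_cases hxy : x = y
  · subst hxy
    by_cases hz : z = x
    · subst hz; simp [modify, h rfl]
    · simp [modify, hz]
  · by_cases hz : z = x
    · subst hz; simp [modify, hxy]
    · by_cases hz' : z = y
      · subst hz'; simp [modify, hz]
      · simp [modify, hz, hz']

/-- Add an active particle at `x`. -/
def addAt (x : V) (η : V → SiteState) : V → SiteState := modify x SiteState.addActive η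

/-- Execute an instruction at the site `x`: `none` is the instruction to sleep, `some none` kills a
particle, and `some (some y)` lets a particle jump to `y`. -/
def act (x : V) : Option (Option V) → (V → SiteState) → (V → SiteState)
  | none, η => modify x SiteState.trySleep η
  | some none, η => modify x SiteState.removeActive η
  | some (some y), η => addAt y (modify x SiteState.removeActive η)

/-- The law of the instructions at `x`. -/
def instrWeight (K : V → V → ℝ) (lam : ℝ) (x : V) : Option (Option V) → ℝ
  | none => lam / (1 + lam)
  | some none => (1 - ∑ y, K x y) / (1 + lam)
  | some (some y) => K x y / (1 + lam)

/-- Expectation of `g` after a random instruction has been executed at the site `x` of `η`. -/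
def topple (K : V → V → ℝ) (lam : ℝ) (g : (V → SiteState) → ℝ) (x : V) (η : V → SiteState) : ℝ :=
  ∑ i, instrWeight K lam x i * g (act x i η)

/-- Expectation of `g` after an active particle has left the site `x` of `η`. -/
def jumpMean (K : V → V → ℝ) (g : (V → SiteState) → ℝ) (x : V) (η : V → SiteState) : ℝ :=
  ∑ y, K x y * g (addAt y (modify x SiteState.removeActive η))
    + (1 - ∑ y, K x y) * g (modify x SiteState.removeActive η)

theorem topple_eq (g : (V → SiteState) → ℝ) (x : V) (η : V → SiteState) :
    topple K lam g x η
      = (jumpMean K g x η + lam * g (modify x SiteState.trySleep η)) / (1 + lam) := by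
  simp only [topple, Fintype.sum_option, instrWeight, act, jumpMean, add_div, Finset.sum_div]
  rw [add_comm, add_comm (((1 - ∑ y, K x y) / (1 + lam)) * _)]
  congr 1
  · congr 1
    · exact Finset.sum_congr rfl fun y _ => by ring
    · ring
  · ring

theorem instrWeight_nonneg (hK : IsKilled K) (hlam : 0 < lam) (x : V) (i : Option (Option V)) :
    0 ≤ instrWeight K lam x i := by
  have := hK.sum_le x
  rcases i with _ | _ | y <;> simp only [instrWeight]
  · positivity
  · exact div_nonneg (by linarith) (by linarith)
  · exact div_nonneg (hK.nonneg x y) (by linarith)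

theorem sum_instrWeight (hlam : 0 < lam) (x : V) : ∑ i, instrWeight K lam x i = 1 := by
  simp only [Fintype.sum_option, instrWeight, ← Finset.sum_div]
  field_simp
  ring

theorem topple_mono (hK : IsKilled K) (hlam : 0 < lam) {f g : (V → SiteState) → ℝ}
    (h : ∀ η, f η ≤ g η) (x : V) (η : V → SiteState) :
    topple K lam f x η ≤ topple K lam g x η :=
  Finset.sum_le_sum fun i _ => mul_le_mul_of_nonneg_left (h _) (instrWeight_nonneg hK hlam x i)

theorem topple_const (hlam : 0 < lam) (c : ℝ) (x : V) (η : V → SiteState) :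
    topple K lam (fun _ => c) x η = c := by
  rw [topple, ← Finset.sum_mul, sum_instrWeight hlam, one_mul]

theorem activeCount_addAt_pos {x y : V} {η : V → SiteState} (h : 0 < (η x).activeCount) :
    0 < (addAt y η x).activeCount := by
  by_cases hxy : x = y
  · subst hxy; rw [addAt, modify_self]; exact SiteState.activeCount_addActive_pos _
  · rwa [addAt, modify_of_ne hxy]

theorem activeCount_act_pos {x y : V} (hxy : x ≠ y) {η : V → SiteState}
    (h : 0 < (η x).activeCount) (i : Option (Option V)) : 0 < (act y i η x).activeCount := by
  rcases i with _ | _ | z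
  · rwa [act, modify_of_ne hxy]
  · rwa [act, modify_of_ne hxy]
  · exact activeCount_addAt_pos (by rwa [modify_of_ne hxy])

theorem addAt_comm (x y : V) (η : V → SiteState) :
    addAt x (addAt y η) = addAt y (addAt x η) :=
  modify_comm fun _ => rfl

theorem removeActive_addAt {x y : V} {η : V → SiteState} (h : 0 < (η x).activeCount) :
    modify x SiteState.removeActive (addAt y η) = addAt y (modify x SiteState.removeActive η) :=
  modify_comm fun _ => by
    rw [SiteState.removeActive_addActive h, SiteState.addActive_removeActive h]

/-- Adding a particle commutes with the instructions at an active site. -/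
theorem act_addAt {x y : V} {η : V → SiteState} (h : 0 < (η x).activeCount)
    (i : Option (Option V)) : act x i (addAt y η) = addAt y (act x i η) := by
  rcases i with _ | _ | z
  · exact modify_comm fun _ => SiteState.trySleep_addActive h
  · exact removeActive_addAt h
  · simp only [act]
    rw [removeActive_addAt h, addAt_comm]

/-- Abelian property: instructions at distinct active sites commute. -/
theorem act_comm {x y : V} (hxy : x ≠ y) {η : V → SiteState} (hx : 0 < (η x).activeCount)
    (hy : 0 < (η y).activeCount) (i j : Option (Option V)) :
    act x i (act y j η) = act y j (act x i η) := by
  have hm : ∀ f g : SiteState → SiteState,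
      modify x f (modify y g η) = modify y g (modify x f η) :=
    fun f g => modify_comm fun h => absurd h hxy
  have hx' : ∀ g, 0 < (modify y g η x).activeCount := fun g => by rwa [modify_of_ne hxy]
  have hy' : ∀ g, 0 < (modify x g η y).activeCount := fun g => by rwa [modify_of_ne hxy.symm]
  rcases j with _ | _ | z
  · rcases i with _ | _ | z'
    · exact hm _ _
    · exact hm _ _
    · change addAt z' _ = act y none (addAt z' _)
      rw [act_addAt (hy' _)]
      exact congrArg _ (hm _ _)
  · rcases i with _ | _ | z'
    · exact hm _ _
    · exact hm _ _
    · change addAt z' _ = act y (some none) (addAt z' _)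
      rw [act_addAt (hy' _)]
      exact congrArg _ (hm _ _)
  · change act x i (addAt z _) = _
    rw [act_addAt (hx' _)]
    rcases i with _ | _ | z'
    · exact congrArg _ (hm _ _)
    · exact congrArg _ (hm _ _)
    · change addAt z (addAt z' _) = addAt z (act y (some none) (addAt z' _))
      rw [act_addAt (hy' _)]
      exact congrArg _ (congrArg _ (hm _ _))

/-- The instructions executed at distinct active sites may be executed in either order. -/
theorem topple_comm {x y : V} (hxy : x ≠ y) {η : V → SiteState} (hx : 0 < (η x).activeCount)
    (hy : 0 < (η y).activeCount) (g : (V → SiteState) → ℝ) :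
    topple K lam (topple K lam g x) y η = topple K lam (topple K lam g y) x η := by
  simp only [topple, Finset.mul_sum]
  rw [Finset.sum_comm]
  refine Finset.sum_congr rfl fun i _ => Finset.sum_congr rfl fun j _ => ?_
  rw [act_comm hxy hx hy]
  ring

/-- A function of the configuration that is preserved in mean by topplings at active sites. -/
def IsTopplingInvariant (K : V → V → ℝ) (lam : ℝ) (g : (V → SiteState) → ℝ) : Prop :=
  ∀ η x, 0 < (η x).activeCount → g η = topple K lam g x η

theorem exists_active {η : V → SiteState} (h : ¬ IsStable η) : ∃ x, 0 < (η x).activeCount := by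
  simp only [IsStable, not_forall] at h
  obtain ⟨x, hx⟩ := h
  exact ⟨x, Nat.pos_of_ne_zero hx⟩

theorem not_isStable {η : V → SiteState} {x : V} (h : 0 < (η x).activeCount) : ¬ IsStable η :=
  fun hs => h.ne' (hs x)

open Classical in
/-- Probability that at most `n` topplings stabilize `η`, with result `ξ`; the sites to be toppled
are chosen arbitrarily. -/
def toppleLaw (K : V → V → ℝ) (lam : ℝ) (ξ : V → SiteState) : ℕ → (V → SiteState) → ℝ
  | 0, η => if η = ξ then 1 else 0
  | n + 1, η =>
      if h : ∃ x, 0 < (η x).activeCount then topple K lam (toppleLaw K lam ξ n) h.choose η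
      else if η = ξ then 1 else 0

/-- The law of the result of at most `n` topplings does not depend on the choice of the sites. -/
theorem toppleLaw_succ {ξ : V → SiteState} (hξ : IsStable ξ) (n : ℕ) :
    ∀ η x, 0 < (η x).activeCount →
      toppleLaw K lam ξ (n + 1) η = topple K lam (toppleLaw K lam ξ n) x η := by
  suffices h : ∀ η x y, 0 < (η x).activeCount → 0 < (η y).activeCount →
      topple K lam (toppleLaw K lam ξ n) x η = topple K lam (toppleLaw K lam ξ n) y η by
    intro η x hx
    have hex : ∃ x, 0 < (η x).activeCount := ⟨x, hx⟩
    rw [toppleLaw, dif_pos hex]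
    exact h η _ x hex.choose_spec hx
  induction n with
  | zero =>
    have key : ∀ η x y, x ≠ y → 0 < (η y).activeCount →
        topple K lam (toppleLaw K lam ξ 0) x η = 0 := by
      intro η x y hxy hy
      refine Finset.sum_eq_zero fun i _ => ?_
      have : act x i η ≠ ξ := by
        intro h
        have := activeCount_act_pos hxy.symm hy i
        rw [h, hξ y] at this
        exact lt_irrefl _ this
      simp [toppleLaw, this]
    intro η x y hx hy
    by_cases hxy : x = y
    · rw [hxy]
    · rw [key η x y hxy hy, key η y x (Ne.symm hxy) hx]
  | succ n ih =>
    have hs : ∀ η x, 0 < (η x).activeCount →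
        toppleLaw K lam ξ (n + 1) η = topple K lam (toppleLaw K lam ξ n) x η := by
      intro η x hx
      have hex : ∃ x, 0 < (η x).activeCount := ⟨x, hx⟩
      rw [toppleLaw, dif_pos hex]
      exact ih η _ x hex.choose_spec hx
    have key : ∀ η x y, x ≠ y → 0 < (η y).activeCount →
        topple K lam (toppleLaw K lam ξ (n + 1)) x η
          = topple K lam (topple K lam (toppleLaw K lam ξ n) y) x η := by
      intro η x y hxy hy
      refine Finset.sum_congr rfl fun i _ => ?_
      rw [hs _ y (activeCount_act_pos hxy.symm hy i)]
    intro η x y hx hy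
    by_cases hxy : x = y
    · rw [hxy]
    · rw [key η x y hxy hy, key η y x (Ne.symm hxy) hx, topple_comm (Ne.symm hxy) hy hx]

theorem toppleLaw_of_isStable {ξ η : V → SiteState} (hη : IsStable η) (n : ℕ) :
    toppleLaw K lam ξ n η = if η = ξ then 1 else 0 := by
  cases n with
  | zero => rw [toppleLaw]
  | succ n =>
    rw [toppleLaw, dif_neg]
    rintro ⟨x, hx⟩
    exact not_isStable hx hη

theorem toppleLaw_nonneg (hK : IsKilled K) (hlam : 0 < lam) {ξ : V → SiteState}
    (hξ : IsStable ξ) (n : ℕ) (η : V → SiteState) : 0 ≤ toppleLaw K lam ξ n η := by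
  induction n generalizing η with
  | zero => rw [toppleLaw]; split_ifs <;> norm_num
  | succ n ih =>
    by_cases hη : IsStable η
    · rw [toppleLaw_of_isStable hη]; split_ifs <;> norm_num
    · obtain ⟨x, hx⟩ := exists_active hη
      rw [toppleLaw_succ hξ n η x hx, ← topple_const (K := K) hlam 0 x η]
      exact topple_mono hK hlam ih x η

theorem toppleLaw_le_one (hK : IsKilled K) (hlam : 0 < lam) {ξ : V → SiteState}
    (hξ : IsStable ξ) (n : ℕ) (η : V → SiteState) : toppleLaw K lam ξ n η ≤ 1 := by
  induction n generalizing η with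
  | zero => rw [toppleLaw]; split_ifs <;> norm_num
  | succ n ih =>
    by_cases hη : IsStable η
    · rw [toppleLaw_of_isStable hη]; split_ifs <;> norm_num
    · obtain ⟨x, hx⟩ := exists_active hη
      rw [toppleLaw_succ hξ n η x hx, ← topple_const (K := K) hlam 1 x η]
      exact topple_mono hK hlam ih x η

theorem toppleLaw_le_succ (hK : IsKilled K) (hlam : 0 < lam) {ξ : V → SiteState}
    (hξ : IsStable ξ) (n : ℕ) (η : V → SiteState) :
    toppleLaw K lam ξ n η ≤ toppleLaw K lam ξ (n + 1) η := by
  induction n generalizing η with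
  | zero =>
    by_cases hη : η = ξ
    · subst hη; rw [toppleLaw_of_isStable hξ, toppleLaw_of_isStable hξ]
    · rw [toppleLaw, if_neg hη]; exact toppleLaw_nonneg hK hlam hξ _ _
  | succ n ih =>
    by_cases hη : IsStable η
    · rw [toppleLaw_of_isStable hη, toppleLaw_of_isStable hη]
    · obtain ⟨x, hx⟩ := exists_active hη
      rw [toppleLaw_succ hξ n η x hx, toppleLaw_succ hξ (n + 1) η x hx]
      exact topple_mono hK hlam ih x η

end Toppling

/-! ### The law of the stabilized configuration -/

section Stabilization

variable {V : Type*} [Fintype V] [DecidableEq V] {K : V → V → ℝ} {lam : ℝ}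

/-- The rates of the dynamics, expressed through topplings. Topplings at rate `1 + lam` per active
particle would let a site with several active particles receive sleep instructions, which have no
effect; the subtracted term removes these void transitions. -/
theorem rateSum_eq (hlam : 0 < lam) (f : (V → SiteState) → ℝ) (η : V → SiteState) :
    rateSum K lam f η = ∑ x, (((η x).activeCount : ℝ) * (1 + lam) * topple K lam f x η
      - if 2 ≤ (η x).activeCount then ((η x).activeCount : ℝ) * lam * f η else 0) := by
  refine Finset.sum_congr rfl fun x _ => ?_
  have h1 : (1 + lam) ≠ 0 := by positivity
  have h2 : ∑ y, K x y * f (move x y η) + (1 - ∑ y, K x y) * f (kill x η) = jumpMean K f x η := rfl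
  rw [h2, topple_eq, mul_assoc, mul_div_cancel₀ _ h1]
  rcases hs : η x with _ | _ | _ | k
  · simp [SiteState.activeCount]
  · simp [SiteState.activeCount]
  · have : modify x SiteState.trySleep η = fallAsleep x η := by
      simp [modify, hs, SiteState.trySleep, fallAsleep]
    simp [SiteState.activeCount, this]
  · have : modify x SiteState.trySleep η = η := by
      rw [modify, hs]
      change Function.update η x (SiteState.active (k + 1)) = η
      rw [← hs, Function.update_eq_self]
    simp [SiteState.activeCount, this]
    ring

theorem rateSum_const (hlam : 0 < lam) (c : ℝ) (η : V → SiteState) :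
    rateSum K lam (fun _ => c) η = rateSum K lam (fun _ => 1) η * c := by
  rw [rateSum_eq hlam, rateSum_eq hlam, Finset.sum_mul]
  refine Finset.sum_congr rfl fun x _ => ?_
  rw [topple_const hlam, topple_const hlam]
  split_ifs <;> ring

theorem rateSum_mono (hK : IsKilled K) (hlam : 0 < lam) {f g : (V → SiteState) → ℝ}
    (h : ∀ η, f η ≤ g η) (η : V → SiteState) : rateSum K lam f η ≤ rateSum K lam g η := by
  refine Finset.sum_le_sum fun x _ => add_le_add (mul_le_mul_of_nonneg_left (add_le_add
    (Finset.sum_le_sum fun y _ => mul_le_mul_of_nonneg_left (h _) (hK.nonneg x y))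
    (mul_le_mul_of_nonneg_left (h _) (by linarith [hK.sum_le x]))) (Nat.cast_nonneg _)) ?_
  split_ifs
  · exact mul_le_mul_of_nonneg_left (h _) hlam.le
  · exact le_rfl

theorem rateSum_one_pos (hlam : 0 < lam) {η : V → SiteState} (h : ¬ IsStable η) :
    0 < rateSum K lam (fun _ => 1) η := by
  obtain ⟨x, hx⟩ := exists_active h
  have key : ∀ z, (((η z).activeCount : ℝ) * (∑ y, K z y * 1 + (1 - ∑ y, K z y) * 1)
      + if η z = SiteState.active 0 then lam * 1 else 0)
      = (η z).activeCount + if η z = SiteState.active 0 then lam else 0 := by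
    intro z; simp
  simp only [rateSum, key]
  refine Finset.sum_pos' (fun z _ => ?_) ⟨x, Finset.mem_univ x, ?_⟩
  · split_ifs <;> positivity
  · have : (0 : ℝ) < (η x).activeCount := by exact_mod_cast hx
    split_ifs <;> positivity

theorem rateSum_of_topple_eq (hlam : 0 < lam) {f : (V → SiteState) → ℝ} {η : V → SiteState}
    (h : ∀ x, 0 < (η x).activeCount → f η = topple K lam f x η) :
    rateSum K lam f η = rateSum K lam (fun _ => 1) η * f η := by
  rw [← rateSum_const hlam, rateSum_eq hlam, rateSum_eq hlam]
  refine Finset.sum_congr rfl fun x _ => ?_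
  rw [topple_const hlam]
  rcases Nat.eq_zero_or_pos (η x).activeCount with h0 | h0
  · simp [h0]
  · rw [← h x h0]

theorem jumpLaw_of_isStable {η ξ : V → SiteState} (hη : IsStable η) (n : ℕ) :
    jumpLaw K lam n η ξ = if η = ξ then 1 else 0 := by
  cases n with
  | zero => rw [jumpLaw]
  | succ n => rw [jumpLaw, if_pos hη]

theorem jumpLaw_of_not_isStable {η ξ : V → SiteState} (hη : ¬ IsStable η) (n : ℕ) :
    jumpLaw K lam (n + 1) η ξ
      = rateSum K lam (fun ζ => jumpLaw K lam n ζ ξ) η / rateSum K lam (fun _ => 1) η := by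
  rw [jumpLaw, if_neg hη]

theorem jumpLaw_mem (hK : IsKilled K) (hlam : 0 < lam) (ξ : V → SiteState) (n : ℕ)
    (η : V → SiteState) : 0 ≤ jumpLaw K lam n η ξ ∧ jumpLaw K lam n η ξ ≤ 1 := by
  induction n generalizing η with
  | zero => rw [jumpLaw]; split_ifs <;> norm_num
  | succ n ih =>
    by_cases hη : IsStable η
    · rw [jumpLaw_of_isStable hη]; split_ifs <;> norm_num
    · have hR := rateSum_one_pos (K := K) hlam hη
      rw [jumpLaw_of_not_isStable hη, le_div_iff₀ hR, div_le_one hR]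
      refine ⟨?_, rateSum_mono hK hlam (fun ζ => (ih ζ).2) η⟩
      have := rateSum_mono hK hlam (fun ζ => (ih ζ).1) η
      rw [rateSum_const hlam] at this
      linarith

theorem jumpLaw_le_succ (hK : IsKilled K) (hlam : 0 < lam) {ξ : V → SiteState}
    (hξ : IsStable ξ) (n : ℕ) (η : V → SiteState) :
    jumpLaw K lam n η ξ ≤ jumpLaw K lam (n + 1) η ξ := by
  induction n generalizing η with
  | zero =>
    by_cases hη : η = ξ
    · subst hη; rw [jumpLaw_of_isStable hξ, jumpLaw_of_isStable hξ]
    · rw [jumpLaw, if_neg hη]; exact (jumpLaw_mem hK hlam _ _ _).1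
  | succ n ih =>
    by_cases hη : IsStable η
    · rw [jumpLaw_of_isStable hη, jumpLaw_of_isStable hη]
    · rw [jumpLaw_of_not_isStable hη, jumpLaw_of_not_isStable hη]
      exact div_le_div_of_nonneg_right (rateSum_mono hK hlam ih η)
        (rateSum_one_pos hlam hη).le

theorem bddAbove_jumpLaw (hK : IsKilled K) (hlam : 0 < lam) (ξ η : V → SiteState) :
    BddAbove (Set.range fun n => jumpLaw K lam n η ξ) :=
  ⟨1, by rintro _ ⟨n, rfl⟩; exact (jumpLaw_mem hK hlam ξ n η).2⟩

theorem tendsto_jumpLaw (hK : IsKilled K) (hlam : 0 < lam) {ξ : V → SiteState}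
    (hξ : IsStable ξ) (η : V → SiteState) :
    Tendsto (fun n => jumpLaw K lam n η ξ) atTop (𝓝 (stabProb K lam η ξ)) :=
  tendsto_atTop_ciSup (monotone_nat_of_le_succ fun n => jumpLaw_le_succ hK hlam hξ n η)
    (bddAbove_jumpLaw hK hlam ξ η)

theorem stabProb_nonneg (hK : IsKilled K) (hlam : 0 < lam) (η ξ : V → SiteState) :
    0 ≤ stabProb K lam η ξ :=
  (jumpLaw_mem hK hlam ξ 0 η).1.trans (le_ciSup (bddAbove_jumpLaw hK hlam ξ η) 0)

theorem stabProb_of_isStable {η ξ : V → SiteState} (hη : IsStable η) :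
    stabProb K lam η ξ = if η = ξ then 1 else 0 := by
  simp only [stabProb, jumpLaw_of_isStable hη, ciSup_const]

/-- The continuous-time dynamics and the successive topplings of arbitrary active sites stabilize
a configuration with the same law. -/
theorem tendsto_toppleLaw (hK : IsKilled K) (hlam : 0 < lam) {ξ : V → SiteState}
    (hξ : IsStable ξ) (η : V → SiteState) :
    Tendsto (fun n => toppleLaw K lam ξ n η) atTop (𝓝 (stabProb K lam η ξ)) := by
  have hbdd : ∀ η, BddAbove (Set.range fun n => toppleLaw K lam ξ n η) := fun η =>
    ⟨1, by rintro _ ⟨n, rfl⟩; exact toppleLaw_le_one hK hlam hξ n η⟩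
  have hlim : ∀ η, Tendsto (fun n => toppleLaw K lam ξ n η) atTop
      (𝓝 (⨆ n, toppleLaw K lam ξ n η)) := fun η =>
    tendsto_atTop_ciSup (monotone_nat_of_le_succ fun n => toppleLaw_le_succ hK hlam hξ n η)
      (hbdd η)
  have hinv : ∀ η x, 0 < (η x).activeCount → (⨆ n, toppleLaw K lam ξ n η)
      = topple K lam (fun η => ⨆ n, toppleLaw K lam ξ n η) x η := by
    intro η x hx
    refine tendsto_nhds_unique ((tendsto_add_atTop_iff_nat 1).mpr (hlim η)) ?_
    simp only [toppleLaw_succ hξ _ η x hx, topple]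
    exact tendsto_finsetSum _ fun i _ => (hlim _).const_mul _
  have heq : (⨆ n, toppleLaw K lam ξ n η) = stabProb K lam η ξ := by
    refine le_antisymm (ciSup_le fun n => ?_) (ciSup_le fun n => ?_)
    · induction n generalizing η with
      | zero =>
        by_cases hη : η = ξ
        · subst hη; rw [toppleLaw_of_isStable hξ, stabProb_of_isStable hξ]
        · rw [toppleLaw, if_neg hη]; exact stabProb_nonneg hK hlam _ _
      | succ n ih =>
        by_cases hη : IsStable η
        · rw [toppleLaw_of_isStable hη, stabProb_of_isStable hη]
        · set s : (V → SiteState) → ℝ := fun η => stabProb K lam η ξ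
          have hR := rateSum_one_pos (K := K) hlam hη
          have h1 : rateSum K lam s η ≤ rateSum K lam (fun _ => 1) η * s η := by
            have ht : Tendsto (fun n => rateSum K lam (fun ζ => jumpLaw K lam n ζ ξ) η) atTop
                (𝓝 (rateSum K lam s η)) := by
              refine tendsto_finsetSum _ fun x _ => Tendsto.add (Tendsto.const_mul _
                (Tendsto.add (tendsto_finsetSum _ fun y _ => Tendsto.const_mul _
                  (tendsto_jumpLaw hK hlam hξ _)) (Tendsto.const_mul _
                  (tendsto_jumpLaw hK hlam hξ _)))) ?_
              split_ifs
              · exact Tendsto.const_mul _ (tendsto_jumpLaw hK hlam hξ _)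
              · exact tendsto_const_nhds
            refine le_of_tendsto' ht fun n => ?_
            have := le_ciSup (bddAbove_jumpLaw hK hlam ξ η) (n + 1)
            simp only [jumpLaw_of_not_isStable hη] at this
            rw [div_le_iff₀ hR] at this
            rw [mul_comm]; exact this
          -- a weighted average of the recursion for `toppleLaw` over all active sites
          have h2 : (∑ x, ((η x).activeCount : ℝ) * (1 + lam)) * toppleLaw K lam ξ (n + 1) η
              ≤ (∑ x, ((η x).activeCount : ℝ) * (1 + lam)) * s η := by
            calc _ ≤ ∑ x, ((η x).activeCount : ℝ) * (1 + lam) * topple K lam s x η := by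
                  rw [Finset.sum_mul]
                  refine Finset.sum_le_sum fun x _ => ?_
                  rcases Nat.eq_zero_or_pos (η x).activeCount with h0 | h0
                  · simp [h0]
                  · rw [toppleLaw_succ hξ n η x h0]
                    exact mul_le_mul_of_nonneg_left (topple_mono hK hlam ih x η) (by positivity)
              _ = rateSum K lam s η + ∑ x, (if 2 ≤ (η x).activeCount then
                    ((η x).activeCount : ℝ) * lam * s η else 0) := by
                  rw [rateSum_eq hlam, ← Finset.sum_add_distrib]
                  exact Finset.sum_congr rfl fun x _ => by ring
              _ ≤ rateSum K lam (fun _ => 1) η * s η + ∑ x, (if 2 ≤ (η x).activeCount then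
                    ((η x).activeCount : ℝ) * lam * s η else 0) := by linarith
              _ = _ := by
                  rw [← rateSum_const hlam, rateSum_eq hlam, ← Finset.sum_add_distrib,
                    Finset.sum_mul]
                  exact Finset.sum_congr rfl fun x _ => by rw [topple_const hlam]; ring
          refine le_of_mul_le_mul_left h2 ?_
          obtain ⟨x, hx⟩ := exists_active hη
          exact Finset.sum_pos' (fun x _ => by positivity)
            ⟨x, Finset.mem_univ x, by have : (0 : ℝ) < (η x).activeCount := by exact_mod_cast hx
                                      positivity⟩
    · induction n generalizing η with
      | zero =>
        refine le_trans ?_ (le_ciSup (hbdd η) 0)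
        rw [jumpLaw, toppleLaw]
      | succ n ih =>
        by_cases hη : IsStable η
        · refine le_trans ?_ (le_ciSup (hbdd η) 0)
          rw [jumpLaw_of_isStable hη, toppleLaw]
        · have hR := rateSum_one_pos (K := K) hlam hη
          rw [jumpLaw_of_not_isStable hη, div_le_iff₀ hR, mul_comm,
            ← rateSum_of_topple_eq hlam (f := fun η => ⨆ n, toppleLaw K lam ξ n η) (hinv η)]
          exact rateSum_mono hK hlam ih η
  rw [← heq]
  exact hlim η

/-- The stabilization law is invariant under topplings. -/
theorem isTopplingInvariant_stabProb (hK : IsKilled K) (hlam : 0 < lam) {ξ : V → SiteState}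
    (hξ : IsStable ξ) : IsTopplingInvariant K lam fun η => stabProb K lam η ξ := by
  intro η x hx
  refine tendsto_nhds_unique
    ((tendsto_add_atTop_iff_nat 1).mpr (tendsto_toppleLaw hK hlam hξ η)) ?_
  simp only [toppleLaw_succ hξ _ η x hx, topple]
  exact tendsto_finsetSum _ fun i _ => (tendsto_toppleLaw hK hlam hξ _).const_mul _

/-- Total number of particles. -/
def numParticles (η : V → SiteState) : ℕ := ∑ x, (η x).count

theorem numParticles_modify (x : V) (f : SiteState → SiteState) (η : V → SiteState) :
    numParticles (modify x f η) + (η x).count = numParticles η + (f (η x)).count := by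
  simp only [numParticles]
  rw [← Finset.add_sum_erase _ _ (Finset.mem_univ x),
    ← Finset.add_sum_erase _ (fun y => (η y).count) (Finset.mem_univ x), modify_self,
    Finset.sum_congr rfl fun y hy => by rw [modify_of_ne (Finset.ne_of_mem_erase hy)]]
  ring

theorem numParticles_addAt (x : V) (η : V → SiteState) :
    numParticles (addAt x η) = numParticles η + 1 := by
  have := numParticles_modify x SiteState.addActive η
  rw [SiteState.count_addActive] at this
  simp only [addAt]; omega

theorem numParticles_removeActive {x : V} {η : V → SiteState} (h : 0 < (η x).activeCount) :
    numParticles (modify x SiteState.removeActive η) + 1 = numParticles η := by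
  have := numParticles_modify x SiteState.removeActive η
  have := SiteState.count_removeActive h
  omega

theorem numParticles_act_le {x : V} {η : V → SiteState} (h : 0 < (η x).activeCount)
    (i : Option (Option V)) : numParticles (act x i η) ≤ numParticles η := by
  have h1 := numParticles_removeActive h
  rcases i with _ | _ | y
  · have := numParticles_modify x SiteState.trySleep η
    rw [SiteState.count_trySleep] at this
    simp only [act]; omega
  · simp only [act]; omega
  · simp only [act, numParticles_addAt]; omega

theorem finite_numParticles_le (N : ℕ) : {η : V → SiteState | numParticles η ≤ N}.Finite := by
  have hS : {s : SiteState | s.count ≤ N}.Finite := by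
    refine (((Set.finite_singleton SiteState.empty).insert SiteState.sleeping).union
      ((Set.finite_Iio N).image SiteState.active)).subset fun s hs => ?_
    rcases s with _ | _ | k
    · simp
    · simp
    · right; exact ⟨k, by simpa [SiteState.count, Nat.succ_le_iff] using hs, rfl⟩
  refine (Set.Finite.pi fun _ : V => hS).subset fun η hη => ?_
  simp only [Set.mem_pi, Set.mem_ofPred_eq]
  intro x _
  exact (Finset.single_le_sum (f := fun y => (η y).count) (fun y _ => Nat.zero_le _)
    (Finset.mem_univ x)).trans hη

/-- Maximum principle for toppling-invariant functions. If the maximum were positive, then among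
the maximizers with fewest particles one could keep moving an active particle until it is killed. -/
theorem IsTopplingInvariant.nonpos (hK : IsKilled K) (hlam : 0 < lam)
    {g : (V → SiteState) → ℝ} (hg : IsTopplingInvariant K lam g)
    (h0 : ∀ η, IsStable η → g η ≤ 0) (η : V → SiteState) : g η ≤ 0 := by
  by_contra! hη
  obtain ⟨η₁, hη₁, hmax⟩ := Set.exists_max_image {ζ | numParticles ζ ≤ numParticles η} g
    (finite_numParticles_le _) ⟨η, le_refl (numParticles η)⟩
  have hM : 0 < g η₁ := hη.trans_le (hmax η (le_refl (numParticles η)))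
  obtain ⟨η₂, hη₂, hmin⟩ := Set.exists_min_image
    {ζ | numParticles ζ ≤ numParticles η ∧ g ζ = g η₁} numParticles
    ((finite_numParticles_le (numParticles η)).subset fun ζ hζ => hζ.1) ⟨η₁, hη₁, rfl⟩
  -- every possible outcome of a toppling of a maximizer is a maximizer
  have key : ∀ ζ x i, numParticles ζ ≤ numParticles η → g ζ = g η₁ → 0 < (ζ x).activeCount →
      0 < instrWeight K lam x i → g (act x i ζ) = g η₁ := by
    intro ζ x i hζ hgζ hx hi
    by_contra hne
    have hle : ∀ j, g (act x j ζ) ≤ g η₁ := fun j =>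
      hmax _ ((numParticles_act_le hx j).trans hζ)
    have h1 : topple K lam g x ζ < ∑ j, instrWeight K lam x j * g η₁ :=
      Finset.sum_lt_sum
        (fun j _ => mul_le_mul_of_nonneg_left (hle j) (instrWeight_nonneg hK hlam x j))
        ⟨i, Finset.mem_univ i, mul_lt_mul_of_pos_left (lt_of_le_of_ne (hle i) hne) hi⟩
    rw [← Finset.sum_mul, sum_instrWeight hlam, one_mul, ← hg ζ x hx, hgζ] at h1
    exact lt_irrefl _ h1
  classical
  let S : Finset V := Finset.univ.filter fun z => ∃ ζ, numParticles ζ ≤ numParticles η ∧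
    g ζ = g η₁ ∧ numParticles ζ = numParticles η₂ ∧ 0 < (ζ z).activeCount
  have hS : S.Nonempty := by
    have : ¬ IsStable η₂ := fun h => by linarith [h0 η₂ h, hη₂.2]
    obtain ⟨x, hx⟩ := exists_active this
    exact ⟨x, by simpa [S] using ⟨η₂, hη₂.1, hη₂.2, rfl, hx⟩⟩
  obtain ⟨x, hx, hleak⟩ := hK.exists_leak hS
  simp only [S, Finset.mem_filter, Finset.mem_univ, true_and] at hx hleak
  obtain ⟨ζ, hζ1, hζ2, hζ3, hζx⟩ := hx
  have h1 := numParticles_removeActive hζx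
  rcases hleak with ⟨y, hy, hKy⟩ | hlt
  · refine hy ⟨act x (some (some y)) ζ, (numParticles_act_le hζx _).trans hζ1,
      key ζ x _ hζ1 hζ2 hζx (div_pos hKy (by linarith)), ?_, ?_⟩
    · simp only [act, numParticles_addAt]; omega
    · simp only [act, addAt, modify_self]; exact SiteState.activeCount_addActive_pos _
  · have h2 := hmin (act x (some none) ζ) ⟨(numParticles_act_le hζx _).trans hζ1,
      key ζ x _ hζ1 hζ2 hζx (div_pos (by linarith) (by linarith))⟩
    simp only [act] at h2
    omega

end Stabilization

/-! ### The chain and its distances to equilibrium -/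

section Chain

variable {V : Type*} [Fintype V] [DecidableEq V] {K : V → V → ℝ} {lam : ℝ} {ν : V → ℝ}

theorem IsTopplingInvariant.sub {f g : (V → SiteState) → ℝ} (hf : IsTopplingInvariant K lam f)
    (hg : IsTopplingInvariant K lam g) : IsTopplingInvariant K lam fun η => f η - g η := by
  intro η x hx
  beta_reduce
  rw [hf η x hx, hg η x hx]
  simp only [topple, mul_sub, Finset.sum_sub_distrib]

theorem IsTopplingInvariant.sum {ι : Type*} [Fintype ι] {g : ι → (V → SiteState) → ℝ}
    (c : ι → ℝ) (hg : ∀ i, IsTopplingInvariant K lam (g i)) :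
    IsTopplingInvariant K lam fun η => ∑ i, c i * g i η := by
  intro η x hx
  simp only [topple, Finset.mul_sum]
  rw [Finset.sum_comm]
  refine Finset.sum_congr rfl fun i _ => ?_
  rw [hg i η x hx, topple, Finset.mul_sum]
  exact Finset.sum_congr rfl fun j _ => by ring

theorem isTopplingInvariant_const (hlam : 0 < lam) (c : ℝ) :
    IsTopplingInvariant K lam fun _ => c :=
  fun η x _ => (topple_const hlam c x η).symm

/-- Adding a particle before or after stabilization makes no difference. -/
theorem IsTopplingInvariant.comp_addAt {g : (V → SiteState) → ℝ}
    (hg : IsTopplingInvariant K lam g) (y : V) :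
    IsTopplingInvariant K lam fun η => g (addAt y η) := by
  intro η x hx
  beta_reduce
  rw [hg _ x (activeCount_addAt_pos hx), topple, topple]
  exact Finset.sum_congr rfl fun i _ => by rw [act_addAt hx]

theorem isStable_ofStable (ζ : V → Bool) : IsStable (ofStable ζ) := by
  intro x
  simp only [ofStable]
  cases ζ x <;> rfl

theorem ofStable_injective : Function.Injective (ofStable (V := V)) := by
  intro ζ ξ h
  funext x
  have := congrFun h x
  simp only [ofStable] at this
  revert this
  cases ζ x <;> cases ξ x <;> simp [SiteState.ofBool]

theorem exists_eq_ofStable {η : V → SiteState} (h : IsStable η) : ∃ ζ, η = ofStable ζ := by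
  refine ⟨fun x => decide (η x = SiteState.sleeping), funext fun x => ?_⟩
  have := h x
  rcases hx : η x with _ | _ | k
  · simp [ofStable, hx, SiteState.ofBool]
  · simp [ofStable, hx, SiteState.ofBool]
  · simp [hx, SiteState.activeCount] at this

/-- The value of a toppling-invariant function is its expectation after stabilization. -/
theorem IsTopplingInvariant.eq_sum (hK : IsKilled K) (hlam : 0 < lam)
    {g : (V → SiteState) → ℝ} (hg : IsTopplingInvariant K lam g) (η : V → SiteState) :
    g η = ∑ ζ, g (ofStable ζ) * stabProb K lam η (ofStable ζ) := by
  have hs : IsTopplingInvariant K lam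
      fun η => ∑ ζ, g (ofStable ζ) * stabProb K lam η (ofStable ζ) :=
    IsTopplingInvariant.sum _ fun ζ => isTopplingInvariant_stabProb hK hlam (isStable_ofStable ζ)
  have hst : ∀ η, IsStable η →
      ∑ ζ, g (ofStable ζ) * stabProb K lam η (ofStable ζ) = g η := by
    intro η hη
    obtain ⟨ξ, rfl⟩ := exists_eq_ofStable hη
    simp only [stabProb_of_isStable hη, ofStable_injective.eq_iff, mul_ite, mul_one, mul_zero]
    simp
  have h1 := (hg.sub hs).nonpos hK hlam (fun η hη => by rw [hst η hη]; linarith) η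
  have h2 := (hs.sub hg).nonpos hK hlam (fun η hη => by rw [hst η hη]; linarith) η
  linarith

theorem sum_stabProb (hK : IsKilled K) (hlam : 0 < lam) (η : V → SiteState) :
    ∑ ζ, stabProb K lam η (ofStable ζ) = 1 := by
  have := (isTopplingInvariant_const (K := K) hlam 1).eq_sum hK hlam η
  simpa using this.symm

/-- Expectation of `g` after the insertion of an active particle at a random site. -/
def insertStep (ν : V → ℝ) (g : (V → SiteState) → ℝ) (η : V → SiteState) : ℝ :=
  ∑ x, ν x * g (addAt x η)

theorem IsTopplingInvariant.iterate_insertStep {g : (V → SiteState) → ℝ}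
    (hg : IsTopplingInvariant K lam g) (ν : V → ℝ) (t : ℕ) :
    IsTopplingInvariant K lam ((insertStep ν)^[t] g) := by
  induction t with
  | zero => exact hg
  | succ t ih =>
    rw [Function.iterate_succ_apply']
    exact IsTopplingInvariant.sum _ fun x => ih.comp_addAt x

/-- Abelian property of the chain: all particles may be inserted before the stabilization. -/
theorem transitionMatrix_pow (hK : IsKilled K) (hlam : 0 < lam) (t : ℕ) (ζ ξ : V → Bool) :
    (transitionMatrix K lam ν ^ t) ζ ξ
      = (insertStep ν)^[t] (fun η => stabProb K lam η (ofStable ξ)) (ofStable ζ) := by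
  induction t generalizing ζ with
  | zero =>
    simp only [pow_zero, Function.iterate_zero, id, Matrix.one_apply,
      stabProb_of_isStable (isStable_ofStable ζ), ofStable_injective.eq_iff]
  | succ t ih =>
    have hinv := (isTopplingInvariant_stabProb hK hlam (isStable_ofStable ξ)).iterate_insertStep ν t
    rw [pow_succ', Matrix.mul_apply, Function.iterate_succ_apply', insertStep]
    have hP : ∀ ζ', transitionMatrix K lam ν ζ ζ'
        = ∑ x, ν x * stabProb K lam (addAt x (ofStable ζ)) (ofStable ζ') := fun ζ' => rfl
    simp only [ih, hP, Finset.sum_mul]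
    rw [Finset.sum_comm]
    refine Finset.sum_congr rfl fun x _ => ?_
    rw [hinv.eq_sum hK hlam (addAt x (ofStable ζ)), Finset.mul_sum]
    exact Finset.sum_congr rfl fun ζ' _ => by
      rw [mul_assoc, mul_comm (stabProb _ _ _ _)]

/-- Add one active particle at each site of `A`. -/
def addOn (A : Finset V) (η : V → SiteState) : V → SiteState :=
  fun x => if x ∈ A then (η x).addActive else η x

theorem addOn_empty (η : V → SiteState) : addOn ∅ η = η := by
  funext x; simp [addOn]

theorem addAt_addOn {A : Finset V} {x : V} (hx : x ∉ A) (η : V → SiteState) :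
    addAt x (addOn A η) = addOn (insert x A) η := by
  funext y
  by_cases h : y = x
  · subst h; rw [addAt, modify_self]; simp [addOn, hx]
  · rw [addAt, modify_of_ne h]; simp [addOn, h]

theorem activeCount_addOn_pos {A : Finset V} {x : V} (hx : x ∈ A) (η : V → SiteState) :
    0 < (addOn A η x).activeCount := by
  simp only [addOn, hx, if_true]; exact SiteState.activeCount_addActive_pos _

/-- A particle arriving at an active site may be moved on, without changing the site. -/
theorem IsTopplingInvariant.addAt_eq (hlam : 0 < lam) {g : (V → SiteState) → ℝ}
    (hg : IsTopplingInvariant K lam g) {η : V → SiteState} {x : V}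
    (hx : 0 < (η x).activeCount) :
    g (addAt x η) = ∑ y, K x y * g (addAt y η) + (1 - ∑ y, K x y) * g η := by
  have h1 := hg (addAt x η) x (activeCount_addAt_pos hx)
  have h2 : modify x SiteState.removeActive (addAt x η) = η := by
    funext y
    by_cases h : y = x
    · subst h
      rw [modify_self, addAt, modify_self, SiteState.removeActive_addActive hx]
    · rw [modify_of_ne h, addAt, modify_of_ne h]
  have h3 : modify x SiteState.trySleep (addAt x η) = addAt x η := by
    funext y
    by_cases h : y = x
    · subst h
      rw [modify_self, addAt, modify_self]
      rcases hs : η y with _ | _ | k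
      · simp [hs, SiteState.activeCount] at hx
      · simp [hs, SiteState.activeCount] at hx
      · rfl
    · rw [modify_of_ne h]
  rw [topple_eq, jumpMean, h2, h3] at h1
  have h4 : (1 + lam) ≠ 0 := by positivity
  field_simp at h1
  linarith

/-- Moving the inserted particles first, as long as they do not find a site that is not occupied
by an inserted particle, relates the chain to internal aggregation. -/
theorem IsTopplingInvariant.iterate_insertStep_addOn (hK : IsKilled K) (hlam : 0 < lam)
    {g : (V → SiteState) → ℝ} (hg : IsTopplingInvariant K lam g) (η : V → SiteState) (t : ℕ)
    (A : Finset V) : (insertStep ν)^[t] g (addOn A η)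
      = (aggStep K ν)^[t] (fun B => g (addOn B η)) A := by
  induction t generalizing A with
  | zero => rfl
  | succ t ih =>
    rw [Function.iterate_succ_apply', Function.iterate_succ_apply', insertStep, aggStep]
    refine Finset.sum_congr rfl fun x _ => ?_
    congr 1
    have hinv := hg.iterate_insertStep ν t
    refine congrFun (hK.eq_release (u := fun x => (insertStep ν)^[t] g (addAt x (addOn A η)))
      (fun y hy => ?_) fun y hy => ?_) x
    · rw [hinv.addAt_eq hlam (activeCount_addOn_pos hy η), ih]
    · rw [addAt_addOn hy, ih]

/-- One active particle at each site of `A`, and no other particle. -/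
def activeOn (A : Finset V) : V → SiteState :=
  fun x => if x ∈ A then SiteState.active 0 else SiteState.empty

theorem addOn_eq_activeOn (A : Finset V) : addOn A (ofStable fun _ => false) = activeOn A := by
  funext x
  simp only [addOn, activeOn, ofStable, SiteState.ofBool, SiteState.addActive]

/-- All configurations in which every site is active have the same stabilization law. -/
theorem IsTopplingInvariant.eq_of_forall_active (hK : IsKilled K) (hlam : 0 < lam)
    {g : (V → SiteState) → ℝ} (hg : IsTopplingInvariant K lam g) {η : V → SiteState}
    (hη : ∀ x, 0 < (η x).activeCount) : g η = g (activeOn Finset.univ) := by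
  have hadd : ∀ ω : V → SiteState, (∀ x, 0 < (ω x).activeCount) → ∀ x, g (addAt x ω) = g ω := by
    intro ω hω x
    have h1 : (fun x => g (addAt x ω)) = release K (fun _ => g ω) Finset.univ :=
      hK.eq_release (fun y _ => hg.addAt_eq hlam (hω y)) fun y hy => absurd (Finset.mem_univ y) hy
    rw [congrFun h1 x, hK.release_const]
  induction hN : numParticles η using Nat.strong_induction_on generalizing η with
  | _ N ih =>
    by_cases hall : ∀ x, η x = SiteState.active 0
    · congr 1
      funext x
      simp [activeOn, hall x]
    · push Not at hall
      obtain ⟨x, hx⟩ := hall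
      have hact : 0 < (modify x SiteState.removeActive η x).activeCount := by
        rw [modify_self]
        have := hη x
        rcases hs : η x with _ | _ | _ | k <;>
          simp_all [SiteState.activeCount, SiteState.removeActive]
      have hback : addAt x (modify x SiteState.removeActive η) = η := by
        funext y
        by_cases h : y = x
        · subst h
          rw [addAt, modify_self, modify_self, SiteState.addActive_removeActive (hη y)]
        · rw [addAt, modify_of_ne h, modify_of_ne h]
      have hall' : ∀ y, 0 < (modify x SiteState.removeActive η y).activeCount := by
        intro y
        by_cases h : y = x
        · subst h; exact hact
        · rw [modify_of_ne h]; exact hη y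
      have hn := numParticles_removeActive (hη x)
      rw [← ih _ (by omega) hall' rfl, ← hadd _ hall' x, hback]

/-- The stabilization law of the configuration with one active particle at each site; it is the
invariant law of the chain. -/
def fullStabLaw (K : V → V → ℝ) (lam : ℝ) (ξ : V → Bool) : ℝ :=
  stabProb K lam (activeOn Finset.univ) (ofStable ξ)

theorem IsTopplingInvariant.addOn_univ (hK : IsKilled K) (hlam : 0 < lam)
    {g : (V → SiteState) → ℝ} (hg : IsTopplingInvariant K lam g) (η : V → SiteState) :
    g (addOn Finset.univ η) = g (activeOn Finset.univ) :=
  hg.eq_of_forall_active hK hlam fun x => activeCount_addOn_pos (Finset.mem_univ x) η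

/-- The time at which aggregation has filled all sites acts as a strong stationary time. -/
theorem le_transitionMatrix_pow (hK : IsKilled K) (hlam : 0 < lam) (hν : ∀ x, 0 ≤ ν x)
    (hν1 : ∑ x, ν x = 1) (t : ℕ) (ζ ξ : V → Bool) :
    (1 - vacantProb K ν t ∅) * fullStabLaw K lam ξ ≤ (transitionMatrix K lam ν ^ t) ζ ξ := by
  have hinv := isTopplingInvariant_stabProb hK hlam (isStable_ofStable ξ)
  have h0 : 0 ≤ fullStabLaw K lam ξ := stabProb_nonneg hK hlam _ _
  rw [transitionMatrix_pow hK hlam, ← addOn_empty (ofStable ζ),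
    hinv.iterate_insertStep_addOn hK hlam]
  generalize (∅ : Finset V) = A
  induction t generalizing A with
  | zero =>
    by_cases hA : A = Finset.univ
    · subst hA
      simp only [Function.iterate_zero, id, vacantProb, if_true, sub_zero, one_mul]
      exact (hinv.addOn_univ hK hlam (ofStable ζ)).ge
    · simp only [Function.iterate_zero, id, vacantProb, hA, if_false, sub_self, zero_mul]
      exact stabProb_nonneg hK hlam _ _
  | succ t ih =>
    rw [Function.iterate_succ_apply']
    calc (1 - vacantProb K ν (t + 1) A) * fullStabLaw K lam ξ
        = aggStep K ν (fun B => fullStabLaw K lam ξ * 1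
            + (-fullStabLaw K lam ξ) * vacantProb K ν t B) A := by
          rw [aggStep_lin hK (f := fun _ => 1), aggStep_const hK hν1, vacantProb_succ]; ring
      _ ≤ _ := aggStep_mono hK hν (by linarith [ih A]) fun y _ => by linarith [ih (insert y A)]

theorem stabProb_eq_zero_of_numParticles_lt (hK : IsKilled K) (hlam : 0 < lam)
    {η ξ : V → SiteState} (hξ : IsStable ξ) (h : numParticles η < numParticles ξ) :
    stabProb K lam η ξ = 0 := by
  refine tendsto_nhds_unique (tendsto_toppleLaw hK hlam hξ η) ?_
  have : ∀ n, toppleLaw K lam ξ n η = 0 := by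
    intro n
    induction n generalizing η with
    | zero => rw [toppleLaw, if_neg]; rintro rfl; exact lt_irrefl _ h
    | succ n ih =>
      by_cases hη : IsStable η
      · rw [toppleLaw_of_isStable hη, if_neg]; rintro rfl; exact lt_irrefl _ h
      · obtain ⟨x, hx⟩ := exists_active hη
        rw [toppleLaw_succ hξ n η x hx]
        refine Finset.sum_eq_zero fun i _ => ?_
        rw [ih ((numParticles_act_le hx i).trans_lt h), mul_zero]
  simp only [this, tendsto_const_nhds]

theorem numParticles_activeOn (A : Finset V) : numParticles (activeOn A) = A.card := by
  have : ∀ x, (activeOn A x).count = if x ∈ A then 1 else 0 := fun x => by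
    simp only [activeOn]; split_ifs <;> rfl
  simp [numParticles, this]

/-- From the empty configuration, the full one can only be reached if all sites are filled by
aggregation. -/
theorem transitionMatrix_pow_empty_full (hK : IsKilled K) (hlam : 0 < lam)
    (hν1 : ∑ x, ν x = 1) (t : ℕ) :
    (transitionMatrix K lam ν ^ t) (fun _ => false) (fun _ => true)
      = (1 - vacantProb K ν t ∅) * fullStabLaw K lam fun _ => true := by
  have hinv := isTopplingInvariant_stabProb hK hlam (isStable_ofStable (V := V) fun _ => true)
  rw [transitionMatrix_pow hK hlam, ← addOn_empty (ofStable fun _ => false),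
    hinv.iterate_insertStep_addOn hK hlam]
  generalize (∅ : Finset V) = A
  induction t generalizing A with
  | zero =>
    by_cases hA : A = Finset.univ
    · subst hA
      simp only [Function.iterate_zero, id, vacantProb, if_true, sub_zero, one_mul]
      exact hinv.addOn_univ hK hlam _
    · simp only [Function.iterate_zero, id, vacantProb, hA, if_false, sub_self, zero_mul]
      refine stabProb_eq_zero_of_numParticles_lt hK hlam (isStable_ofStable _) ?_
      have : numParticles (ofStable fun _ : V => true) = Fintype.card V := by
        simp [numParticles, ofStable, SiteState.ofBool, SiteState.count]
      rw [addOn_eq_activeOn, numParticles_activeOn, this]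
      exact (Finset.card_lt_iff_ne_univ A).mpr hA
  | succ t ih =>
    have hfun : (aggStep K ν)^[t] (fun B => stabProb K lam (addOn B (ofStable fun _ => false))
        (ofStable fun _ => true)) = fun B => fullStabLaw K lam (fun _ => true) * 1
            + (-fullStabLaw K lam (fun _ => true)) * vacantProb K ν t B := by
      funext B; rw [ih]; ring
    rw [Function.iterate_succ_apply', hfun, aggStep_lin hK (f := fun _ => 1),
      aggStep_const hK hν1, vacantProb_succ]
    ring

/-- Lower bound for the probability that all active particles fall asleep at once. -/
theorem pow_le_stabProb (hK : IsKilled K) (hlam : 0 < lam) {ξ : V → Bool} {A : Finset V}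
    (hA : ∀ x ∈ A, ξ x = true) : (lam / (1 + lam)) ^ A.card ≤
      stabProb K lam (fun x => if x ∈ A then SiteState.active 0 else ofStable ξ x)
        (ofStable ξ) := by
  induction A using Finset.induction_on with
  | empty =>
    have := stabProb_of_isStable (K := K) (lam := lam) (ξ := ofStable ξ) (isStable_ofStable ξ)
    simp [this]
  | insert x A hx ih =>
    set η : V → SiteState := fun z => if z ∈ insert x A then SiteState.active 0 else ofStable ξ z
    have hηx : η x = SiteState.active 0 := by simp [η]
    have hinv := isTopplingInvariant_stabProb hK hlam (isStable_ofStable ξ) η x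
      (by simp [hηx, SiteState.activeCount])
    simp only at hinv
    rw [hinv, Finset.card_insert_of_notMem hx, pow_succ, mul_comm]
    have h1 : act x none η = fun z => if z ∈ A then SiteState.active 0 else ofStable ξ z := by
      funext z
      by_cases h : z = x
      · subst h
        rw [act, modify_self, hηx]
        simp [hx, ofStable, hA z (Finset.mem_insert_self z A), SiteState.ofBool,
          SiteState.trySleep]
      · rw [act, modify_of_ne h]; simp [η, h]
    have h2 := ih fun z hz => hA z (Finset.mem_insert_of_mem hz)
    rw [← h1] at h2
    calc lam / (1 + lam) * (lam / (1 + lam)) ^ A.card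
        ≤ instrWeight K lam x none * stabProb K lam (act x none η) (ofStable ξ) :=
          mul_le_mul_of_nonneg_left h2 (by positivity)
      _ ≤ _ := Finset.single_le_sum
          (f := fun i => instrWeight K lam x i * stabProb K lam (act x i η) (ofStable ξ))
          (fun i _ => mul_nonneg (instrWeight_nonneg hK hlam x i) (stabProb_nonneg hK hlam _ _))
          (Finset.mem_univ none)

theorem activeOn_eq (ξ : V → Bool) : activeOn (Finset.univ.filter fun x => ξ x = true)
    = fun x => if x ∈ Finset.univ.filter (fun x => ξ x = true) then SiteState.active 0
      else ofStable ξ x := by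
  funext x
  simp only [activeOn, Finset.mem_filter, Finset.mem_univ, true_and, ofStable]
  cases h : ξ x <;> simp [SiteState.ofBool]

theorem pow_le_fullStabLaw (hK : IsKilled K) (hlam : 0 < lam) :
    (lam / (1 + lam)) ^ Fintype.card V ≤ fullStabLaw K lam fun _ : V => true := by
  have h1 := pow_le_stabProb (A := Finset.univ) hK hlam (ξ := fun _ : V => true) fun _ _ => rfl
  have h2 : (fun x : V => if x ∈ Finset.univ then SiteState.active 0
      else ofStable (fun _ => true) x) = activeOn Finset.univ := by
    funext x; simp [activeOn]
  rwa [h2, Finset.card_univ] at h1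

/-- An additional active particle may leave without changing the configuration, so that it does
not destroy the possibility of reaching `ξ`. -/
theorem stabProb_activeOn_insert_pos (hK : IsKilled K) (hlam : 0 < lam) {ξ : V → Bool}
    {A : Finset V} (hA : 0 < stabProb K lam (activeOn A) (ofStable ξ)) (x : V) :
    0 < stabProb K lam (addAt x (activeOn A)) (ofStable ξ) := by
  by_contra hx
  have hrem : ∀ x, modify x SiteState.removeActive (addAt x (activeOn A)) = activeOn A := by
    intro x
    funext y
    by_cases h : y = x
    · subst h
      rw [modify_self, addAt, modify_self]
      simp only [activeOn]
      split_ifs <;> rfl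
    · rw [modify_of_ne h, addAt, modify_of_ne h]
  obtain ⟨z, hz, hleak⟩ := hK.exists_leak
    (S := Finset.univ.filter fun z => ¬ 0 < stabProb K lam (addAt z (activeOn A)) (ofStable ξ))
    ⟨x, by simpa using hx⟩
  simp only [Finset.mem_filter, Finset.mem_univ, true_and, not_not] at hz hleak
  apply hz
  have hact : 0 < (addAt z (activeOn A) z).activeCount := by
    rw [addAt, modify_self]; exact SiteState.activeCount_addActive_pos _
  have hinv := isTopplingInvariant_stabProb hK hlam (isStable_ofStable ξ) _ z hact
  simp only at hinv
  rw [hinv]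
  have hterm : ∀ i, 0 ≤ instrWeight K lam z i
      * stabProb K lam (act z i (addAt z (activeOn A))) (ofStable ξ) := fun i =>
    mul_nonneg (instrWeight_nonneg hK hlam z i) (stabProb_nonneg hK hlam _ _)
  rcases hleak with ⟨y, hy, hKy⟩ | hlt
  · refine Finset.sum_pos' (fun i _ => hterm i) ⟨some (some y), Finset.mem_univ _, ?_⟩
    rw [act, hrem]
    exact mul_pos (div_pos hKy (by linarith)) hy
  · refine Finset.sum_pos' (fun i _ => hterm i) ⟨some none, Finset.mem_univ _, ?_⟩
    rw [act, hrem]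
    exact mul_pos (div_pos (by linarith) (by linarith)) hA

theorem fullStabLaw_pos (hK : IsKilled K) (hlam : 0 < lam) (ξ : V → Bool) :
    0 < fullStabLaw K lam ξ := by
  set A : Finset V := Finset.univ.filter fun x => ξ x = true
  have h0 : 0 < stabProb K lam (activeOn A) (ofStable ξ) := by
    rw [activeOn_eq]
    exact lt_of_lt_of_le (by positivity) (pow_le_stabProb hK hlam fun x hx => by simpa using hx)
  have h1 : ∀ B : Finset V, 0 < stabProb K lam (activeOn (B ∪ A)) (ofStable ξ) := by
    intro B
    induction B using Finset.induction_on with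
    | empty => simpa using h0
    | insert x B _ ih =>
      rw [Finset.insert_union]
      by_cases hx : x ∈ B ∪ A
      · rwa [Finset.insert_eq_of_mem hx]
      · rw [← addOn_eq_activeOn, ← addAt_addOn hx, addOn_eq_activeOn]
        exact stabProb_activeOn_insert_pos hK hlam ih x
  have := h1 Finset.univ
  rwa [Finset.union_eq_left.mpr (Finset.subset_univ A)] at this

theorem sum_transitionMatrix (hK : IsKilled K) (hlam : 0 < lam) (hν1 : ∑ x, ν x = 1)
    (ζ : V → Bool) : ∑ ξ, transitionMatrix K lam ν ζ ξ = 1 := by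
  simp only [transitionMatrix, Matrix.of_apply]
  rw [Finset.sum_comm]
  simp only [← Finset.mul_sum, sum_stabProb hK hlam, mul_one, hν1]

theorem sum_transitionMatrix_pow (hK : IsKilled K) (hlam : 0 < lam) (hν1 : ∑ x, ν x = 1) (t : ℕ)
    (ζ : V → Bool) : ∑ ξ, (transitionMatrix K lam ν ^ t) ζ ξ = 1 := by
  induction t generalizing ζ with
  | zero => simp [Matrix.one_apply]
  | succ t ih =>
    simp only [pow_succ', Matrix.mul_apply]
    rw [Finset.sum_comm]
    simp only [← Finset.mul_sum, ih, mul_one, sum_transitionMatrix hK hlam hν1]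

theorem isInvariantLaw_fullStabLaw (hK : IsKilled K) (hlam : 0 < lam) (hν1 : ∑ x, ν x = 1) :
    IsInvariantLaw (transitionMatrix K lam ν) (fullStabLaw K lam) := by
  refine ⟨fun ξ => stabProb_nonneg hK hlam _ _, sum_stabProb hK hlam _, fun ξ => ?_⟩
  have hinv := isTopplingInvariant_stabProb hK hlam (isStable_ofStable ξ)
  have h1 := (hinv.iterate_insertStep ν 1).eq_sum hK hlam (activeOn Finset.univ)
  simp only [Function.iterate_one] at h1
  have h2 : ∀ x, stabProb K lam (addAt x (activeOn Finset.univ)) (ofStable ξ)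
      = fullStabLaw K lam ξ := fun x =>
    hinv.eq_of_forall_active hK hlam fun y =>
      activeCount_addAt_pos (by simp [activeOn, SiteState.activeCount])
  calc ∑ ζ, fullStabLaw K lam ζ * transitionMatrix K lam ν ζ ξ
      = insertStep ν (fun η => stabProb K lam η (ofStable ξ)) (activeOn Finset.univ) := by
        rw [h1]
        exact Finset.sum_congr rfl fun ζ _ => mul_comm _ _
    _ = fullStabLaw K lam ξ := by
        simp only [insertStep, h2, ← Finset.sum_mul, hν1, one_mul]

theorem IsAdmissible.isKilled (h : IsAdmissible K lam ν) : IsKilled K :=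
  ⟨h.kernel_nonneg, h.kernel_sum_le, h.kernel_nondegenerate⟩

theorem IsAdmissible.meanHit_pos (h : IsAdmissible K lam ν) (x : V) : 0 < meanHit K ν x := by
  obtain ⟨y, hy, hyx⟩ := h.law_reaches x
  exact Finset.sum_pos'
    (fun z _ => mul_nonneg (h.law_nonneg z) (h.isKilled.hitProb_nonneg x z))
    ⟨y, Finset.mem_univ y, mul_pos hy (h.isKilled.hitProb_pos hyx)⟩

theorem IsAdmissible.tendsto_vacantProb (h : IsAdmissible K lam ν) :
    Tendsto (fun t => vacantProb K ν t ∅) atTop (𝓝 0) := by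
  have hp := h.meanHit_pos
  have hρ : ∀ x, 1 ≤ (∑ y, (meanHit K ν y)⁻¹) * meanHit K ν x := by
    intro x
    have h1 : (meanHit K ν x)⁻¹ ≤ ∑ y, (meanHit K ν y)⁻¹ :=
      Finset.single_le_sum (f := fun y => (meanHit K ν y)⁻¹)
        (fun y _ => inv_nonneg.mpr (hp y).le) (Finset.mem_univ x)
    calc (1 : ℝ) = (meanHit K ν x)⁻¹ * meanHit K ν x := (inv_mul_cancel₀ (hp x).ne').symm
      _ ≤ _ := mul_le_mul_of_nonneg_right h1 (hp x).le
  obtain ⟨m, hm, -⟩ := exists_fillTime_concentration h.isKilled h.law_nonneg h.law_sum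
    (Finset.sum_nonneg fun y _ => inv_nonneg.mpr (hp y).le) hρ
  exact (summable_of_sum_range_le
    (fun t => vacantProb_nonneg h.isKilled h.law_nonneg h.law_sum t ∅) hm).tendsto_atTop_zero

theorem IsInvariantLaw.pow {X : Type*} [Fintype X] [DecidableEq X] {P : Matrix X X ℝ} {μ : X → ℝ}
    (h : IsInvariantLaw P μ) (t : ℕ) (y : X) : ∑ x, μ x * (P ^ t) x y = μ y := by
  induction t generalizing y with
  | zero => simp [Matrix.one_apply]
  | succ t ih =>
    simp only [pow_succ, Matrix.mul_apply, Finset.mul_sum]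
    rw [Finset.sum_comm]
    simp only [← mul_assoc, ← Finset.sum_mul, ih]
    exact h.2.2 y

theorem IsAdmissible.eq_fullStabLaw (h : IsAdmissible K lam ν) {μ : (V → Bool) → ℝ}
    (hμ : IsInvariantLaw (transitionMatrix K lam ν) μ) : μ = fullStabLaw K lam := by
  have hle : ∀ ξ, fullStabLaw K lam ξ ≤ μ ξ := by
    intro ξ
    have h1 : ∀ t, (1 - vacantProb K ν t ∅) * fullStabLaw K lam ξ ≤ μ ξ := by
      intro t
      rw [← hμ.pow t ξ]
      calc (1 - vacantProb K ν t ∅) * fullStabLaw K lam ξ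
          = ∑ ζ, μ ζ * ((1 - vacantProb K ν t ∅) * fullStabLaw K lam ξ) := by
            rw [← Finset.sum_mul, hμ.2.1, one_mul]
        _ ≤ _ := Finset.sum_le_sum fun ζ _ => mul_le_mul_of_nonneg_left
            (le_transitionMatrix_pow h.isKilled h.rate_pos h.law_nonneg h.law_sum t ζ ξ) (hμ.1 ζ)
    have h2 : Tendsto (fun t => (1 - vacantProb K ν t ∅) * fullStabLaw K lam ξ) atTop
        (𝓝 ((1 - 0) * fullStabLaw K lam ξ)) :=
      (tendsto_const_nhds.sub h.tendsto_vacantProb).mul_const _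
    have := le_of_tendsto' h2 h1
    linarith
  have hsum : ∑ ξ, fullStabLaw K lam ξ = ∑ ξ, μ ξ := by
    rw [hμ.2.1]; exact sum_stabProb h.isKilled h.rate_pos _
  funext ξ
  exact ((Finset.sum_eq_sum_iff_of_le fun ξ _ => hle ξ).mp hsum ξ (Finset.mem_univ ξ)).symm

theorem IsAdmissible.existsUnique_invariantLaw (h : IsAdmissible K lam ν) :
    ∃! μ, IsInvariantLaw (transitionMatrix K lam ν) μ :=
  ⟨_, isInvariantLaw_fullStabLaw h.isKilled h.rate_pos h.law_sum, fun _ hμ => h.eq_fullStabLaw hμ⟩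

theorem IsAdmissible.invariantLaw_eq (h : IsAdmissible K lam ν) :
    invariantLaw (transitionMatrix K lam ν) = fullStabLaw K lam :=
  h.eq_fullStabLaw (Classical.epsilon_spec
    ⟨_, isInvariantLaw_fullStabLaw h.isKilled h.rate_pos h.law_sum⟩)

/-- The separation distance is the tail of the filling time of aggregation; the worst pair consists
of the empty initial and the full final configuration. -/
theorem IsAdmissible.sepDistance_eq (h : IsAdmissible K lam ν) (t : ℕ) :
    sepDistance (transitionMatrix K lam ν) t = vacantProb K ν t ∅ := by
  have hpos := fullStabLaw_pos h.isKilled h.rate_pos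
  rw [sepDistance, h.invariantLaw_eq]
  refine le_antisymm (ciSup_le fun p => ?_) ?_
  · have := le_transitionMatrix_pow h.isKilled h.rate_pos h.law_nonneg h.law_sum t p.1 p.2
    rw [← le_div_iff₀ (hpos p.2)] at this
    linarith
  · refine le_trans ?_ (le_ciSup (Set.finite_range _).bddAbove
      ((fun _ => false, fun _ => true) : (V → Bool) × (V → Bool)))
    rw [transitionMatrix_pow_empty_full h.isKilled h.rate_pos h.law_sum,
      mul_div_cancel_right₀ _ (hpos _).ne']
    linarith

theorem IsAdmissible.tvDistance_le (h : IsAdmissible K lam ν) (t : ℕ) :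
    tvDistance (transitionMatrix K lam ν) t ≤ vacantProb K ν t ∅ := by
  have hF := vacantProb_nonneg h.isKilled h.law_nonneg h.law_sum t ∅
  have hπ1 : ∑ ξ, fullStabLaw K lam ξ = 1 := sum_stabProb h.isKilled h.rate_pos _
  have hkey : ∀ (ζ : V → Bool) (A : Finset (V → Bool)), ∑ ξ ∈ A, fullStabLaw K lam ξ
      - ∑ ξ ∈ A, (transitionMatrix K lam ν ^ t) ζ ξ ≤ vacantProb K ν t ∅ := by
    intro ζ A
    have h1 : ∑ ξ ∈ A, (1 - vacantProb K ν t ∅) * fullStabLaw K lam ξ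
        ≤ ∑ ξ ∈ A, (transitionMatrix K lam ν ^ t) ζ ξ := Finset.sum_le_sum fun ξ _ =>
      le_transitionMatrix_pow h.isKilled h.rate_pos h.law_nonneg h.law_sum t ζ ξ
    rw [← Finset.mul_sum] at h1
    have h2 : ∑ ξ ∈ A, fullStabLaw K lam ξ ≤ 1 := by
      rw [← hπ1]
      exact Finset.sum_le_sum_of_subset_of_nonneg (Finset.subset_univ _)
        fun ξ _ _ => (fullStabLaw_pos h.isKilled h.rate_pos ξ).le
    nlinarith
  rw [tvDistance, h.invariantLaw_eq]
  refine ciSup_le fun p => abs_le.mpr ⟨by linarith [hkey p.1 p.2], ?_⟩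
  have h1 := hkey p.1 p.2ᶜ
  have h2 := Finset.sum_add_sum_compl p.2 (fullStabLaw K lam)
  have h3 := Finset.sum_add_sum_compl p.2 ((transitionMatrix K lam ν ^ t) p.1)
  rw [sum_transitionMatrix_pow h.isKilled h.rate_pos h.law_sum] at h3
  linarith

/-- Started from the empty configuration, the chain is in the full configuration with probability
`1 - vacantProb K ν t ∅` times its invariant probability. The latter is at least
`1 - |V| / (1 + lam)`, as this bounds the probability that one active particle at each site all
fall asleep before any of them moves. -/
theorem IsAdmissible.le_tvDistance (h : IsAdmissible K lam ν) (t : ℕ) :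
    (1 - (Fintype.card V : ℝ) / (1 + lam)) * vacantProb K ν t ∅
      ≤ tvDistance (transitionMatrix K lam ν) t := by
  have hF := vacantProb_nonneg h.isKilled h.law_nonneg h.law_sum t ∅
  have hlam := h.rate_pos
  have h1 : 1 - (Fintype.card V : ℝ) / (1 + lam) ≤ fullStabLaw K lam fun _ : V => true := by
    refine le_trans ?_ (pow_le_fullStabLaw h.isKilled hlam)
    have h2 : 1 / (1 + lam) ≤ 1 := by rw [div_le_one (by linarith)]; linarith
    have := one_add_mul_le_pow (a := -(1 / (1 + lam))) (by linarith) (Fintype.card V)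
    have h3 : lam / (1 + lam) = 1 + -(1 / (1 + lam)) := by field_simp; ring
    rw [h3]
    refine le_trans (le_of_eq ?_) this
    ring
  refine (mul_le_mul_of_nonneg_right h1 hF).trans ?_
  rw [tvDistance, h.invariantLaw_eq]
  refine le_trans ?_ (le_ciSup (Set.finite_range _).bddAbove
    ((fun _ => false, {fun _ => true}) : (V → Bool) × Finset (V → Bool)))
  simp only [Finset.sum_singleton]
  rw [transitionMatrix_pow_empty_full h.isKilled h.rate_pos h.law_sum]
  refine le_trans (le_of_eq ?_) (neg_le_abs _)
  ring

end Chain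

/-! ### Concentrated distances have a cutoff -/

section Cutoff

/-- The distances `d n` drop from `1` to `0` around `m n`, on the scale `s n`, at the speed given by
Chebyshev's inequality. -/
structure IsConcentrated (d : ℕ → ℕ → ℝ) (m s : ℕ → ℝ) : Prop where
  mem : ∀ᶠ n in atTop, ∀ t, 0 ≤ d n t ∧ d n t ≤ 1
  pos : ∀ᶠ n in atTop, 0 < m n
  one_le : ∀ᶠ n in atTop, 1 ≤ s n
  small : Tendsto (fun n => s n / m n) atTop (𝓝 0)
  upper : ∀ᶠ n in atTop, ∀ t : ℕ, m n ≤ t → d n t * (t - m n) ^ 2 ≤ s n ^ 2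
  lower : ∃ ε : ℕ → ℝ, Tendsto ε atTop (𝓝 0) ∧
    ∀ᶠ n in atTop, ∀ t : ℕ, t ≤ m n → (1 - ε n - d n t) * (t - m n) ^ 2 ≤ s n ^ 2

variable {d : ℕ → ℕ → ℝ} {m s : ℕ → ℝ}

theorem IsConcentrated.mixingTime (h : IsConcentrated d m s) {δ : ℝ} (h0 : 0 < δ) (h1 : δ < 1) :
    ∃ C, 0 ≤ C ∧ ∀ᶠ n in atTop, |(ARW.mixingTime (d n) δ : ℝ) - m n| ≤ C * s n := by
  obtain ⟨ε, hε, hlow⟩ := h.lower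
  -- at distance `c * s n` from `m n`, the Chebyshev bounds decide whether `d n` is below `δ`
  set c : ℝ := 1 / δ + 2 / (1 - δ)
  have h1' : 0 < 1 - δ := by linarith
  have hc1 : 1 / δ ≤ c := by have : 0 < 2 / (1 - δ) := by positivity
                             simp only [c]; linarith
  have hc2 : 2 / (1 - δ) ≤ c := by have : 0 < 1 / δ := by positivity
                                   simp only [c]; linarith
  have hcδ : 1 ≤ c * δ := by rwa [div_le_iff₀ h0] at hc1
  have hcδ' : 2 ≤ c * (1 - δ) := by rwa [div_le_iff₀ h1'] at hc2
  have hc : 1 ≤ c := by nlinarith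
  refine ⟨c + 1, by linarith, ?_⟩
  filter_upwards [h.pos, h.one_le, h.upper, hlow,
    hε.eventually (gt_mem_nhds (show (0 : ℝ) < (1 - δ) / 2 by linarith))] with n hm hs hup hlo hεn
  set T := ⌈m n + c * s n⌉₊
  have hcs : 0 ≤ c * s n := by positivity
  have hT1 : m n + c * s n ≤ T := Nat.le_ceil _
  have hT2 : (T : ℝ) < m n + c * s n + 1 := Nat.ceil_lt_add_one (by linarith)
  have hdT : d n T ≤ δ := by
    have h2 := hup T (by linarith)
    by_contra! hcon
    have h3 : (c * s n) ^ 2 ≤ (T - m n) ^ 2 := by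
      apply pow_le_pow_left₀ hcs; linarith
    have h4 : s n ^ 2 ≤ δ * (c * s n) ^ 2 := by
      have : 1 ≤ δ * c ^ 2 := by nlinarith
      nlinarith [sq_nonneg (s n)]
    have h5 : 0 < (c * s n) ^ 2 := by positivity
    nlinarith
  have hne : {t | d n t ≤ δ}.Nonempty := ⟨T, hdT⟩
  have hle : ARW.mixingTime (d n) δ ≤ T := Nat.sInf_le hdT
  have hmem : d n (ARW.mixingTime (d n) δ) ≤ δ := Nat.sInf_mem hne
  have hle' : (ARW.mixingTime (d n) δ : ℝ) ≤ T := by exact_mod_cast hle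
  rw [abs_le]
  refine ⟨?_, by linarith⟩
  set τ := ARW.mixingTime (d n) δ
  by_contra! hcon
  have h6 : c * s n ≤ m n - τ := by linarith
  have h7 := hlo τ (by linarith)
  have h8 : (c * s n) ^ 2 ≤ (τ - m n) ^ 2 := by
    rw [← neg_sub, neg_sq]; exact pow_le_pow_left₀ hcs h6 2
  have h9 : (1 - δ) / 2 * (τ - m n) ^ 2 < (1 - ε n - d n τ) * (τ - m n) ^ 2 := by
    refine mul_lt_mul_of_pos_right (by linarith) ?_
    have : 0 < m n - τ := by nlinarith
    rw [← neg_sub, neg_sq]; positivity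
  have h10 : s n ^ 2 ≤ (1 - δ) / 2 * (c * s n) ^ 2 := by
    have : 1 ≤ (1 - δ) / 2 * c ^ 2 := by nlinarith
    nlinarith [sq_nonneg (s n)]
  nlinarith

theorem IsConcentrated.mixingTime_isBigO (h : IsConcentrated d m s) {δ : ℝ} (h0 : 0 < δ)
    (h1 : δ < 1) : (fun n => (ARW.mixingTime (d n) δ : ℝ) - m n) =O[atTop] s := by
  obtain ⟨C, -, hC⟩ := h.mixingTime h0 h1
  refine IsBigO.of_bound C ?_
  filter_upwards [hC, h.one_le] with n hn hs
  rwa [Real.norm_eq_abs, Real.norm_of_nonneg (by linarith)]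

theorem IsConcentrated.hasWindow (h : IsConcentrated d m s) {w : ℕ → ℝ} (hw : s =O[atTop] w) :
    HasWindow d w := by
  intro ε h0 h1
  have := (h.mixingTime_isBigO h0 (by linarith)).sub
    (h.mixingTime_isBigO (δ := 1 - ε) (by linarith) (by linarith))
  simp only [sub_sub_sub_cancel_right] at this
  exact this.trans hw

theorem IsConcentrated.hasCutoff (h : IsConcentrated d m s) : HasCutoff d := by
  obtain ⟨C, hC0, hC⟩ := h.mixingTime (δ := 1 / 2) (by norm_num) (by norm_num)
  obtain ⟨ε, hε, hlow⟩ := h.lower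
  have hsq : Tendsto (fun n => (s n / m n) ^ 2) atTop (𝓝 0) := by
    simpa using h.small.pow 2
  intro α hα0
  refine ⟨fun hα => ?_, fun hα => ?_⟩
  · set κ : ℝ := (1 - α) / 2
    have hκ : 0 < κ := by simp only [κ]; linarith
    have hsmall : ∀ᶠ n in atTop, C * (s n / m n) < κ := by
      have := h.small.const_mul C
      rw [mul_zero] at this
      exact this.eventually (gt_mem_nhds hκ)
    have hlim : Tendsto (fun n => 1 - (ε n + (s n / m n) ^ 2 * (1 / κ ^ 2))) atTop (𝓝 1) := by
      have := (tendsto_const_nhds (x := (1 : ℝ)) (f := atTop)).sub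
        (hε.add (hsq.mul_const (1 / κ ^ 2)))
      simpa using this
    refine tendsto_of_tendsto_of_tendsto_of_le_of_le' hlim tendsto_const_nhds ?_ ?_
    · filter_upwards [h.pos, hlow, hsmall, hC] with n hm hlo hsm hCn
      set τ := ARW.mixingTime (d n) (1 / 2)
      have h1 : (⌊α * (τ : ℝ)⌋₊ : ℝ) ≤ α * τ := Nat.floor_le (by positivity)
      have h2 : (τ : ℝ) ≤ m n + κ * m n := by
        have : C * s n ≤ κ * m n := by
          rw [← mul_div_assoc, div_lt_iff₀ hm] at hsm; exact hsm.le
        linarith [(abs_le.mp hCn).2]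
      have h3 : κ * m n ≤ m n - ⌊α * (τ : ℝ)⌋₊ := by
        have h4 : α * τ ≤ α * (m n + κ * m n) := mul_le_mul_of_nonneg_left h2 hα0
        have h5 : α * κ ≤ κ := by nlinarith
        have h6 : α = 1 - 2 * κ := by simp only [κ]; ring
        nlinarith
      have hκm : 0 < κ * m n := by positivity
      have h4 := hlo ⌊α * (τ : ℝ)⌋₊ (by linarith)
      have h5 : (κ * m n) ^ 2 ≤ (⌊α * (τ : ℝ)⌋₊ - m n) ^ 2 := by
        rw [← neg_sub, neg_sq]; exact pow_le_pow_left₀ hκm.le h3 2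
      by_contra! hcon
      have h6 : (s n / m n) ^ 2 * (1 / κ ^ 2) = s n ^ 2 / (κ * m n) ^ 2 := by field_simp
      rw [h6] at hcon
      have h7 : s n ^ 2 / (κ * m n) ^ 2 < 1 - ε n - d n ⌊α * (τ : ℝ)⌋₊ := by linarith
      rw [div_lt_iff₀ (by positivity)] at h7
      have h8 : 0 ≤ 1 - ε n - d n ⌊α * (τ : ℝ)⌋₊ := by
        have : 0 ≤ s n ^ 2 / (κ * m n) ^ 2 := by positivity
        linarith
      nlinarith
    · filter_upwards [h.mem] with n hn using (hn _).2
  · set κ : ℝ := (α - 1) / (2 * (α + 1))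
    have hκ : 0 < κ := div_pos (by linarith) (by linarith)
    have hκα : κ * (2 * (α + 1)) = α - 1 := div_mul_cancel₀ _ (by linarith)
    have hsmall : ∀ᶠ n in atTop, C * (s n / m n) < κ := by
      have := h.small.const_mul C
      rw [mul_zero] at this
      exact this.eventually (gt_mem_nhds hκ)
    have hsmall' : ∀ᶠ n in atTop, s n / m n < κ := h.small.eventually (gt_mem_nhds hκ)
    have hlim : Tendsto (fun n => (s n / m n) ^ 2 * (1 / κ ^ 2)) atTop (𝓝 0) := by
      have := hsq.mul_const (1 / κ ^ 2)
      rwa [zero_mul] at this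
    refine tendsto_of_tendsto_of_tendsto_of_le_of_le' tendsto_const_nhds hlim ?_ ?_
    · filter_upwards [h.mem] with n hn using (hn _).1
    · filter_upwards [h.pos, h.upper, hsmall, hsmall', hC, h.one_le, h.mem]
        with n hm hup hsm hsm' hCn hs hmem
      set τ := ARW.mixingTime (d n) (1 / 2)
      have h1 : α * (τ : ℝ) < ⌊α * (τ : ℝ)⌋₊ + 1 := Nat.lt_floor_add_one _
      have h2 : m n - κ * m n ≤ (τ : ℝ) := by
        have : C * s n ≤ κ * m n := by
          rw [← mul_div_assoc, div_lt_iff₀ hm] at hsm; exact hsm.le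
        linarith [(abs_le.mp hCn).1]
      have h2' : 1 ≤ κ * m n := by
        rw [div_lt_iff₀ hm] at hsm'; linarith
      have h3 : κ * m n ≤ ⌊α * (τ : ℝ)⌋₊ - m n := by
        have h4 : α * (m n - κ * m n) ≤ α * τ := mul_le_mul_of_nonneg_left h2 hα0
        have h5 : (α - 1) * m n = κ * m n * (2 * (α + 1)) := by rw [← hκα]; ring
        nlinarith
      have h4 := hup ⌊α * (τ : ℝ)⌋₊ (by linarith)
      have h5 : (κ * m n) ^ 2 ≤ (⌊α * (τ : ℝ)⌋₊ - m n) ^ 2 :=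
        pow_le_pow_left₀ (by linarith) h3 2
      have h6 : (s n / m n) ^ 2 * (1 / κ ^ 2) = s n ^ 2 / (κ * m n) ^ 2 := by field_simp
      rw [h6, le_div_iff₀ (by positivity)]
      exact (mul_le_mul_of_nonneg_left h5 (hmem _).1).trans h4

/-- Two distances that are asymptotically equivalent, uniformly in time, are concentrated
simultaneously. -/
theorem IsConcentrated.of_le {d' : ℕ → ℕ → ℝ} {ε : ℕ → ℝ} (h : IsConcentrated d m s)
    (hε : Tendsto ε atTop (𝓝 0)) (h0 : ∀ᶠ n in atTop, 0 ≤ ε n)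
    (h1 : ∀ᶠ n in atTop, ∀ t, (1 - ε n) * d n t ≤ d' n t)
    (h2 : ∀ᶠ n in atTop, ∀ t, d' n t ≤ d n t) : IsConcentrated d' m s where
  mem := by
    filter_upwards [h.mem, h1, h2, hε.eventually (gt_mem_nhds one_pos)] with n hn h1 h2 h3 t
    refine ⟨(mul_nonneg (by linarith) (hn t).1).trans (h1 t), (h2 t).trans (hn t).2⟩
  pos := h.pos
  one_le := h.one_le
  small := h.small
  upper := by
    filter_upwards [h.upper, h2] with n hn h2 t ht
    exact (mul_le_mul_of_nonneg_right (h2 t) (sq_nonneg _)).trans (hn t ht)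
  lower := by
    obtain ⟨ε', hε', hlow⟩ := h.lower
    refine ⟨fun n => ε' n + ε n, by simpa using hε'.add hε, ?_⟩
    filter_upwards [hlow, h1, h.mem, h0] with n hn h1 hmem h0 t ht
    refine le_trans (mul_le_mul_of_nonneg_right ?_ (sq_nonneg _)) (hn t ht)
    nlinarith [h1 t, (hmem t).2]

end Cutoff

/-! ### Cutoff at the mean filling time -/

section ChainCutoff

variable {V : ℕ → Type*} [∀ n, Fintype (V n)] [∀ n, DecidableEq (V n)]
  {K : ∀ n, V n → V n → ℝ} {lam : ℕ → ℝ} {ν : ∀ n, V n → ℝ} {ρ a w : ℕ → ℝ}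

/-- Cutoff for a sequence of chains whose aggregation processes have filling times of order `a`,
where the inverses of the hitting probabilities are at most `ρ` and `ρ = o(a)`. The location `m` is
the mean filling time. -/
theorem exists_location (hadm : ∀ᶠ n in atTop, IsAdmissible (K n) (lam n) (ν n))
    (hlam : Tendsto (fun n => lam n / (Fintype.card (V n) : ℝ)) atTop atTop)
    (hρ : ∀ᶠ n in atTop, 0 ≤ ρ n ∧ ∀ x, 1 ≤ ρ n * meanHit (K n) (ν n) x)
    (ha : ∀ᶠ n in atTop, 0 < a n) (hρa : Tendsto (fun n => ρ n / a n) atTop (𝓝 0))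
    (hlow : ∃ c : ℝ, 0 < c ∧ ∀ᶠ n in atTop, ∀ t : ℕ, (t : ℝ) ≤ c * a n →
      1 / 2 ≤ vacantProb (K n) (ν n) t ∅)
    (hup : ∃ C : ℝ, ∀ᶠ n in atTop, ∃ t : ℕ, (t : ℝ) ≤ C * a n ∧
      vacantProb (K n) (ν n) t ∅ ≤ 1 / 2)
    (hw : (fun n => Real.sqrt (ρ n * a n)) =O[atTop] w) :
    HasCommonCutoff (fun n => transitionMatrix (K n) (lam n) (ν n)) w ∧
    ∃ m : ℕ → ℝ,
      (fun n => (mixingTime (tvDistance (transitionMatrix (K n) (lam n) (ν n))) (1 / 2) : ℝ)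
        - m n) =o[atTop] a ∧
      (∀ᶠ n in atTop, ∀ t, ∑ s ∈ Finset.range t, vacantProb (K n) (ν n) s ∅ ≤ m n) ∧
      (∃ c C : ℝ, 0 < c ∧ ∀ᶠ n in atTop, c * a n ≤ m n ∧ m n ≤ C * a n) ∧
      ∀ᶠ n in atTop, ∀ t : ℕ, vacantProb (K n) (ν n) t ∅ ≤ 1 / 2 →
        m n ≤ t + Real.sqrt (2 * (ρ n * m n)) := by
  have hex : ∀ n, ∃ m : ℝ, IsAdmissible (K n) (lam n) (ν n) →
      (0 ≤ ρ n ∧ ∀ x, 1 ≤ ρ n * meanHit (K n) (ν n) x) →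
      (∀ t, ∑ s ∈ Finset.range t, vacantProb (K n) (ν n) s ∅ ≤ m) ∧
      (∀ t : ℕ, m ≤ t → vacantProb (K n) (ν n) t ∅ * (t - m) ^ 2 ≤ ρ n * m) ∧
      (∀ t : ℕ, t ≤ m → (1 - vacantProb (K n) (ν n) t ∅) * (t - m) ^ 2 ≤ ρ n * m) := by
    intro n
    by_cases h : IsAdmissible (K n) (lam n) (ν n) ∧
        (0 ≤ ρ n ∧ ∀ x, 1 ≤ ρ n * meanHit (K n) (ν n) x)
    · obtain ⟨m, hm⟩ := exists_fillTime_concentration h.1.isKilled h.1.law_nonneg h.1.law_sum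
        h.2.1 h.2.2
      exact ⟨m, fun _ _ => hm⟩
    · exact ⟨0, fun h1 h2 => absurd ⟨h1, h2⟩ h⟩
  choose m hm using hex
  have hm' : ∀ᶠ n in atTop,
      (∀ t, ∑ s ∈ Finset.range t, vacantProb (K n) (ν n) s ∅ ≤ m n) ∧
      (∀ t : ℕ, m n ≤ t → vacantProb (K n) (ν n) t ∅ * (t - m n) ^ 2 ≤ ρ n * m n) ∧
      (∀ t : ℕ, t ≤ m n → (1 - vacantProb (K n) (ν n) t ∅) * (t - m n) ^ 2 ≤ ρ n * m n) := by
    filter_upwards [hadm, hρ] with n h1 h2 using hm n h1 h2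
  obtain ⟨c, hc, hlow⟩ := hlow
  obtain ⟨C, hup⟩ := hup
  have hm1 : ∀ᶠ n in atTop, 1 ≤ m n := by
    filter_upwards [hadm, hm'] with n h1 h2
    have hne : (∅ : Finset (V n)) ≠ Finset.univ := by
      intro h
      have := h1.law_sum
      rw [← h] at this
      simp at this
    have := h2.1 1
    simpa [vacantProb, hne] using this
  have hρ1 : ∀ᶠ n in atTop, 1 ≤ ρ n := by
    filter_upwards [hadm, hρ] with n h1 h2
    have hne : (Finset.univ : Finset (V n)).Nonempty := by
      by_contra h
      rw [Finset.not_nonempty_iff_eq_empty] at h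
      have := h1.law_sum
      rw [h] at this
      simp at this
    obtain ⟨x, -⟩ := hne
    have := h1.isKilled.meanHit_le_one h1.law_nonneg h1.law_sum x
    nlinarith [h2.2 x]
  have hmlow : ∀ᶠ n in atTop, c / 2 * a n ≤ m n := by
    filter_upwards [hlow, hm', ha] with n h1 h2 h3
    have hca : 0 < c * a n := by positivity
    have h4 := h2.1 (⌊c * a n⌋₊ + 1)
    have h5 : ∑ s ∈ Finset.range (⌊c * a n⌋₊ + 1), (1 / 2 : ℝ)
        ≤ ∑ s ∈ Finset.range (⌊c * a n⌋₊ + 1), vacantProb (K n) (ν n) s ∅ := by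
      refine Finset.sum_le_sum fun t ht => h1 t ?_
      rw [Finset.mem_range, Nat.lt_succ_iff] at ht
      exact (Nat.cast_le.mpr ht).trans (Nat.floor_le hca.le)
    simp only [Finset.sum_const, Finset.card_range, nsmul_eq_mul] at h5
    push_cast at h5
    have h6 := Nat.lt_floor_add_one (c * a n)
    linarith
  have hsqrt : ∀ᶠ n in atTop, ∀ t : ℕ, vacantProb (K n) (ν n) t ∅ ≤ 1 / 2 →
        m n ≤ t + Real.sqrt (2 * (ρ n * m n)) := by
    filter_upwards [hm'] with n h1 t ht
    rcases le_total (m n) t with h | h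
    · linarith [Real.sqrt_nonneg (2 * (ρ n * m n))]
    · have h2 := h1.2.2 t h
      have h3 : (m n - t) ^ 2 ≤ 2 * (ρ n * m n) := by nlinarith [sq_nonneg (m n - t)]
      have := Real.le_sqrt_of_sq_le h3
      linarith
  have hmup : ∀ᶠ n in atTop, m n ≤ (2 * C + 8) * a n := by
    filter_upwards [hup, hsqrt, hm1, ha, hρ1, hρa.eventually (gt_mem_nhds one_pos)]
      with n ⟨t, ht, hFt⟩ h2 h3 h4 h5 h6
    rw [div_lt_one h4] at h6
    have h7 := h2 t hFt
    have h8 : Real.sqrt (2 * (ρ n * m n)) ≤ 4 * ρ n + m n / 2 := by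
      apply Real.sqrt_le_iff.mpr
      constructor
      · positivity
      · nlinarith [sq_nonneg (4 * ρ n - m n / 2)]
    nlinarith
  -- the window and the separation distance
  set s : ℕ → ℝ := fun n => Real.sqrt (ρ n * m n)
  have hs2 : ∀ᶠ n in atTop, s n ^ 2 = ρ n * m n := by
    filter_upwards [hm1, hρ1] with n h1 h2
    exact Real.sq_sqrt (by positivity)
  have hmpos : ∀ᶠ n in atTop, 0 < m n := by
    filter_upwards [hm1] with n h; linarith
  have hsmall : Tendsto (fun n => s n / m n) atTop (𝓝 0) := by
    have h1 : Tendsto (fun n => Real.sqrt (2 / c * (ρ n / a n))) atTop (𝓝 0) := by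
      have := (hρa.const_mul (2 / c)).sqrt
      simpa using this
    refine squeeze_zero' ?_ ?_ h1
    · filter_upwards [hmpos] with n h; positivity
    · filter_upwards [hmpos, hmlow, ha, hρ1] with n h1 h2 h3 h4
      rw [div_le_iff₀ h1]
      refine (Real.sqrt_le_sqrt (y := 2 / c * (ρ n / a n) * m n ^ 2) ?_).trans ?_
      · have h5 : 1 ≤ 2 / c * (m n / a n) := by
          rw [div_mul_div_comm, le_div_iff₀ (by positivity)]; linarith
        have h6 : 0 ≤ ρ n * m n := by positivity
        calc ρ n * m n = ρ n * m n * 1 := by ring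
          _ ≤ ρ n * m n * (2 / c * (m n / a n)) := mul_le_mul_of_nonneg_left h5 h6
          _ = _ := by ring
      · rw [Real.sqrt_mul' _ (sq_nonneg _), Real.sqrt_sq h1.le]
  have hsep : IsConcentrated (fun n => sepDistance (transitionMatrix (K n) (lam n) (ν n))) m s := by
    refine ⟨?_, hmpos, ?_, hsmall, ?_, fun _ => 0, tendsto_const_nhds, ?_⟩
    · filter_upwards [hadm] with n h t
      rw [h.sepDistance_eq]
      exact ⟨vacantProb_nonneg h.isKilled h.law_nonneg h.law_sum t ∅,
        vacantProb_le_one h.isKilled h.law_nonneg h.law_sum t ∅⟩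
    · filter_upwards [hm1, hρ1] with n h1 h2
      apply Real.le_sqrt_of_sq_le
      nlinarith
    · filter_upwards [hadm, hm', hs2] with n h h1 h2 t ht
      rw [h.sepDistance_eq, h2]
      exact h1.2.1 t ht
    · filter_upwards [hadm, hm', hs2] with n h h1 h2 t ht
      rw [h.sepDistance_eq, h2, sub_zero]
      exact h1.2.2 t ht
  have htv : IsConcentrated (fun n => tvDistance (transitionMatrix (K n) (lam n) (ν n))) m s := by
    refine hsep.of_le (ε := fun n => (Fintype.card (V n) : ℝ) / (1 + lam n)) ?_ ?_ ?_ ?_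
    · refine squeeze_zero' ?_ ?_ hlam.inv_tendsto_atTop
      · filter_upwards [hadm] with n h
        have := h.rate_pos
        positivity
      · filter_upwards [hadm] with n h
        have := h.rate_pos
        simp only [Pi.inv_apply, inv_div]
        exact div_le_div_of_nonneg_left (Nat.cast_nonneg _) this (by linarith)
    · filter_upwards [hadm] with n h
      have := h.rate_pos
      positivity
    · filter_upwards [hadm] with n h t
      rw [h.sepDistance_eq]
      exact h.le_tvDistance t
    · filter_upwards [hadm] with n h t
      rw [h.sepDistance_eq]
      exact h.tvDistance_le t
  have hsa : s =O[atTop] fun n => Real.sqrt (ρ n * a n) := by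
    refine IsBigO.of_bound (Real.sqrt (2 * C + 8)) ?_
    filter_upwards [hmup, ha, hρ1, hmpos] with n h1 h2 h3 h4
    have hC : 0 ≤ 2 * C + 8 := by
      by_contra! h
      nlinarith
    rw [Real.norm_of_nonneg (Real.sqrt_nonneg _), Real.norm_of_nonneg (Real.sqrt_nonneg _),
      ← Real.sqrt_mul hC]
    apply Real.sqrt_le_sqrt
    nlinarith
  have hso : (fun n => Real.sqrt (ρ n * a n)) =o[atTop] a := by
    rw [isLittleO_iff_tendsto' (by filter_upwards [ha] with n h h0; exact absurd h0 h.ne')]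
    have h1 : Tendsto (fun n => Real.sqrt (ρ n / a n)) atTop (𝓝 0) := by
      simpa using hρa.sqrt
    refine h1.congr' ?_
    filter_upwards [ha] with n h
    rw [eq_div_iff h.ne']
    nth_rewrite 2 [← Real.sqrt_sq h.le]
    rw [← Real.sqrt_mul' _ (sq_nonneg _)]
    congr 1
    field_simp
  refine ⟨⟨hsep.hasCutoff, hsep.hasWindow (hsa.trans hw), htv.hasCutoff,
    htv.hasWindow (hsa.trans hw), ?_⟩, m, ?_, ?_, ⟨c / 2, 2 * C + 8, by positivity, ?_⟩, hsqrt⟩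
  · have := (htv.mixingTime_isBigO (δ := 1 / 2) (by norm_num) (by norm_num)).sub
      (hsep.mixingTime_isBigO (δ := 1 / 2) (by norm_num) (by norm_num))
    simp only [sub_sub_sub_cancel_right] at this
    exact this.trans (hsa.trans hw)
  · exact ((htv.mixingTime_isBigO (by norm_num) (by norm_num)).trans hsa).trans_isLittleO hso
  · filter_upwards [hm'] with n h using h.1
  · filter_upwards [hmlow, hmup] with n h1 h2 using ⟨h1, h2⟩

end ChainCutoff

/-! ### Uniform insertion -/

section UniformInsertion

section Bounds

variable {V : Type*} [Fintype V] [DecidableEq V] {K : V → V → ℝ}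

/-- The uniform distribution. -/
def uniformLaw (V : Type*) [Fintype V] : V → ℝ := fun _ => 1 / (Fintype.card V : ℝ)

theorem uniformLaw_nonneg (x : V) : 0 ≤ uniformLaw V x := by
  unfold uniformLaw; positivity

theorem sum_uniformLaw [Nonempty V] : ∑ x, uniformLaw V x = 1 := by
  simp [uniformLaw, Finset.card_univ]

theorem sum_hitProb_eq [Nonempty V] (x : V) :
    ∑ y, hitProb K x y = Fintype.card V * meanHit K (uniformLaw V) x := by
  simp only [meanHit, uniformLaw, ← Finset.mul_sum]
  field_simp

theorem IsKilled.one_le_card_mul_meanHit (hK : IsKilled K) [Nonempty V] (x : V) :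
    1 ≤ (Fintype.card V : ℝ) * meanHit K (uniformLaw V) x := by
  rw [← sum_hitProb_eq, ← hK.hitProb_self x]
  exact Finset.single_le_sum (f := fun y => hitProb K x y) (fun y _ => hK.hitProb_nonneg x y)
    (Finset.mem_univ x)

theorem vacantProb_le_card_mul_exp (hK : IsKilled K) [Nonempty V] {θ ρ : ℝ} (hθ : 0 ≤ θ)
    (hρ0 : 0 < ρ) (hρ : ∀ x, 1 ≤ ρ * meanHit K (uniformLaw V) x) (t : ℕ)
    (ht : θ * Fintype.card V ≤ t * (1 - Real.exp (-θ))) :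
    vacantProb K (uniformLaw V) t ∅ ≤ Fintype.card V
      * Real.exp (-((t * (1 - Real.exp (-θ)) - θ * Fintype.card V) / ρ)) := by
  refine (vacantProb_le_sum_exp hK uniformLaw_nonneg sum_uniformLaw θ hθ t).trans ?_
  have : ∀ x ∈ Finset.univ, Real.exp (θ * ∑ y, hitProb K x y
      - t * (meanHit K (uniformLaw V) x * (1 - Real.exp (-θ))))
      ≤ Real.exp (-((t * (1 - Real.exp (-θ)) - θ * Fintype.card V) / ρ)) := by
    intro x _
    apply Real.exp_le_exp.mpr
    rw [sum_hitProb_eq, le_neg, div_le_iff₀ hρ0]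
    have := mul_le_mul_of_nonneg_left (hρ x) (sub_nonneg.mpr ht)
    linarith
  refine (Finset.sum_le_card_nsmul _ _ _ this).trans ?_
  rw [nsmul_eq_mul, Finset.card_univ]

/-- If the walk visits a bounded number of sites on average, at least half of the sites are hit
with probability of order `1 / |V|`, so that filling takes at least as long as in the coupon
collector's problem. -/
theorem half_le_vacantProb (hK : IsKilled K) (hn : 4 ≤ Fintype.card V) {C : ℝ} (hC0 : 0 < C)
    (hC : ∑ x, meanHit K (uniformLaw V) x ≤ C) (t : ℕ)
    (ht : (t : ℝ) ≤ 1 / (8 * C) * (Fintype.card V * Real.log (Fintype.card V))) :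
    1 / 2 ≤ vacantProb K (uniformLaw V) t ∅ := by
  have : Nonempty V := Fintype.card_pos_iff.mp (by omega)
  set n : ℝ := (Fintype.card V : ℝ)
  have hn4 : (4 : ℝ) ≤ n := by simp only [n]; exact_mod_cast hn
  set B : Finset V := Finset.univ.filter fun x => meanHit K (uniformLaw V) x ≤ 2 * C / n
  have hp := fun x => hK.meanHit_nonneg (ν := uniformLaw V) uniformLaw_nonneg x
  have hBc : (Bᶜ.card : ℝ) ≤ n / 2 := by
    have h1 : Bᶜ.card • (2 * C / n) ≤ ∑ x ∈ Bᶜ, meanHit K (uniformLaw V) x :=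
      Finset.card_nsmul_le_sum _ _ _ fun x hx => by
        simp only [B, Finset.mem_compl, Finset.mem_filter, Finset.mem_univ, true_and,
          not_le] at hx
        exact hx.le
    have h2 : ∑ x ∈ Bᶜ, meanHit K (uniformLaw V) x ≤ C :=
      (Finset.sum_le_sum_of_subset_of_nonneg (Finset.subset_univ _) fun x _ _ => hp x).trans hC
    rw [nsmul_eq_mul] at h1
    have h3 : (Bᶜ.card : ℝ) * (2 * C / n) ≤ C := h1.trans h2
    rw [mul_div_assoc', div_le_iff₀ (by linarith)] at h3
    nlinarith
  have hB : n / 2 ≤ (B.card : ℝ) := by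
    have : (B.card : ℝ) + Bᶜ.card = n := by
      simp only [n]; exact_mod_cast Finset.card_add_card_compl B
    linarith
  set H : ℝ := (harmonic B.card : ℝ)
  have hlogn : 0 < Real.log n := Real.log_pos (by linarith)
  have hH : Real.log n / 2 ≤ H := by
    have h1 : Real.log (B.card + 1) ≤ H := by exact_mod_cast log_add_one_le_harmonic B.card
    refine le_trans ?_ h1
    have h2 : Real.log n ≤ Real.log ((B.card + 1 : ℝ) ^ 2) :=
      Real.log_le_log (by linarith) (by nlinarith)
    rw [Real.log_pow] at h2
    push_cast at h2
    linarith
  have hmain := le_vacantProb_of_meanHit_le hK uniformLaw_nonneg sum_uniformLaw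
    (c := 2 * C / n) (B := B) (by positivity) (fun x hx => (Finset.mem_filter.mp hx).2) t
  have h4 : 2 * C / n * t ≤ Real.log n / 4 := by
    calc 2 * C / n * t ≤ 2 * C / n * (1 / (8 * C) * (n * Real.log n)) :=
          mul_le_mul_of_nonneg_left ht (by positivity)
      _ = Real.log n / 4 := by field_simp; ring
  have hH0 : 0 < H := by linarith
  have h5 : H * (1 / 2) ≤ H * vacantProb K (uniformLaw V) t ∅ := by
    have : H - 2 * C / n * t ≤ H * vacantProb K (uniformLaw V) t ∅ := hmain
    linarith
  exact le_of_mul_le_mul_left h5 hH0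

end Bounds

variable {V : ℕ → Type*} [∀ n, Fintype (V n)] [∀ n, DecidableEq (V n)]
  {K : ∀ n, V n → V n → ℝ} {lam : ℕ → ℝ} {ρ w : ℕ → ℝ}

/-- Cutoff when the walk visits a bounded number of sites on average. -/
theorem cutoff_of_sum_meanHit_le
    (hadm : ∀ᶠ n in atTop, IsAdmissible (K n) (lam n) (uniformLaw (V n)))
    (hlam : Tendsto (fun n => lam n / (Fintype.card (V n) : ℝ)) atTop atTop)
    (hcard : ∀ᶠ n in atTop, Fintype.card (V n) = n)
    (hC : ∃ C : ℝ, ∀ᶠ n in atTop, ∑ x, meanHit (K n) (uniformLaw (V n)) x ≤ C) :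
    HasCommonCutoff (fun n => transitionMatrix (K n) (lam n) (uniformLaw (V n)))
      (fun n => (n : ℝ) * Real.sqrt (Real.log n)) ∧
    (fun n => (mixingTime (tvDistance (transitionMatrix (K n) (lam n) (uniformLaw (V n))))
      (1 / 2) : ℝ)) =Θ[atTop] (fun n : ℕ => (n : ℝ) * Real.log n) := by
  obtain ⟨C, hC⟩ := hC
  have ha : ∀ᶠ n : ℕ in atTop, 0 < (n : ℝ) * Real.log n := by
    filter_upwards [eventually_gt_atTop 1] with n hn
    have : (1 : ℝ) < n := by exact_mod_cast hn
    have := Real.log_pos this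
    positivity
  have hloc := exists_location (ρ := fun n => (n : ℝ)) (a := fun n => (n : ℝ) * Real.log n)
    (w := fun n => (n : ℝ) * Real.sqrt (Real.log n)) hadm hlam ?_ ha ?_ ?_ ?_ ?_
  · obtain ⟨hcut, m, hmix, -, ⟨c, C', hc, hm⟩, -⟩ := hloc
    refine ⟨hcut, ?_⟩
    have hmΘ : m =Θ[atTop] (fun n : ℕ => (n : ℝ) * Real.log n) := by
      constructor
      · refine IsBigO.of_bound C' ?_
        filter_upwards [hm, ha] with n hn ha
        rw [Real.norm_of_nonneg ha.le, Real.norm_of_nonneg (by nlinarith)]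
        exact hn.2
      · refine IsBigO.of_bound (1 / c) ?_
        filter_upwards [hm, ha] with n hn ha
        rw [Real.norm_of_nonneg ha.le, Real.norm_of_nonneg (by nlinarith), one_div_mul_eq_div,
          le_div_iff₀ hc]
        linarith
    have h1 := hmix.trans_isTheta hmΘ.symm
    have h2 : (fun n => (mixingTime (tvDistance (transitionMatrix (K n) (lam n)
        (uniformLaw (V n)))) (1 / 2) : ℝ)) ~[atTop] m := h1
    exact h2.isTheta.trans hmΘ
  · filter_upwards [hadm, hcard, eventually_gt_atTop 0] with n h1 h2 h3
    have : Nonempty (V n) := Fintype.card_pos_iff.mp (by omega)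
    refine ⟨Nat.cast_nonneg n, fun x => ?_⟩
    have := h1.isKilled.one_le_card_mul_meanHit x
    rwa [h2] at this
  · have h1 : Tendsto (fun n : ℕ => (Real.log n)⁻¹) atTop (𝓝 0) :=
      (Real.tendsto_log_atTop.comp tendsto_natCast_atTop_atTop).inv_tendsto_atTop
    refine h1.congr' ?_
    filter_upwards [eventually_gt_atTop 0] with n hn
    have : (n : ℝ) ≠ 0 := by positivity
    field_simp
  · refine ⟨1 / (8 * max C 1), by positivity, ?_⟩
    filter_upwards [hadm, hcard, hC, eventually_ge_atTop 4] with n h1 h2 h3 h4 t ht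
    refine half_le_vacantProb h1.isKilled (by omega) (C := max C 1) (by positivity)
      (h3.trans (le_max_left _ _)) t ?_
    rwa [h2]
  · refine ⟨5, ?_⟩
    filter_upwards [hadm, hcard, eventually_ge_atTop 6] with n h1 h2 h4
    have : Nonempty (V n) := Fintype.card_pos_iff.mp (by omega)
    have hn : (6 : ℝ) ≤ n := by exact_mod_cast h4
    have hlog : 1 ≤ Real.log n := by
      rw [Real.le_log_iff_exp_le (by linarith)]
      linarith [Real.exp_one_lt_d9]
    have hq : (1 : ℝ) / 2 ≤ 1 - Real.exp (-1) := by
      have h5 : Real.exp (-1) ≤ 1 / 2 := by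
        rw [Real.exp_neg, ← one_div]
        exact one_div_le_one_div_of_le (by norm_num) (by linarith [Real.exp_one_gt_d9])
      linarith
    set t := ⌈4 * ((n : ℝ) * Real.log n)⌉₊
    have ht1 : 4 * ((n : ℝ) * Real.log n) ≤ t := Nat.le_ceil _
    have ht2 : (t : ℝ) < 4 * ((n : ℝ) * Real.log n) + 1 := Nat.ceil_lt_add_one (by positivity)
    refine ⟨t, by nlinarith, ?_⟩
    have ht0 : (0 : ℝ) ≤ t := Nat.cast_nonneg t
    have hbound : 2 * (n * Real.log n) - n ≤ t * (1 - Real.exp (-1)) - 1 * (n : ℝ) := by nlinarith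
    have h5 := vacantProb_le_card_mul_exp h1.isKilled (θ := 1) (ρ := n) (by norm_num)
      (by linarith) (fun x => by
        have := h1.isKilled.one_le_card_mul_meanHit x
        rwa [h2] at this) t (by rw [h2]; nlinarith)
    refine h5.trans ?_
    rw [h2]
    have h6 : Real.exp (-((t * (1 - Real.exp (-1)) - 1 * (n : ℝ)) / n))
        ≤ Real.exp (1 - 2 * Real.log n) := by
      apply Real.exp_le_exp.mpr
      rw [neg_le, neg_sub, le_div_iff₀ (by linarith)]
      linarith
    have h7 : Real.exp (1 - 2 * Real.log n) = Real.exp 1 / (n : ℝ) ^ 2 := by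
      rw [Real.exp_sub, ← Real.log_rpow (by linarith), Real.exp_log (by positivity)]
      norm_num
    rw [h7] at h6
    calc (n : ℝ) * _ ≤ n * (Real.exp 1 / (n : ℝ) ^ 2) :=
          mul_le_mul_of_nonneg_left h6 (by linarith)
      _ = Real.exp 1 / n := by field_simp
      _ ≤ 1 / 2 := by
        rw [div_le_div_iff₀ (by linarith) (by norm_num)]
        linarith [Real.exp_one_lt_d9]
  · refine IsBigO.of_bound 1 ?_
    filter_upwards [ha] with n hn
    rw [Real.norm_of_nonneg (Real.sqrt_nonneg _), Real.norm_of_nonneg (by positivity), one_mul,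
      ← mul_assoc, Real.sqrt_mul (by positivity), Real.sqrt_mul_self (Nat.cast_nonneg n)]

theorem one_sub_exp_neg_ge {θ : ℝ} (hθ : 0 ≤ θ) : θ - θ ^ 2 / 2 ≤ 1 - Real.exp (-θ) := by
  have h1 := Real.quadratic_le_exp_of_nonneg hθ
  have h2 : 0 < 1 + θ + θ ^ 2 / 2 := by positivity
  have h3 : Real.exp (-θ) ≤ 1 / (1 + θ + θ ^ 2 / 2) := by
    rw [Real.exp_neg, ← one_div]; exact one_div_le_one_div_of_le h2 h1
  have h4 : 1 / (1 + θ + θ ^ 2 / 2) ≤ 1 - θ + θ ^ 2 / 2 := by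
    rw [div_le_iff₀ h2]; nlinarith [sq_nonneg (θ ^ 2)]
  linarith

/-- Cutoff at time `|V|`, if all sites are hit with a probability of larger order than
`log |V| / |V|`. -/
theorem cutoff_of_meanHit_ge
    (hadm : ∀ᶠ n in atTop, IsAdmissible (K n) (lam n) (uniformLaw (V n)))
    (hlam : Tendsto (fun n => lam n / (Fintype.card (V n) : ℝ)) atTop atTop)
    (hcard : Tendsto (fun n => Fintype.card (V n)) atTop atTop)
    (hρ : ∀ᶠ n in atTop, 0 < ρ n ∧ ∀ x, 1 ≤ ρ n * meanHit (K n) (uniformLaw (V n)) x)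
    (hρV : Tendsto (fun n => ρ n * Real.log (Fintype.card (V n)) / Fintype.card (V n))
      atTop (𝓝 0))
    (hw : (fun n => Real.sqrt (ρ n * Fintype.card (V n))) =O[atTop] w) :
    HasCommonCutoff (fun n => transitionMatrix (K n) (lam n) (uniformLaw (V n))) w ∧
    (fun n => (mixingTime (tvDistance (transitionMatrix (K n) (lam n) (uniformLaw (V n))))
      (1 / 2) : ℝ) - (Fintype.card (V n) : ℝ)) =o[atTop] fun n => (Fintype.card (V n) : ℝ) := by
  set N : ℕ → ℝ := fun n => (Fintype.card (V n) : ℝ)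
  have hN : Tendsto N atTop atTop := tendsto_natCast_atTop_atTop.comp hcard
  have ha : ∀ᶠ n in atTop, 0 < N n := hN.eventually (eventually_gt_atTop 0)
  have hρN : Tendsto (fun n => ρ n / N n) atTop (𝓝 0) := by
    refine squeeze_zero' ?_ ?_ hρV
    · filter_upwards [hρ, ha] with n h1 h2
      exact div_nonneg h1.1.le h2.le
    · filter_upwards [hρ, ha, hN.eventually (eventually_ge_atTop 3)] with n h1 h2 h3
      refine div_le_div_of_nonneg_right ?_ h2.le
      have hlog : 1 ≤ Real.log (N n) := by
        rw [Real.le_log_iff_exp_le h2]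
        linarith [Real.exp_one_lt_d9]
      exact le_mul_of_one_le_right h1.1.le hlog
  have htail : ∀ δ : ℝ, 0 < δ → ∀ᶠ n in atTop, ∃ t : ℕ, (t : ℝ) ≤ (1 + 2 * δ) * N n ∧
      vacantProb (K n) (uniformLaw (V n)) t ∅ ≤ 1 / 2 := by
    intro δ hδ
    -- `θ` is optimal for the quadratic lower bound of `1 - exp (-θ)`, and `κ` is the gain
    set θ : ℝ := δ / (1 + δ)
    have hθ : 0 < θ := by positivity
    set κ : ℝ := δ ^ 2 / (2 * (1 + δ))
    have hκ : 0 < κ := by positivity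
    have hθκ : κ ≤ (1 + δ) * (1 - Real.exp (-θ)) - θ := by
      have h1 := mul_le_mul_of_nonneg_left (one_sub_exp_neg_ge hθ.le) (by linarith : 0 ≤ 1 + δ)
      have h2 : (1 + δ) * (θ - θ ^ 2 / 2) - θ = κ := by
        simp only [θ, κ]; field_simp; ring
      linarith
    have hsmall := hρV.eventually (gt_mem_nhds (show (0 : ℝ) < κ / 2 by positivity))
    filter_upwards [hadm, hρ, ha, hsmall, hN.eventually (eventually_ge_atTop 2),
      hN.eventually (eventually_ge_atTop (1 / δ))] with n h1 h2 h3 h4 h5 h6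
    have : Nonempty (V n) := Fintype.card_pos_iff.mp (Nat.cast_pos.mp h3)
    set t := ⌈(1 + δ) * N n⌉₊
    have ht1 : (1 + δ) * N n ≤ t := Nat.le_ceil _
    have ht2 : (t : ℝ) < (1 + δ) * N n + 1 := Nat.ceil_lt_add_one (by positivity)
    have h7 : 1 ≤ δ * N n := by
      rw [div_le_iff₀ hδ] at h6; linarith
    have hq : 0 ≤ 1 - Real.exp (-θ) := by
      have : Real.exp (-θ) ≤ 1 := Real.exp_le_one_iff.mpr (by linarith)
      linarith
    have h8 : κ * N n ≤ t * (1 - Real.exp (-θ)) - θ * N n := by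
      have := mul_le_mul_of_nonneg_right ht1 hq
      have := mul_le_mul_of_nonneg_right hθκ h3.le
      linarith
    have h9 : 0 ≤ κ * N n := by positivity
    refine ⟨t, by nlinarith, ?_⟩
    refine (vacantProb_le_card_mul_exp h1.isKilled hθ.le h2.1 h2.2 t
      (sub_nonneg.mp (h9.trans h8))).trans ?_
    have h10 : Real.log (2 * N n) ≤ κ * N n / ρ n := by
      rw [div_lt_iff₀ h3] at h4
      rw [le_div_iff₀ h2.1, Real.log_mul (by norm_num) h3.ne']
      have : Real.log 2 ≤ Real.log (N n) := Real.log_le_log (by norm_num) h5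
      nlinarith [h2.1]
    have h11 : κ * N n / ρ n ≤ (t * (1 - Real.exp (-θ)) - θ * N n) / ρ n :=
      div_le_div_of_nonneg_right h8 h2.1.le
    calc N n * Real.exp (-((t * (1 - Real.exp (-θ)) - θ * N n) / ρ n))
        ≤ N n * Real.exp (-Real.log (2 * N n)) := by
          refine mul_le_mul_of_nonneg_left (Real.exp_le_exp.mpr ?_) h3.le
          linarith
      _ = 1 / 2 := by
          rw [Real.exp_neg, Real.exp_log (by positivity)]
          field_simp
  have hone : ∀ᶠ n in atTop, ∀ t : ℕ, (t : ℝ) < N n →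
      vacantProb (K n) (uniformLaw (V n)) t ∅ = 1 := by
    filter_upwards [hadm] with n h t ht
    refine vacantProb_eq_one h.isKilled h.law_nonneg h.law_sum t ∅ ?_
    rw [Finset.card_empty, zero_add]
    exact Nat.cast_lt.mp ht
  obtain ⟨hcut, m, hmix, hsum, ⟨c, C', hc, hm⟩, hsqrt⟩ := exists_location (ρ := ρ) (a := N)
    (w := w) hadm hlam (hρ.mono fun n h => ⟨h.1.le, h.2⟩) ha hρN
    ⟨1 / 2, by norm_num, by
      filter_upwards [hone, ha] with n h1 h2 t ht
      rw [h1 t (by linarith)]; norm_num⟩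
    ⟨_, htail 1 one_pos⟩ hw
  refine ⟨hcut, ?_⟩
  have hmN : (fun n => m n - N n) =o[atTop] N := by
    rw [isLittleO_iff]
    intro ε hε
    have hsmall : ∀ᶠ n in atTop, Real.sqrt (2 * (ρ n * m n)) ≤ ε / 2 * N n := by
      have h1 : ∀ᶠ n in atTop, ρ n / N n < ε ^ 2 / (8 * (|C'| + 1)) :=
        hρN.eventually (gt_mem_nhds (by positivity))
      filter_upwards [h1, ha, hm, hρ] with n h1 h2 h3 h4
      apply Real.sqrt_le_iff.mpr
      refine ⟨by positivity, ?_⟩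
      rw [div_lt_div_iff₀ h2 (by positivity)] at h1
      have h5 : m n ≤ (|C'| + 1) * N n :=
        h3.2.trans (mul_le_mul_of_nonneg_right (by linarith [le_abs_self C']) h2.le)
      have h6 : ρ n * m n ≤ ρ n * ((|C'| + 1) * N n) := mul_le_mul_of_nonneg_left h5 h4.1.le
      nlinarith
    filter_upwards [hsmall, hsqrt, htail (ε / 4) (by positivity), hsum, hone, ha]
      with n h1 h2 ⟨t, ht, hFt⟩ h3 h4 h5
    have h6 := h2 t hFt
    have h7 : N n ≤ m n := by
      have := h3 (Fintype.card (V n))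
      rw [Finset.sum_congr rfl fun t ht => h4 t (Nat.cast_lt.mpr (Finset.mem_range.mp ht))] at this
      simpa using this
    rw [Real.norm_of_nonneg (by linarith), Real.norm_of_nonneg h5.le]
    nlinarith
  have := hmix.add hmN
  simpa using this

end UniformInsertion

/-! ### Random walk killed outside a set of vertices -/

section KilledGraphWalk

variable {W : Type*} [DecidableEq W] {G : SimpleGraph W} {S : Finset W}

/-- `nb` lists the neighbours of each vertex of `G`. -/
def IsNeighborList (G : SimpleGraph W) (nb : W → Finset W) : Prop :=
  ∀ x y, y ∈ nb x ↔ G.Adj x y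

theorem IsNeighborList.ncard {nb : W → Finset W} (h : IsNeighborList G nb) (x : W) :
    (G.neighborSet x).ncard = (nb x).card := by
  rw [← Set.ncard_coe_finset]
  congr 1
  ext y
  simp [h x y]

theorem exists_isNeighborList (h : ∀ x, (G.neighborSet x).Finite) :
    ∃ nb : W → Finset W, IsNeighborList G nb :=
  ⟨fun x => (h x).toFinset, fun x y => by simp⟩

theorem graphChain_eq (lam : ℝ) :
    graphChain G S lam = transitionMatrix (walkKernel G S) lam (uniformLaw S) := by
  unfold graphChain uniformLaw
  rw [Fintype.card_coe]

theorem sum_walkKernel_mul {nb : W → Finset W} (h : IsNeighborList G nb) {g : W → ℝ}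
    (hg : ∀ y ∉ S, g y = 0) (x : S) :
    ∑ y, walkKernel G S x y * g y = (∑ y ∈ nb x, g y) / (nb x).card := by
  have h1 : ∑ y : S, walkKernel G S x y * g y
      = ∑ y ∈ S, if y ∈ nb x then g y / (nb x).card else 0 := by
    rw [← Finset.sum_coe_sort S]
    refine Finset.sum_congr rfl fun y _ => ?_
    simp only [walkKernel, h.ncard]
    by_cases hxy : G.Adj x y
    · rw [if_pos hxy, if_pos ((h x y).mpr hxy)]; ring
    · rw [if_neg hxy, if_neg fun h' => hxy ((h x y).mp h'), zero_mul]
  rw [h1, Finset.sum_ite, Finset.sum_const_zero, add_zero, Finset.sum_div]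
  refine Finset.sum_subset (fun y hy => (Finset.mem_filter.mp hy).2) fun y hy hy' => ?_
  rw [hg y fun hS => hy' (Finset.mem_filter.mpr ⟨hS, hy⟩), zero_div]

theorem sum_walkKernel_subset {nb : W → Finset W} (h : IsNeighborList G nb) (T : Finset S)
    (x : S) : ∑ y ∈ T, walkKernel G S x y
      = ((nb x).filter fun y => y ∈ T.map (Function.Embedding.subtype _)).card / (nb x).card := by
  have h1 := sum_walkKernel_mul (S := S) h
    (g := fun y => if y ∈ T.map (Function.Embedding.subtype _) then 1 else 0) (fun y hy => by
      rw [if_neg]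
      simp only [Finset.mem_map, Function.Embedding.subtype_apply, Subtype.exists,
        exists_and_right, exists_eq_right, not_exists]
      exact fun h => absurd h hy) x
  have h2 : ∀ y : S, ((y : W) ∈ T.map (Function.Embedding.subtype _)) ↔ y ∈ T := fun y => by
    simp
  simp only [h2, mul_ite, mul_one, mul_zero, Finset.sum_ite_mem, Finset.univ_inter] at h1
  rw [h1, Finset.filter_mem_eq_inter, Finset.sum_const, nsmul_eq_mul, mul_one]

/-- The walk leaks at `x` if some neighbour of `x` is not in the set. -/
theorem sum_walkKernel_subset_le {nb : W → Finset W} (h : IsNeighborList G nb) (T : Finset S)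
    {x : S} {y : W} (hxy : G.Adj x y) (hy : y ∉ T.map (Function.Embedding.subtype _)) :
    ∑ y ∈ T, walkKernel G S x y ≤ 1 - 1 / ((nb x).card : ℝ) := by
  have hmem : y ∈ nb x := (h x y).mpr hxy
  have hpos : 0 < (nb x).card := Finset.card_pos.mpr ⟨y, hmem⟩
  have h1 : ((nb x).filter fun y => y ∈ T.map (Function.Embedding.subtype _)).card + 1
      ≤ (nb x).card := by
    rw [Nat.succ_le_iff]
    exact Finset.card_lt_card (Finset.filter_ssubset.mpr ⟨y, hmem, hy⟩)
  have h2 : (((nb x).filter fun y => y ∈ T.map (Function.Embedding.subtype _)).card : ℝ) + 1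
      ≤ (nb x).card := by exact_mod_cast h1
  have h3 : (0 : ℝ) < (nb x).card := by exact_mod_cast hpos
  rw [sum_walkKernel_subset h, div_le_iff₀ h3, sub_mul, one_div_mul_cancel h3.ne']
  linarith

theorem isAdmissible_walkKernel {nb : W → Finset W} (h : IsNeighborList G nb)
    (hS : S.Nonempty) {lam : ℝ} (hlam : 0 < lam)
    (hbd : ∀ T : Finset W, T ⊆ S → T.Nonempty → ∃ x ∈ T, ∃ y ∉ T, G.Adj x y) :
    IsAdmissible (walkKernel G S) lam (uniformLaw S) := by
  have : Nonempty S := hS.to_subtype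
  refine ⟨fun x y => ?_, fun x => ?_, fun T hT => ?_, hlam, uniformLaw_nonneg, sum_uniformLaw,
    fun x => ⟨x, ?_, Relation.ReflTransGen.refl⟩⟩
  · unfold walkKernel; split_ifs <;> positivity
  · rw [sum_walkKernel_subset h]
    refine div_le_one_of_le₀ ?_ (Nat.cast_nonneg _)
    exact_mod_cast Finset.card_filter_le _ _
  · obtain ⟨x, hx, y, hy, hxy⟩ := hbd (T.map (Function.Embedding.subtype _))
      (fun y hy => by
        obtain ⟨y, -, rfl⟩ := Finset.mem_map.mp hy
        exact y.2) (hT.map)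
    obtain ⟨x, hxT, rfl⟩ := Finset.mem_map.mp hx
    refine ⟨x, hxT, ne_of_lt ?_⟩
    have hpos : 0 < (nb x).card := Finset.card_pos.mpr ⟨y, (h _ _).mpr hxy⟩
    have h1 := sum_walkKernel_subset_le h T hxy hy
    have h2 : (0 : ℝ) < 1 / (nb x).card := by positivity
    linarith
  · simp only [uniformLaw]
    have : 0 < Fintype.card S := Fintype.card_pos
    positivity

theorem IsKilled.sum_meanHit_le {V : Type*} [Fintype V] [DecidableEq V] {K : V → V → ℝ}
    {ν : V → ℝ} (hK : IsKilled K) (hν : ∀ x, 0 ≤ ν x) {u : V → ℝ}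
    (hu : ∀ y, 1 + ∑ w, K y w * u w ≤ u y) : ∑ x, meanHit K ν x ≤ ∑ y, ν y * u y := by
  simp only [meanHit]
  rw [Finset.sum_comm]
  simp only [← Finset.mul_sum]
  exact Finset.sum_le_sum fun y _ => mul_le_mul_of_nonneg_left (hK.sum_hitProb_le hu y) (hν y)

end KilledGraphWalk

/-! ### Wheel-like graphs -/

section Wheel

/-- In a wheel-like graph the walk is killed with probability at least `1 / d` in each step. -/
theorem sum_meanHit_le_of_wheel {W : Type*} [Fintype W] [DecidableEq W] {G : SimpleGraph W}
    {z : W} {lam : ℝ} {d : ℕ} (hadj : ∀ x, x ≠ z → G.Adj x z)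
    (hdeg : ∀ x, x ≠ z → (G.neighborSet x).ncard ≤ d)
    (h : IsAdmissible (walkKernel G (Finset.univ.erase z)) lam
      (uniformLaw (Finset.univ.erase z : Finset W))) :
    ∑ x, meanHit (walkKernel G (Finset.univ.erase z))
      (uniformLaw (Finset.univ.erase z : Finset W)) x ≤ d := by
  obtain ⟨nb, hnb⟩ := exists_isNeighborList (G := G) fun x => Set.toFinite _
  refine (h.isKilled.sum_meanHit_le h.law_nonneg (u := fun _ => (d : ℝ)) fun y => ?_).trans ?_
  · have hy : (y : W) ≠ z := Finset.ne_of_mem_erase y.2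
    have h1 := sum_walkKernel_subset_le (S := Finset.univ.erase z) hnb Finset.univ (hadj y hy)
      (by simp)
    have hpos : (0 : ℝ) < (nb y).card := by
      exact_mod_cast Finset.card_pos.mpr ⟨z, (hnb _ _).mpr (hadj y hy)⟩
    have h2 : ((nb y).card : ℝ) ≤ d := by
      have := hdeg y hy
      rw [hnb.ncard] at this
      exact_mod_cast this
    have h3 : 1 ≤ (d : ℝ) * (1 / (nb y).card) := by
      rw [mul_one_div, le_div_iff₀ hpos]; linarith
    rw [← Finset.sum_mul]
    nlinarith
  · rw [← Finset.sum_mul, h.law_sum, one_mul]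

end Wheel

/-! ### Non-amenable graphs -/

section NonAmenable

variable {W : Type*} [DecidableEq W] {G : SimpleGraph W} {nb : W → Finset W} {κ : ℝ}

/-- The isoperimetric inequality for functions (co-area formula), by induction on the number of
values of `f`. -/
theorem isoperimetric_sum_le (hnb : IsNeighborList G nb)
    (hκ : ∀ T : Finset W, T.Nonempty → κ * T.card ≤ (outerBoundary G T).ncard)
    (T : Finset W) (f : W → ℝ) (hf : ∀ x, 0 ≤ f x) (hfT : ∀ x ∉ T, f x = 0) :
    κ * ∑ x ∈ T, f x ≤ ∑ x ∈ T, ∑ y ∈ nb x, max (f x - f y) 0 := by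
  induction hn : T.card using Nat.strong_induction_on generalizing T f with
  | _ n ih =>
    rcases T.eq_empty_or_nonempty with rfl | hT
    · simp
    obtain ⟨x₀, hx₀, hmin⟩ := Finset.exists_min_image T f hT
    set m := f x₀
    have hm0 : 0 ≤ m := hf x₀
    set f' : W → ℝ := fun x => if x ∈ T then f x - m else 0
    set T' := T.filter fun x => m < f x
    have hT' : T' ⊂ T := Finset.filter_ssubset.mpr ⟨x₀, hx₀, lt_irrefl _⟩
    have hf'0 : ∀ x, 0 ≤ f' x := fun x => by
      simp only [f']; split_ifs with h
      · linarith [hmin x h]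
      · exact le_rfl
    have hf'T : ∀ x ∉ T', f' x = 0 := by
      intro x hx
      simp only [f']
      split_ifs with h
      · have : ¬ m < f x := fun h' => hx (Finset.mem_filter.mpr ⟨h, h'⟩)
        linarith [hmin x h]
      · rfl
    have hih := ih _ (hn ▸ Finset.card_lt_card hT') T' f' hf'0 hf'T rfl
    have hsum1 : ∑ x ∈ T', f' x = ∑ x ∈ T, f' x :=
      Finset.sum_subset hT'.1 fun x _ hx => hf'T x hx
    have hsum2 : ∑ x ∈ T', ∑ y ∈ nb x, max (f' x - f' y) 0
        = ∑ x ∈ T, ∑ y ∈ nb x, max (f' x - f' y) 0 :=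
      Finset.sum_subset hT'.1 fun x _ hx => Finset.sum_eq_zero fun y _ => by
        rw [hf'T x hx]; exact max_eq_right (by linarith [hf'0 y])
    have hsum3 : ∑ x ∈ T, f x = m * T.card + ∑ x ∈ T, f' x := by
      have : ∀ x ∈ T, f' x = f x - m := fun x hx => by simp [f', hx]
      rw [Finset.sum_congr rfl this, Finset.sum_sub_distrib, Finset.sum_const, nsmul_eq_mul]
      ring
    have hsum4 : ∑ x ∈ T, ∑ y ∈ nb x, max (f x - f y) 0
        = m * (∑ x ∈ T, ((nb x).filter fun y => y ∉ T).card : ℕ)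
          + ∑ x ∈ T, ∑ y ∈ nb x, max (f' x - f' y) 0 := by
      push_cast
      rw [Finset.mul_sum, ← Finset.sum_add_distrib]
      refine Finset.sum_congr rfl fun x hx => ?_
      have : m * (((nb x).filter fun y => y ∉ T).card : ℝ)
          = ∑ y ∈ nb x, if y ∉ T then m else 0 := by
        rw [← Finset.sum_filter, Finset.sum_const, nsmul_eq_mul, mul_comm]
      rw [this, ← Finset.sum_add_distrib]
      refine Finset.sum_congr rfl fun y _ => ?_
      by_cases hy : y ∈ T
      · simp [f', hx, hy]
      · have h1 := hmin x hx
        simp only [f', hx, hy, if_true, if_false, not_false_eq_true, hfT y hy, sub_zero]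
        rw [max_eq_left (hf x), max_eq_left (by linarith)]
        ring
    have hbd : (outerBoundary G T).ncard ≤ ∑ x ∈ T, ((nb x).filter fun y => y ∉ T).card := by
      refine le_trans ?_ (Finset.card_biUnion_le (s := T) (t := fun x => (nb x).filter (· ∉ T)))
      rw [← Set.ncard_coe_finset]
      refine Set.ncard_le_ncard (fun y hy => ?_) (Finset.finite_toSet _)
      obtain ⟨hy, x, hx, hxy⟩ := hy
      simp only [Finset.coe_biUnion, Set.mem_iUnion, Finset.mem_coe, Finset.mem_filter]
      exact ⟨x, hx, (hnb x y).mpr hxy, hy⟩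
    have hbd' : κ * T.card ≤ ((∑ x ∈ T, ((nb x).filter fun y => y ∉ T).card : ℕ) : ℝ) :=
      (hκ T hT).trans (by exact_mod_cast hbd)
    rw [hsum1, hsum2] at hih
    rw [hsum3, hsum4]
    have := mul_le_mul_of_nonneg_left hbd' hm0
    linarith

/-- In a non-amenable graph, the walk killed outside a finite set has a bounded mean lifetime when
it starts from the uniform distribution: Cheeger's inequality bounds the Dirichlet form of the mean
lifetime from below by its squared norm. -/
theorem sum_lifetime_le (hnb : IsNeighborList G nb) (hκ0 : 0 < κ)
    (hκ : ∀ T : Finset W, T.Nonempty → κ * T.card ≤ (outerBoundary G T).ncard)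
    {D : ℝ} (hD0 : 0 < D) (hD : ∀ x, ((nb x).card : ℝ) ≤ D) (S : Finset W) (u : W → ℝ)
    (hu0 : ∀ x, 0 ≤ u x) (huS : ∀ x ∉ S, u x = 0)
    (hu : ∀ x ∈ S, ∑ y ∈ nb x, (u x - u y) = (nb x).card) :
    ∑ x ∈ S, u x ≤ 8 * D ^ 2 / κ ^ 2 * S.card := by
  set A := ∑ x ∈ S, u x
  set B := ∑ x ∈ S, u x ^ 2
  have hA0 : 0 ≤ A := Finset.sum_nonneg fun x _ => hu0 x
  -- sums over pairs of neighbours are symmetric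
  have hswap : ∀ g : W → ℝ, (∀ x ∉ S, g x = 0) →
      ∑ x ∈ S, ∑ y ∈ nb x, g y = ∑ x ∈ S, ((nb x).filter fun y => y ∈ S).card * g x := by
    intro g hg
    have h1 : ∀ x ∈ S, ∑ y ∈ nb x, g y = ∑ y ∈ S, if y ∈ nb x then g y else 0 := by
      intro x _
      rw [← Finset.sum_filter]
      symm
      refine Finset.sum_subset_zero_on_sdiff (fun y hy => ?_) (fun y hy => ?_) fun _ _ => rfl
      · exact (Finset.mem_filter.mp hy).2
      · simp only [Finset.mem_sdiff, Finset.mem_filter, not_and] at hy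
        exact hg y fun hyS => hy.2 hyS hy.1
    rw [Finset.sum_congr rfl h1, Finset.sum_comm]
    refine Finset.sum_congr rfl fun y _ => ?_
    rw [← Finset.sum_filter, Finset.sum_const, nsmul_eq_mul]
    congr 3
    ext x
    simp only [Finset.mem_filter, hnb y x, hnb x y, G.adj_comm y x, and_comm]
  have hcard : ∀ x, (((nb x).filter fun y => y ∈ S).card : ℝ) ≤ (nb x).card := fun x => by
    exact_mod_cast Finset.card_filter_le _ _
  have hE1 : ∑ x ∈ S, ∑ y ∈ nb x, (u x - u y) ^ 2 ≤ 2 * D * A := by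
    have h1 : ∀ x ∈ S, ∑ y ∈ nb x, (u x - u y) ^ 2
        = 2 * ((nb x).card * u x) + ∑ y ∈ nb x, u y ^ 2 - (nb x).card * u x ^ 2 := by
      intro x hx
      have h2 : ∀ y, (u x - u y) ^ 2 = 2 * u x * (u x - u y) + u y ^ 2 - u x ^ 2 := fun y => by
        ring
      simp only [h2, Finset.sum_sub_distrib, Finset.sum_add_distrib, Finset.sum_const,
        nsmul_eq_mul, ← Finset.mul_sum]
      have := hu x hx
      simp only [Finset.sum_sub_distrib, Finset.sum_const, nsmul_eq_mul] at this
      rw [this]; ring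
    rw [Finset.sum_congr rfl h1, Finset.sum_sub_distrib, Finset.sum_add_distrib,
      hswap (fun y => u y ^ 2) fun x hx => by rw [huS x hx]; norm_num]
    have h3 : ∑ x ∈ S, (((nb x).filter fun y => y ∈ S).card : ℝ) * u x ^ 2
        ≤ ∑ x ∈ S, ((nb x).card : ℝ) * u x ^ 2 :=
      Finset.sum_le_sum fun x _ => mul_le_mul_of_nonneg_right (hcard x) (sq_nonneg _)
    have h4 : ∑ x ∈ S, 2 * (((nb x).card : ℝ) * u x) ≤ 2 * D * A := by
      simp only [A, Finset.mul_sum]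
      refine Finset.sum_le_sum fun x _ => ?_
      have := mul_le_mul_of_nonneg_right (hD x) (hu0 x)
      linarith
    linarith
  have hE2 : ∑ x ∈ S, ∑ y ∈ nb x, (u x + u y) ^ 2 ≤ 4 * D * B := by
    have h1 : ∀ x ∈ S, ∑ y ∈ nb x, (u x + u y) ^ 2
        ≤ 2 * ((nb x).card * u x ^ 2) + 2 * ∑ y ∈ nb x, u y ^ 2 := by
      intro x _
      have h2 : ∀ y ∈ nb x, (u x + u y) ^ 2 ≤ 2 * u x ^ 2 + 2 * u y ^ 2 := fun y _ => by
        nlinarith [sq_nonneg (u x - u y)]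
      refine (Finset.sum_le_sum h2).trans (le_of_eq ?_)
      simp only [Finset.sum_add_distrib, Finset.sum_const, nsmul_eq_mul, ← Finset.mul_sum]
      ring
    refine (Finset.sum_le_sum h1).trans ?_
    rw [Finset.sum_add_distrib, ← Finset.mul_sum, ← Finset.mul_sum,
      hswap (fun y => u y ^ 2) fun x hx => by rw [huS x hx]; norm_num]
    have h3 : ∀ c : W → ℝ, (∀ x, c x ≤ D) → ∑ x ∈ S, c x * u x ^ 2 ≤ D * B := by
      intro c hc
      simp only [B, Finset.mul_sum]
      exact Finset.sum_le_sum fun x _ => mul_le_mul_of_nonneg_right (hc x) (sq_nonneg _)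
    have h4 := h3 _ hD
    have h5 := h3 _ fun x => (hcard x).trans (hD x)
    linarith
  have hiso := isoperimetric_sum_le hnb hκ S (fun x => u x ^ 2) (fun x => sq_nonneg _)
    fun x hx => by rw [huS x hx]; norm_num
  -- the weights are such that `hE2` lets half of the left side of `hiso` absorb the second sum
  have hcs : ∑ x ∈ S, ∑ y ∈ nb x, max (u x ^ 2 - u y ^ 2) 0
      ≤ 2 * D / κ * (∑ x ∈ S, ∑ y ∈ nb x, (u x - u y) ^ 2)
        + κ / (8 * D) * ∑ x ∈ S, ∑ y ∈ nb x, (u x + u y) ^ 2 := by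
    simp only [Finset.mul_sum, ← Finset.sum_add_distrib]
    refine Finset.sum_le_sum fun x _ => Finset.sum_le_sum fun y _ => max_le ?_ (by positivity)
    have h1 : 0 ≤ 2 * D / κ * ((u x - u y) - κ / (4 * D) * (u x + u y)) ^ 2 := by positivity
    have h2 : 2 * D / κ * ((u x - u y) - κ / (4 * D) * (u x + u y)) ^ 2
        = 2 * D / κ * (u x - u y) ^ 2 - (u x ^ 2 - u y ^ 2)
          + κ / (8 * D) * (u x + u y) ^ 2 := by
      field_simp; ring
    linarith
  have h1 : κ / (8 * D) * ∑ x ∈ S, ∑ y ∈ nb x, (u x + u y) ^ 2 ≤ κ / 2 * B := by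
    calc _ ≤ κ / (8 * D) * (4 * D * B) := mul_le_mul_of_nonneg_left hE2 (by positivity)
      _ = κ / 2 * B := by field_simp; ring
  have h2 : 2 * D / κ * (∑ x ∈ S, ∑ y ∈ nb x, (u x - u y) ^ 2) ≤ 4 * D ^ 2 / κ * A := by
    calc _ ≤ 2 * D / κ * (2 * D * A) := mul_le_mul_of_nonneg_left hE1 (by positivity)
      _ = 4 * D ^ 2 / κ * A := by ring
  have h3 : B ≤ 8 * D ^ 2 / κ ^ 2 * A := by
    have h4 : κ / 2 * B ≤ 4 * D ^ 2 / κ * A := by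
      have : κ * B ≤ _ := hiso
      linarith
    calc B = 2 / κ * (κ / 2 * B) := by field_simp
      _ ≤ 2 / κ * (4 * D ^ 2 / κ * A) := mul_le_mul_of_nonneg_left h4 (by positivity)
      _ = _ := by field_simp; ring
  have h4 : A ^ 2 ≤ S.card * B := sq_sum_le_card_mul_sum_sq
  rcases hA0.eq_or_lt with h0 | h0
  · rw [← h0]; positivity
  · have h5 : A * A ≤ (8 * D ^ 2 / κ ^ 2 * S.card) * A := by
      have := mul_le_mul_of_nonneg_left h3 (Nat.cast_nonneg (α := ℝ) S.card)
      nlinarith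
    exact le_of_mul_le_mul_right h5 h0

/-- Extension by `0` of a function on `S`. -/
def extendZero {S : Finset W} (u : S → ℝ) : W → ℝ :=
  fun w => if h : w ∈ S then u ⟨w, h⟩ else 0

theorem extendZero_coe {S : Finset W} (u : S → ℝ) (x : S) : extendZero u x = u x := by
  simp [extendZero]

theorem extendZero_of_not_mem {S : Finset W} (u : S → ℝ) {x : W} (h : x ∉ S) :
    extendZero u x = 0 := by simp [extendZero, h]

/-- Mean lifetime of the walk. -/
def lifetime {V : Type*} [Fintype V] [DecidableEq V] (K : V → V → ℝ) : V → ℝ :=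
  dirichlet K Finset.univ fun _ => 1

theorem IsKilled.lifetime_eq {V : Type*} [Fintype V] [DecidableEq V] {K : V → V → ℝ}
    (hK : IsKilled K) (y : V) : lifetime K y = 1 + ∑ w, K y w * lifetime K w := by
  rw [lifetime, hK.dirichlet_eq]; simp [add_comm]

theorem IsKilled.lifetime_nonneg {V : Type*} [Fintype V] [DecidableEq V] {K : V → V → ℝ}
    (hK : IsKilled K) (y : V) : 0 ≤ lifetime K y :=
  hK.dirichlet_nonneg (fun _ => zero_le_one) y

theorem sum_meanHit_le_of_isoperimetric (hnb : IsNeighborList G nb) (hκ0 : 0 < κ)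
    (hκ : ∀ T : Finset W, T.Nonempty → κ * T.card ≤ (outerBoundary G T).ncard)
    {D : ℝ} (hD0 : 0 < D) (hD : ∀ x, ((nb x).card : ℝ) ≤ D) {S : Finset W} (hS : S.Nonempty)
    {lam : ℝ} (h : IsAdmissible (walkKernel G S) lam (uniformLaw S)) :
    ∑ x, meanHit (walkKernel G S) (uniformLaw S) x ≤ 8 * D ^ 2 / κ ^ 2 := by
  have hK := h.isKilled
  refine (hK.sum_meanHit_le h.law_nonneg (u := lifetime (walkKernel G S))
    fun y => (hK.lifetime_eq y).ge).trans ?_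
  set u := extendZero (lifetime (walkKernel G S))
  have hu := sum_lifetime_le hnb hκ0 hκ hD0 hD S u (fun x => by
      by_cases hx : x ∈ S
      · have := hK.lifetime_nonneg ⟨x, hx⟩
        rwa [← extendZero_coe (lifetime (walkKernel G S)) ⟨x, hx⟩] at this
      · exact (extendZero_of_not_mem _ hx).ge)
    (fun x hx => extendZero_of_not_mem _ hx) (fun x hx => by
      have h1 := hK.lifetime_eq ⟨x, hx⟩
      have h2 := sum_walkKernel_mul (S := S) hnb (g := u)
        (fun x hx => extendZero_of_not_mem _ hx) ⟨x, hx⟩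
      simp only [u, extendZero_coe] at h2
      rw [h2, ← extendZero_coe (lifetime (walkKernel G S)) ⟨x, hx⟩] at h1
      have hT : 0 < (outerBoundary G {x}).ncard := by
        have := hκ {x} (Finset.singleton_nonempty x)
        rw [Finset.card_singleton, Nat.cast_one, mul_one] at this
        exact_mod_cast hκ0.trans_le this
      obtain ⟨y, hy⟩ := Set.nonempty_of_ncard_ne_zero hT.ne'
      obtain ⟨-, x', hx', hxy⟩ := hy
      rw [Finset.mem_singleton] at hx'
      subst hx'
      have hpos : (0 : ℝ) < (nb x').card := by
        exact_mod_cast Finset.card_pos.mpr ⟨y, (hnb _ _).mpr hxy⟩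
      simp only [Finset.sum_sub_distrib, Finset.sum_const, nsmul_eq_mul, u]
      rw [h1]
      field_simp
      ring)
  have h1 : ∑ y, uniformLaw S y * lifetime (walkKernel G S) y = (∑ x ∈ S, u x) / S.card := by
    rw [← Finset.sum_coe_sort S, Finset.sum_div]
    refine Finset.sum_congr rfl fun y _ => ?_
    simp only [u, extendZero_coe, uniformLaw, Fintype.card_coe]
    ring
  rw [h1, div_le_iff₀ (by exact_mod_cast hS.card_pos)]
  exact hu

end NonAmenable

/-! ### Transitive graphs -/

section Transitive

variable {W : Type*} [Fintype W] [DecidableEq W] {G : SimpleGraph W} {nb : W → Finset W}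

/-- The Laplacian of a graph, without normalization. -/
def laplacian (nb : W → Finset W) (f : W → ℝ) (x : W) : ℝ := ∑ y ∈ nb x, (f x - f y)

theorem sum_mul_laplacian_comm (hnb : IsNeighborList G nb) (f g : W → ℝ) :
    ∑ x, f x * laplacian nb g x = ∑ x, g x * laplacian nb f x := by
  have key : ∀ f g : W → ℝ, ∑ x, f x * laplacian nb g x
      = ∑ x, ((nb x).card * (f x * g x)) - ∑ x, ∑ y, if y ∈ nb x then f x * g y else 0 := by
    intro f g
    rw [← Finset.sum_sub_distrib]
    refine Finset.sum_congr rfl fun x _ => ?_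
    rw [← Finset.sum_filter, Finset.filter_mem_eq_inter, Finset.univ_inter, laplacian,
      Finset.sum_sub_distrib, Finset.sum_const, nsmul_eq_mul, mul_sub, Finset.mul_sum]
    ring
  rw [key, key]
  congr 1
  · exact Finset.sum_congr rfl fun x _ => by ring
  · rw [Finset.sum_comm]
    refine Finset.sum_congr rfl fun x _ => Finset.sum_congr rfl fun y _ => ?_
    exact if_congr (by rw [hnb, hnb, G.adj_comm]) (mul_comm _ _) rfl

theorem sum_laplacian (hnb : IsNeighborList G nb) (f : W → ℝ) : ∑ x, laplacian nb f x = 0 := by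
  have := sum_mul_laplacian_comm hnb (fun _ => 1) f
  simpa [laplacian] using this

theorem laplacian_comp (hnb : IsNeighborList G nb) (φ : G ≃g G) (f : W → ℝ) (x : W) :
    laplacian nb (fun y => f (φ y)) x = laplacian nb f (φ x) := by
  rw [laplacian, laplacian]
  refine Finset.sum_bij (fun y _ => φ y) (fun y hy => ?_) (fun y _ y' _ h => φ.injective h)
    (fun y hy => ⟨φ.symm y, ?_, by simp⟩) fun y _ => rfl
  · rw [hnb] at hy ⊢; exact φ.map_adj_iff.mpr hy
  · rw [hnb] at hy ⊢
    rw [← φ.map_adj_iff]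
    simpa using hy

/-- On a finite transitive graph, the probability that the walk visits `x` before `z` has mean
`1 / 2` with respect to the uniform distribution. This follows by pairing it with the mean
hitting times of `x` and `z`; these satisfy `E_x H_z = E_z H_x`. -/
theorem sum_eq_half_card_of_transitive (hnb : IsNeighborList G nb) {r : ℝ} {x z : W}
    (φ : G ≃g G) (hφ : φ x = z) (hxz : x ≠ z) {f u : W → ℝ}
    (hfx : f x = 1) (hfz : f z = 0) (hf : ∀ y, y ≠ x → y ≠ z → laplacian nb f y = 0)
    (hr : r ≠ 0) (huz : u z = 0) (hu : ∀ y, y ≠ z → laplacian nb u y = r) :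
    ∑ y, f y = Fintype.card W / 2 := by
  set N : ℝ := (Fintype.card W : ℝ)
  -- pairing with the mean hitting time of a vertex
  have hpair : ∀ (g v : W → ℝ) (w : W), (∀ y, y ≠ w → laplacian nb v y = r) →
      ∑ y, g y * laplacian nb v y = r * (∑ y, g y) - r * N * g w := by
    intro g v w hv
    have h0 := sum_laplacian hnb v
    rw [← Finset.add_sum_erase _ _ (Finset.mem_univ w),
      Finset.sum_congr rfl fun y hy => hv y (Finset.ne_of_mem_erase hy), Finset.sum_const,
      nsmul_eq_mul, Finset.card_erase_of_mem (Finset.mem_univ w), Finset.card_univ,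
      Nat.cast_pred (Fintype.card_pos_iff.mpr ⟨w⟩)] at h0
    rw [← Finset.add_sum_erase _ _ (Finset.mem_univ w),
      Finset.sum_congr rfl fun y hy => by rw [hv y (Finset.ne_of_mem_erase hy)],
      ← Finset.sum_mul, ← Finset.add_sum_erase _ g (Finset.mem_univ w)]
    have h1 : laplacian nb v w = -((N - 1) * r) := by linarith
    rw [h1]; ring
  set v : W → ℝ := fun y => u (φ y)
  have hv : ∀ y, y ≠ x → laplacian nb v y = r := by
    intro y hy
    rw [laplacian_comp hnb φ u y]
    refine hu _ fun h => hy ?_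
    rw [← hφ] at h
    exact φ.injective h
  have hsum : ∑ y, v y = ∑ y, u y := Equiv.sum_comp φ.toEquiv u
  have hvx : v x = 0 := by simp only [v, hφ, huz]
  have hsymm : v z = u x := by
    have h1 := hpair u v x hv
    have h2 := hpair v u z hu
    rw [sum_mul_laplacian_comm hnb, h2, hsum] at h1
    have hN : r * N ≠ 0 := mul_ne_zero hr (by
      have : 0 < Fintype.card W := Fintype.card_pos_iff.mpr ⟨x⟩
      positivity)
    have : r * N * v z = r * N * u x := by linarith
    exact mul_left_cancel₀ hN this
  have hpair' : ∀ g : W → ℝ, ∑ y, g y * laplacian nb f y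
      = (g x - g z) * laplacian nb f x := by
    intro g
    have hz : laplacian nb f z = -laplacian nb f x := by
      have h0 := sum_laplacian hnb f
      rw [Fintype.sum_eq_add x z hxz fun y hy => hf y hy.1 hy.2] at h0
      linarith
    rw [Fintype.sum_eq_add x z hxz fun y hy => by rw [hf y hy.1 hy.2, mul_zero], hz]
    ring
  have h1 := hpair f u z hu
  have h2 := hpair f v x hv
  rw [sum_mul_laplacian_comm hnb, hpair', huz, hfz] at h1
  rw [sum_mul_laplacian_comm hnb, hpair', hvx, hfx, hsymm] at h2
  have h3 : r * (2 * ∑ y, f y) = r * N := by linarith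
  have := mul_left_cancel₀ hr h3
  linarith

/-- On a finite transitive graph with a sink, every site is visited with probability at least
`1 / 2` from the uniform distribution. -/
theorem half_le_meanHit_of_transitive {z : W} (hconn : G.Connected)
    (htr : VertexTransitive G) {lam : ℝ}
    (h : IsAdmissible (walkKernel G (Finset.univ.erase z)) lam
      (uniformLaw (Finset.univ.erase z : Finset W))) (x : (Finset.univ.erase z : Finset W)) :
    1 ≤ 2 * meanHit (walkKernel G (Finset.univ.erase z))
      (uniformLaw (Finset.univ.erase z : Finset W)) x := by
  have hK := h.isKilled
  obtain ⟨nb, hnb⟩ := exists_isNeighborList (G := G) fun x => Set.toFinite _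
  obtain ⟨φ, hφ⟩ := htr x z
  have hxz : (x : W) ≠ z := Finset.ne_of_mem_erase x.2
  have hmem : ∀ y, y ≠ z → y ∈ (Finset.univ.erase z : Finset W) := fun y hy => by simp [hy]
  have hzS : z ∉ (Finset.univ.erase z : Finset W) := by simp
  have hreg : ∀ y, (nb y).card = (nb z).card := by
    intro y
    obtain ⟨ψ, hψ⟩ := htr y z
    refine Finset.card_bij (fun w _ => ψ w) (fun w hw => ?_) (fun _ _ _ _ h => ψ.injective h)
      fun w hw => ⟨ψ.symm w, ?_, by simp⟩
    · rw [hnb] at hw ⊢; rw [← hψ]; exact ψ.map_adj_iff.mpr hw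
    · rw [hnb] at hw ⊢
      rw [← ψ.map_adj_iff, hψ]
      simpa using hw
  have hpos : (0 : ℝ) < (nb z).card := by
    have : Nontrivial W := ⟨x, z, hxz⟩
    obtain ⟨y, hy⟩ := hconn.preconnected.exists_adj_of_nontrivial z
    exact_mod_cast Finset.card_pos.mpr ⟨y, (hnb _ _).mpr hy⟩
  -- the killed walk is the walk on the graph, as far as functions vanishing at `z` are concerned
  have hlap : ∀ (g : ↥(Finset.univ.erase z) → ℝ) (y) (hy : y ≠ z),
      laplacian nb (extendZero g) y = (nb z).card * (g ⟨y, hmem y hy⟩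
        - ∑ w, walkKernel G (Finset.univ.erase z) ⟨y, hmem y hy⟩ w * g w) := by
    intro g y hy
    have h2 := sum_walkKernel_mul (S := Finset.univ.erase z) hnb (g := extendZero g)
        (fun x hx => extendZero_of_not_mem _ hx) ⟨y, hmem y hy⟩
    simp only [extendZero_coe] at h2
    rw [h2, laplacian, Finset.sum_sub_distrib, Finset.sum_const, nsmul_eq_mul, hreg,
      ← extendZero_coe g ⟨y, hmem y hy⟩]
    field_simp
  have hsum := sum_eq_half_card_of_transitive hnb φ hφ hxz
    (f := extendZero (hitProb (walkKernel G (Finset.univ.erase z)) x))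
    (u := extendZero (lifetime (walkKernel G (Finset.univ.erase z)))) (r := (nb z).card)
    (by rw [extendZero_coe, hK.hitProb_self]) (extendZero_of_not_mem _ hzS)
    (fun y hyx hyz => by
      rw [hlap _ y hyz, hK.hitProb_of_ne (fun h => hyx (congrArg Subtype.val h)), sub_self,
        mul_zero])
    hpos.ne' (extendZero_of_not_mem _ hzS)
    (fun y hyz => by
      rw [hlap _ y hyz, hK.lifetime_eq ⟨y, hmem y hyz⟩]
      ring)
  have : Nonempty (Finset.univ.erase z : Finset W) := ⟨x⟩
  have h1 := sum_hitProb_eq (K := walkKernel G (Finset.univ.erase z)) x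
  have h2 : ∑ y, hitProb (walkKernel G (Finset.univ.erase z)) x y
      = ∑ y, extendZero (hitProb (walkKernel G (Finset.univ.erase z)) x) y := by
    rw [← Finset.add_sum_erase _ _ (Finset.mem_univ z), extendZero_of_not_mem _ hzS, zero_add,
      ← Finset.sum_coe_sort (Finset.univ.erase z)]
    exact Finset.sum_congr rfl fun y _ => (extendZero_coe _ y).symm
  rw [h2, hsum, Fintype.card_coe, Finset.card_erase_of_mem (Finset.mem_univ z),
    Finset.card_univ] at h1
  have hcard : 1 < Fintype.card W := Fintype.one_lt_card_iff.mpr ⟨x, z, hxz⟩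
  rw [Nat.cast_pred (by omega)] at h1
  have h3 : (1 : ℝ) < Fintype.card W := by exact_mod_cast hcard
  nlinarith

end Transitive

/-! ### Symmetric walks -/

section Green

variable {V : Type*} [Fintype V] [DecidableEq V] {K : V → V → ℝ}

/-- For a symmetric walk, the sum over `y` of the probabilities to visit `x` from `y` is the mean
lifetime from `x` divided by the Green function at `x`; the latter is bounded with the help of a
superharmonic function `F`. -/
theorem IsKilled.mul_lifetime_le (hK : IsKilled K) (hsymm : ∀ x y, K x y = K y x) {F : V → ℝ}
    {x : V} {δ : ℝ} (hF : ∀ y, ∑ w, K y w * F w ≤ F y)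
    (hFx : ∑ w, K x w * F w ≤ F x - δ) :
    δ * lifetime K x ≤ F x * ∑ y, hitProb K x y := by
  set c := 1 - ∑ w, K x w * hitProb K x w
  have hpair : ∀ g : V → ℝ, ∑ y, hitProb K x y * (g y - ∑ w, K y w * g w) = c * g x := by
    intro g
    have h1 : ∑ y, hitProb K x y * (g y - ∑ w, K y w * g w)
        = ∑ y, (hitProb K x y - ∑ w, K y w * hitProb K x w) * g y := by
      simp only [mul_sub, sub_mul, Finset.sum_sub_distrib, Finset.mul_sum, Finset.sum_mul]
      congr 1
      rw [Finset.sum_comm]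
      refine Finset.sum_congr rfl fun y _ => Finset.sum_congr rfl fun w _ => ?_
      rw [hsymm w y]; ring
    rw [h1, Finset.sum_eq_single x (fun y _ hy => by rw [hK.hitProb_of_ne hy]; ring)
      (fun h => absurd (Finset.mem_univ x) h), hK.hitProb_self]
  have h1 : ∑ y, hitProb K x y = c * lifetime K x := by
    rw [← hpair]
    refine Finset.sum_congr rfl fun y _ => ?_
    have := hK.lifetime_eq y
    rw [show lifetime K y - ∑ w, K y w * lifetime K w = 1 by linarith, mul_one]
  have h2 : δ ≤ c * F x := by
    rw [← hpair F]
    refine le_trans ?_ (Finset.single_le_sum (f := fun y =>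
      hitProb K x y * (F y - ∑ w, K y w * F w)) (fun y _ => mul_nonneg (hK.hitProb_nonneg x y)
        (sub_nonneg.mpr (hF y))) (Finset.mem_univ x))
    simp only [hK.hitProb_self]
    linarith
  rw [h1]
  have := mul_le_mul_of_nonneg_right h2 (hK.lifetime_nonneg x)
  linarith

end Green

/-! ### The lattice walk killed outside a ball -/

section Lattice

variable {d n : ℕ}

/-- The neighbour of `x` in one of the `2 d` directions. -/
def latticeStep (x : Fin d → ℤ) (p : Fin d × Bool) : Fin d → ℤ :=
  Function.update x p.1 (x p.1 + if p.2 then 1 else -1)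

theorem latticeStep_injective (x : Fin d → ℤ) : Function.Injective (latticeStep x) := by
  rintro ⟨i, a⟩ ⟨j, b⟩ h
  have h1 := congrFun h i
  by_cases hij : i = j
  · subst hij
    simp only [latticeStep, Function.update_self] at h1
    cases a <;> cases b <;> simp_all
  · simp only [latticeStep, Function.update_self, Function.update_of_ne hij] at h1
    cases a <;> simp at h1

/-- The neighbours of a site of the lattice. -/
def latticeNeighbors (x : Fin d → ℤ) : Finset (Fin d → ℤ) :=
  Finset.univ.map ⟨latticeStep x, latticeStep_injective x⟩

theorem isNeighborList_lattice : IsNeighborList (latticeGraph d) latticeNeighbors := by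
  intro x y
  simp only [latticeNeighbors, Finset.mem_map, Finset.mem_univ, true_and,
    Function.Embedding.coeFn_mk, latticeGraph]
  constructor
  · rintro ⟨⟨i, b⟩, rfl⟩
    rw [Finset.sum_eq_single i (fun j _ hj => by
      simp [latticeStep, Function.update_of_ne hj]) (fun h => absurd (Finset.mem_univ i) h)]
    cases b <;> simp [latticeStep]
  · intro h
    obtain ⟨i, hi⟩ : ∃ i, x i ≠ y i := by
      by_contra! hcon
      simp [hcon] at h
    have hi1 : 1 ≤ |x i - y i| := Int.one_le_abs (sub_ne_zero.mpr hi)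
    have hsplit := Finset.add_sum_erase Finset.univ (fun j => |x j - y j|) (Finset.mem_univ i)
    have hnn : 0 ≤ ∑ j ∈ Finset.univ.erase i, |x j - y j| :=
      Finset.sum_nonneg fun j _ => abs_nonneg _
    have hzero : ∑ j ∈ Finset.univ.erase i, |x j - y j| = 0 := by omega
    have hother : ∀ j, j ≠ i → y j = x j := by
      intro j hj
      have := (Finset.sum_eq_zero_iff_of_nonneg fun j _ => abs_nonneg _).mp hzero j
        (Finset.mem_erase.mpr ⟨hj, Finset.mem_univ j⟩)
      rw [abs_eq_zero] at this
      omega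
    have hone : |x i - y i| = 1 := by omega
    rcases (abs_eq one_pos.le).mp hone with h1 | h1
    · refine ⟨(i, false), funext fun j => ?_⟩
      by_cases hj : j = i
      · subst hj; simp [latticeStep]; omega
      · simp [latticeStep, Function.update_of_ne hj, hother j hj]
    · refine ⟨(i, true), funext fun j => ?_⟩
      by_cases hj : j = i
      · subst hj; simp [latticeStep]; omega
      · simp [latticeStep, Function.update_of_ne hj, hother j hj]

theorem card_latticeNeighbors (x : Fin d → ℤ) : (latticeNeighbors x).card = 2 * d := by
  simp [latticeNeighbors, Finset.card_univ, mul_comm]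

theorem sum_latticeNeighbors (g : (Fin d → ℤ) → ℝ) (x : Fin d → ℤ) :
    ∑ y ∈ latticeNeighbors x, g y
      = ∑ i, (g (latticeStep x (i, true)) + g (latticeStep x (i, false))) := by
  simp [latticeNeighbors, Finset.sum_map, Fintype.sum_prod_type]

/-- Squared Euclidean distance. -/
def sqDist (x y : Fin d → ℤ) : ℝ := ∑ i, ((y i : ℝ) - x i) ^ 2

theorem sqDist_nonneg (x y : Fin d → ℤ) : 0 ≤ sqDist x y :=
  Finset.sum_nonneg fun _ _ => sq_nonneg _

theorem sq_le_sqDist (x y : Fin d → ℤ) (i : Fin d) : ((y i : ℝ) - x i) ^ 2 ≤ sqDist x y :=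
  Finset.single_le_sum (f := fun i => ((y i : ℝ) - x i) ^ 2) (fun _ _ => sq_nonneg _)
    (Finset.mem_univ i)

theorem sqDist_latticeStep (x y : Fin d → ℤ) (i : Fin d) (b : Bool) :
    sqDist x (latticeStep y (i, b))
      = sqDist x y + 1 + (if b then 2 else -2) * ((y i : ℝ) - x i) := by
  simp only [sqDist]
  rw [← Finset.add_sum_erase _ _ (Finset.mem_univ i),
    ← Finset.add_sum_erase _ (fun j => ((y j : ℝ) - x j) ^ 2) (Finset.mem_univ i),
    Finset.sum_congr rfl fun j hj => by
      rw [latticeStep, Function.update_of_ne (Finset.ne_of_mem_erase hj)]]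
  cases b <;> simp [latticeStep] <;> ring

theorem mem_latticeBall_iff (x : Fin d → ℤ) :
    x ∈ latticeBall d n ↔ sqDist 0 x ≤ (n : ℝ) ^ 2 := by
  rw [mem_latticeBall]
  have : sqDist 0 x = ((∑ i, x i ^ 2 : ℤ) : ℝ) := by simp [sqDist]
  rw [this]
  exact_mod_cast Iff.rfl

theorem add_one_le_of_not_mem_latticeBall {x : Fin d → ℤ} (h : x ∉ latticeBall d n) :
    (n : ℝ) ^ 2 + 1 ≤ sqDist 0 x := by
  rw [mem_latticeBall, not_le] at h
  have : sqDist 0 x = ((∑ i, x i ^ 2 : ℤ) : ℝ) := by simp [sqDist]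
  rw [this]
  exact_mod_cast h

theorem zero_mem_latticeBall : (0 : Fin d → ℤ) ∈ latticeBall d n := by
  simp [mem_latticeBall]

theorem card_latticeBall_le : ((latticeBall d n).card : ℝ) ≤ (2 * n + 1) ^ d := by
  have h1 : (latticeBall d n).card
      ≤ (Finset.Icc (fun _ : Fin d => -(n : ℤ)) (fun _ => (n : ℤ))).card :=
    Finset.card_filter_le _ _
  rw [Pi.card_Icc] at h1
  simp only [Int.card_Icc, Finset.prod_const, Finset.card_univ, Fintype.card_fin] at h1
  have h2 : ((n : ℤ) + 1 - -(n : ℤ)).toNat = 2 * n + 1 := by omega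
  rw [h2] at h1
  exact_mod_cast h1

theorem isAdmissible_latticeBall (hd : 1 ≤ d) {lam : ℝ} (hlam : 0 < lam) :
    IsAdmissible (walkKernel (latticeGraph d) (latticeBall d n)) lam
      (uniformLaw (latticeBall d n)) := by
  refine isAdmissible_walkKernel isNeighborList_lattice ⟨0, zero_mem_latticeBall⟩ hlam
    fun T _ hT => ?_
  let i : Fin d := ⟨0, hd⟩
  obtain ⟨x, hx, hmax⟩ := Finset.exists_max_image T (fun x => x i) hT
  refine ⟨x, hx, latticeStep x (i, true), fun h => ?_, ?_⟩
  · have := hmax _ h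
    simp [latticeStep] at this
  · rw [← isNeighborList_lattice]
    exact Finset.mem_map_of_mem _ (Finset.mem_univ _)

theorem walkKernel_lattice_symm (x y : latticeBall d n) :
    walkKernel (latticeGraph d) (latticeBall d n) x y
      = walkKernel (latticeGraph d) (latticeBall d n) y x := by
  simp only [walkKernel, isNeighborList_lattice.ncard, card_latticeNeighbors]
  by_cases h : (latticeGraph d).Adj (x : Fin d → ℤ) y
  · rw [if_pos h, if_pos h.symm]
  · rw [if_neg h, if_neg fun h' => h h'.symm]

/-- One step of the walk from `x`, in terms of the sum over the neighbours. -/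
theorem sum_walkKernel_lattice (g : (Fin d → ℤ) → ℝ) (x : latticeBall d n) :
    ∑ y, walkKernel (latticeGraph d) (latticeBall d n) x y * g y
      = (∑ i, ((if latticeStep x (i, true) ∈ latticeBall d n then g (latticeStep x (i, true))
          else 0) + (if latticeStep x (i, false) ∈ latticeBall d n then
            g (latticeStep x (i, false)) else 0))) / (2 * d) := by
  have h1 := sum_walkKernel_mul (S := latticeBall d n) isNeighborList_lattice
    (g := fun y => if y ∈ latticeBall d n then g y else 0) (fun y hy => by rw [if_neg hy]) x
  rw [sum_latticeNeighbors, card_latticeNeighbors] at h1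
  simp only [Finset.coe_mem, if_true] at h1
  rw [h1]
  push_cast
  rfl

theorem sum_walkKernel_lattice_le (hd : 1 ≤ d) {F : (Fin d → ℤ) → ℝ} {x : latticeBall d n}
    {c : ℝ} (h0 : ∀ i b, 0 ≤ F (latticeStep x (i, b)))
    (h : ∑ i, (F (latticeStep x (i, true)) + F (latticeStep x (i, false))) ≤ 2 * d * c) :
    ∑ y, walkKernel (latticeGraph d) (latticeBall d n) x y * F y ≤ c := by
  have hd' : (0 : ℝ) < d := by exact_mod_cast hd
  rw [sum_walkKernel_lattice, div_le_iff₀ (by positivity)]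
  refine le_trans (Finset.sum_le_sum fun i _ => ?_) (h.trans (le_of_eq (by ring)))
  have h1 := h0 i true
  have h2 := h0 i false
  split_ifs <;> linarith

theorem le_sum_walkKernel_lattice (hd : 1 ≤ d) {F : (Fin d → ℤ) → ℝ} {x : latticeBall d n}
    {c : ℝ} (h0 : ∀ i b, latticeStep x (i, b) ∉ latticeBall d n → F (latticeStep x (i, b)) ≤ 0)
    (h : 2 * d * c ≤ ∑ i, (F (latticeStep x (i, true)) + F (latticeStep x (i, false)))) :
    c ≤ ∑ y, walkKernel (latticeGraph d) (latticeBall d n) x y * F y := by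
  have hd' : (0 : ℝ) < d := by exact_mod_cast hd
  rw [sum_walkKernel_lattice, le_div_iff₀ (by positivity)]
  refine le_trans (le_of_eq (by ring)) (h.trans (Finset.sum_le_sum fun i _ => ?_))
  have h1 := h0 i true
  have h2 := h0 i false
  split_ifs with h3 h4 h4
  · exact le_rfl
  · linarith [h2 h4]
  · linarith [h1 h3]
  · linarith [h2 h4, h1 h3]

/-- The compensated squared norm is a martingale, so that the mean time to leave the ball is at
least `n ^ 2 + 1 - |x| ^ 2`. -/
theorem sub_sqDist_le_lifetime (hd : 1 ≤ d) (x : latticeBall d n) :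
    (n : ℝ) ^ 2 + 1 - sqDist 0 (x : Fin d → ℤ)
      ≤ lifetime (walkKernel (latticeGraph d) (latticeBall d n)) x := by
  have hK := (isAdmissible_latticeBall (n := n) hd one_pos).isKilled
  refine hK.le_dirichlet (u := fun x => (n : ℝ) ^ 2 + 1 - sqDist 0 (x : Fin d → ℤ)) (fun y => ?_) x
  simp only [Finset.mem_univ, if_true]
  rw [← sub_le_iff_le_add]
  refine le_sum_walkKernel_lattice (F := fun x => (n : ℝ) ^ 2 + 1 - sqDist 0 x) hd
    (fun i b h => by linarith [add_one_le_of_not_mem_latticeBall h]) (le_of_eq ?_)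
  have : ∀ i : Fin d, (n : ℝ) ^ 2 + 1 - sqDist 0 (latticeStep y (i, true))
      + ((n : ℝ) ^ 2 + 1 - sqDist 0 (latticeStep y (i, false)))
      = 2 * ((n : ℝ) ^ 2 + 1 - sqDist 0 (y : Fin d → ℤ) - 1) := by
    intro i
    rw [sqDist_latticeStep, sqDist_latticeStep]
    simp only [if_true, Bool.false_eq_true, if_false]
    ring
  simp only [this, Finset.sum_const, Finset.card_univ, Fintype.card_fin, nsmul_eq_mul]
  ring

/-- The mean time to leave a ball is at least of the order of its radius, even from sites that are
next to the boundary: one step towards the centre has a positive probability. -/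
theorem le_lifetime_latticeBall (hd : 1 ≤ d) (hn : 1 ≤ n) (x : latticeBall d n) :
    (n : ℝ) / (2 * d ^ 2) ≤ lifetime (walkKernel (latticeGraph d) (latticeBall d n)) x := by
  have hd' : (1 : ℝ) ≤ d := by exact_mod_cast hd
  have hn' : (1 : ℝ) ≤ n := by exact_mod_cast hn
  have h0 := sub_sqDist_le_lifetime hd x
  rcases le_or_gt (sqDist 0 (x : Fin d → ℤ)) ((n : ℝ) ^ 2 / 2) with h | h
  · refine le_trans ?_ h0
    rw [div_le_iff₀ (by positivity)]
    have h1 : (n : ℝ) / 2 ≤ (n : ℝ) ^ 2 + 1 - sqDist 0 (x : Fin d → ℤ) := by nlinarith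
    nlinarith [mul_nonneg (by linarith : (0 : ℝ) ≤ d - 1) (by linarith : (0 : ℝ) ≤ d + 1)]
  · have hK := (isAdmissible_latticeBall (n := n) hd one_pos).isKilled
    have hxS := (mem_latticeBall_iff (n := n) (x : Fin d → ℤ)).mp x.2
    -- a coordinate of maximal absolute value
    obtain ⟨i, -, hi⟩ := Finset.exists_max_image Finset.univ
      (fun i => (((x : Fin d → ℤ) i : ℤ) : ℝ) ^ 2) ⟨⟨0, hd⟩, Finset.mem_univ _⟩
    set xi : ℝ := (((x : Fin d → ℤ) i : ℤ) : ℝ)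
    have h1 : sqDist 0 (x : Fin d → ℤ) ≤ d * xi ^ 2 := by
      have := Finset.sum_le_card_nsmul Finset.univ
        (fun i => (((x : Fin d → ℤ) i : ℤ) : ℝ) ^ 2) (xi ^ 2) hi
      simpa [sqDist] using this
    have h2 : (n : ℝ) / (2 * d) ≤ |xi| := by
      by_contra! hcon
      rw [lt_div_iff₀ (by positivity)] at hcon
      have h3 : |xi| * d < n / 2 := by linarith
      have h4 : (|xi| * d) ^ 2 < (n / 2 : ℝ) ^ 2 :=
        pow_lt_pow_left₀ h3 (by positivity) two_ne_zero
      rw [mul_pow, sq_abs] at h4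
      nlinarith [mul_nonneg (by linarith : (0 : ℝ) ≤ d - 1)
        (mul_nonneg (by positivity : (0 : ℝ) ≤ d) (sq_nonneg xi))]
    have h3 : 1 ≤ |xi| := by
      have hpos : 0 < |xi| := lt_of_lt_of_le (by positivity) h2
      have hne : (x : Fin d → ℤ) i ≠ 0 := fun h => by simp [xi, h] at hpos
      have h4 : (1 : ℝ) ≤ ((|(x : Fin d → ℤ) i| : ℤ) : ℝ) := by exact_mod_cast Int.one_le_abs hne
      rwa [Int.cast_abs] at h4
    -- one step towards the centre
    have hstep : ∃ b, sqDist 0 (latticeStep x (i, b)) = sqDist 0 (x : Fin d → ℤ) + 1 - 2 * |xi| := by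
      rcases le_total 0 xi with hx | hx
      · refine ⟨false, ?_⟩
        rw [sqDist_latticeStep, abs_of_nonneg hx]
        simp [xi]; ring
      · refine ⟨true, ?_⟩
        rw [sqDist_latticeStep, abs_of_nonpos hx]
        simp [xi]
    obtain ⟨b, hb⟩ := hstep
    have hmem : latticeStep x (i, b) ∈ latticeBall d n :=
      (mem_latticeBall_iff _).mpr (by linarith)
    have h5 := sub_sqDist_le_lifetime hd ⟨_, hmem⟩
    simp only [hb] at h5
    have hKxy : walkKernel (latticeGraph d) (latticeBall d n) x ⟨_, hmem⟩ = 1 / (2 * d) := by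
      have hadj : (latticeGraph d).Adj x (latticeStep x (i, b)) := by
        rw [← isNeighborList_lattice]
        exact Finset.mem_map_of_mem _ (Finset.mem_univ _)
      simp only [walkKernel, hadj, if_true, isNeighborList_lattice.ncard, card_latticeNeighbors]
      push_cast
      rfl
    have h6 := hK.lifetime_eq x
    have h7 := Finset.single_le_sum (f := fun y => walkKernel (latticeGraph d) (latticeBall d n) x y
      * lifetime (walkKernel (latticeGraph d) (latticeBall d n)) y)
      (fun y _ => mul_nonneg ((isAdmissible_latticeBall hd one_pos).kernel_nonneg x y)
        (hK.lifetime_nonneg y)) (Finset.mem_univ ⟨_, hmem⟩)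
    simp only [hKxy] at h7
    have h8 : 1 / (2 * d : ℝ) * (2 * |xi|) ≤ 1 / (2 * d)
        * lifetime (walkKernel (latticeGraph d) (latticeBall d n)) ⟨_, hmem⟩ :=
      mul_le_mul_of_nonneg_left (by linarith) (by positivity)
    have h9 : (n : ℝ) / (2 * d ^ 2) ≤ 1 / (2 * d : ℝ) * (2 * |xi|) := by
      have := div_le_div_of_nonneg_right h2 (by positivity : (0 : ℝ) ≤ d)
      refine le_trans (le_of_eq ?_) (this.trans (le_of_eq ?_)) <;> field_simp
    linarith

end Lattice

/-! ### Hitting probabilities in lattice balls -/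

section Lattice

variable {d n : ℕ}

/-- The comparison with a superharmonic function `F`, in terms of the sums over neighbours. -/
theorem mul_lifetime_latticeBall_le (hd : 1 ≤ d) {F : (Fin d → ℤ) → ℝ} {x : latticeBall d n} {δ : ℝ}
    (h0 : ∀ y : latticeBall d n, ∀ i b, 0 ≤ F (latticeStep y (i, b)))
    (hF : ∀ y : latticeBall d n,
      ∑ i, (F (latticeStep y (i, true)) + F (latticeStep y (i, false))) ≤ 2 * d * F y)
    (hFx : ∑ i, (F (latticeStep x (i, true)) + F (latticeStep x (i, false)))
      ≤ 2 * d * (F x - δ)) :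
    δ * lifetime (walkKernel (latticeGraph d) (latticeBall d n)) x
      ≤ F x * ∑ y, hitProb (walkKernel (latticeGraph d) (latticeBall d n)) x y :=
  (isAdmissible_latticeBall (n := n) hd one_pos).isKilled.mul_lifetime_le walkKernel_lattice_symm
    (F := fun y => F y) (fun y => sum_walkKernel_lattice_le hd (h0 y) (hF y))
    (sum_walkKernel_lattice_le hd (h0 x) hFx)

/-- In dimension one the Green function is piecewise linear. -/
theorem le_sum_hitProb_interval (hn : 1 ≤ n) (x : latticeBall 1 n) :
    1 / 5 * (n : ℝ) ≤ ∑ y, hitProb (walkKernel (latticeGraph 1) (latticeBall 1 n)) x y := by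
  have hn' : (1 : ℝ) ≤ n := by exact_mod_cast hn
  have habs : ∀ y : latticeBall 1 n, |(((y : Fin 1 → ℤ) 0 : ℤ) : ℝ)| ≤ n := fun y => by
    have h := (mem_latticeBall_iff (n := n) (y : Fin 1 → ℤ)).mp y.2
    simp only [sqDist, Finset.univ_unique, Fin.default_eq_zero, Finset.sum_singleton,
      Pi.zero_apply, Int.cast_zero, sub_zero] at h
    exact abs_le_of_sq_le_sq h (by positivity)
  have hsq : sqDist 0 (x : Fin 1 → ℤ) = (((x : Fin 1 → ℤ) 0 : ℤ) : ℝ) ^ 2 := by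
    simp [sqDist]
  have hl1 := sub_sqDist_le_lifetime le_rfl x
  have hl2 := le_lifetime_latticeBall le_rfl hn x
  rw [hsq] at hl1
  set a : ℝ := (((x : Fin 1 → ℤ) 0 : ℤ) : ℝ)
  have ha := abs_le.mp (habs x)
  -- a multiple of the Green function of the interval with a pole at `x`
  let F : (Fin 1 → ℤ) → ℝ := fun y =>
    min ((n + 1 - a) * (n + 1 + y 0)) ((n + 1 + a) * (n + 1 - y 0))
  have hstep : ∀ (y : Fin 1 → ℤ) (i : Fin 1) (b : Bool),
      ((latticeStep y (i, b) 0 : ℤ) : ℝ) = y 0 + if b then 1 else -1 := fun y i b => by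
    rw [Subsingleton.elim i 0]
    cases b <;> simp [latticeStep]
  have hFx : F x = (n + 1) ^ 2 - a ^ 2 := by
    rw [show F x = min ((n + 1 - a) * (n + 1 + a)) ((n + 1 + a) * (n + 1 - a)) from rfl,
      mul_comm (n + 1 + a : ℝ), min_self]
    ring
  have key := mul_lifetime_latticeBall_le (F := F) (x := x) (δ := n + 1) le_rfl
    (fun y i b => ?_) (fun y => ?_) ?_
  · have h1 : F x ≤ 5 * lifetime (walkKernel (latticeGraph 1) (latticeBall 1 n)) x := by
      rw [hFx]
      have : (n : ℝ) / (2 * (1 : ℕ) ^ 2) = n / 2 := by norm_num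
      rw [this] at hl2
      linarith
    have hlt : 0 < lifetime (walkKernel (latticeGraph 1) (latticeBall 1 n)) x := by
      refine lt_of_lt_of_le ?_ hl2
      positivity
    have h0 : 0 ≤ ∑ y, hitProb (walkKernel (latticeGraph 1) (latticeBall 1 n)) x y :=
      Finset.sum_nonneg fun y _ =>
        (isAdmissible_latticeBall (n := n) le_rfl one_pos).isKilled.hitProb_nonneg x y
    have h2 := key.trans (mul_le_mul_of_nonneg_right h1 h0)
    rw [mul_right_comm, mul_comm (5 * _ : ℝ)] at h2
    have h3 : (n + 1 : ℝ) * lifetime (walkKernel (latticeGraph 1) (latticeBall 1 n)) x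
        ≤ (5 * ∑ y, hitProb (walkKernel (latticeGraph 1) (latticeBall 1 n)) x y)
          * lifetime (walkKernel (latticeGraph 1) (latticeBall 1 n)) x := by linarith
    have := le_of_mul_le_mul_right h3 hlt
    linarith
  · have hy := abs_le.mp (habs y)
    simp only [F, hstep]
    refine le_min (mul_nonneg (by linarith) ?_) (mul_nonneg (by linarith) ?_) <;>
    cases b <;> simp <;> linarith
  · simp only [F, hstep, Finset.univ_unique, Finset.sum_singleton, if_true, Bool.false_eq_true,
      if_false, Nat.cast_one, mul_one]
    generalize (((y : Fin 1 → ℤ) 0 : ℤ) : ℝ) = b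
    rcases min_choice ((n + 1 - a) * (n + 1 + b)) ((n + 1 + a) * (n + 1 - b)) with h | h <;> rw [h]
    · refine (add_le_add (min_le_left _ _) (min_le_left _ _)).trans (le_of_eq (by ring))
    · refine (add_le_add (min_le_right _ _) (min_le_right _ _)).trans (le_of_eq (by ring))
  · rw [hFx]
    simp only [F, hstep, Finset.univ_unique, Finset.sum_singleton, if_true, Bool.false_eq_true,
      if_false, Nat.cast_one, mul_one]
    exact (add_le_add (min_le_right _ _) (min_le_left _ _)).trans (le_of_eq (by ring))

theorem sqDist_le_of_mem {x y : Fin d → ℤ} (hx : x ∈ latticeBall d n) (hy : y ∈ latticeBall d n) :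
    sqDist x y ≤ (2 * n) ^ 2 := by
  rw [mem_latticeBall_iff] at hx hy
  have h1 : sqDist x y ≤ 2 * sqDist 0 x + 2 * sqDist 0 y := by
    simp only [sqDist, Finset.mul_sum, ← Finset.sum_add_distrib]
    refine Finset.sum_le_sum fun i _ => ?_
    simp only [Pi.zero_apply, Int.cast_zero, sub_zero]
    nlinarith [sq_nonneg ((y i : ℝ) + x i)]
  nlinarith

theorem sqDist_self (x : Fin d → ℤ) : sqDist x x = 0 := by simp [sqDist]

/-- In dimension two a logarithm replaces the Green function. -/
theorem le_sum_hitProb_disc (hn : 2 ≤ n) (x : latticeBall 2 n) :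
    Real.log 2 / 48 * (n : ℝ)
      ≤ Real.log n * ∑ y, hitProb (walkKernel (latticeGraph 2) (latticeBall 2 n)) x y := by
  have hn' : (2 : ℝ) ≤ n := by exact_mod_cast hn
  -- the additive constant keeps `F` nonnegative on the neighbours of the ball
  let F : (Fin 2 → ℤ) → ℝ := fun y => Real.log (10 * n ^ 2 + 1) - Real.log (sqDist x y + 1)
  have hl2 := le_lifetime_latticeBall one_le_two (by omega) x
  have hpos : ∀ y, 0 < sqDist (x : Fin 2 → ℤ) y + 1 := fun y => by linarith [sqDist_nonneg x.1 y]
  have hFx : F x = Real.log (10 * n ^ 2 + 1) := by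
    simp [F, sqDist_self]
  have key := mul_lifetime_latticeBall_le (F := F) (x := x) (δ := Real.log 2) one_le_two
    (fun y i b => ?_) (fun y => ?_) ?_
  · have hlog : F x ≤ 6 * Real.log n := by
      rw [hFx, show (6 : ℝ) * Real.log n = Real.log ((n : ℝ) ^ 6) by rw [Real.log_pow]; norm_num]
      refine Real.log_le_log (by positivity) ?_
      nlinarith [pow_le_pow_left₀ (by norm_num) hn' 2, pow_le_pow_left₀ (by norm_num) hn' 4,
        mul_le_mul_of_nonneg_right (pow_le_pow_left₀ (by norm_num) hn' 4) (sq_nonneg (n : ℝ))]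
    have h0 : 0 ≤ ∑ y, hitProb (walkKernel (latticeGraph 2) (latticeBall 2 n)) x y :=
      Finset.sum_nonneg fun y _ =>
        (isAdmissible_latticeBall (n := n) one_le_two one_pos).isKilled.hitProb_nonneg x y
    have h2 := key.trans (mul_le_mul_of_nonneg_right hlog h0)
    have h3 := mul_le_mul_of_nonneg_left hl2 (Real.log_nonneg one_le_two)
    have h4 : Real.log 2 * ((n : ℝ) / (2 * (2 : ℕ) ^ 2)) = 6 * (Real.log 2 / 48 * n) := by
      push_cast; ring
    rw [h4] at h3
    linarith
  · refine sub_nonneg.mpr (Real.log_le_log (hpos _) ?_)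
    have h1 := sqDist_le_of_mem x.2 y.2
    have h2 := abs_le.mp (abs_le_of_sq_le_sq ((sq_le_sqDist x.1 y.1 i).trans h1) (by positivity))
    rw [sqDist_latticeStep]
    cases b <;> simp <;> nlinarith
  · simp only [F, Fin.sum_univ_two, sqDist_latticeStep, if_true, Bool.false_eq_true, if_false]
    have hq : sqDist (x : Fin 2 → ℤ) y = (((y : Fin 2 → ℤ) 0 : ℝ) - x.1 0) ^ 2
        + (((y : Fin 2 → ℤ) 1 : ℝ) - x.1 1) ^ 2 := by simp [sqDist]
    generalize (((y : Fin 2 → ℤ) 0 : ℝ) - x.1 0) = u at *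
    generalize (((y : Fin 2 → ℤ) 1 : ℝ) - x.1 1) = v at *
    rw [hq]
    have p1 : 0 < u ^ 2 + v ^ 2 + 1 + 2 * u + 1 := by nlinarith [sq_nonneg (u + 1)]
    have p2 : 0 < u ^ 2 + v ^ 2 + 1 + -2 * u + 1 := by nlinarith [sq_nonneg (u - 1)]
    have p3 : 0 < u ^ 2 + v ^ 2 + 1 + 2 * v + 1 := by nlinarith [sq_nonneg (v + 1)]
    have p4 : 0 < u ^ 2 + v ^ 2 + 1 + -2 * v + 1 := by nlinarith [sq_nonneg (v - 1)]
    have hprod : Real.log ((u ^ 2 + v ^ 2 + 1) ^ 4)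
        ≤ Real.log ((u ^ 2 + v ^ 2 + 1 + 2 * u + 1) * (u ^ 2 + v ^ 2 + 1 + -2 * u + 1)
          * ((u ^ 2 + v ^ 2 + 1 + 2 * v + 1) * (u ^ 2 + v ^ 2 + 1 + -2 * v + 1))) := by
      refine Real.log_le_log (by positivity) ?_
      have : (u ^ 2 + v ^ 2 + 1 + 2 * u + 1) * (u ^ 2 + v ^ 2 + 1 + -2 * u + 1)
          * ((u ^ 2 + v ^ 2 + 1 + 2 * v + 1) * (u ^ 2 + v ^ 2 + 1 + -2 * v + 1))
          - (u ^ 2 + v ^ 2 + 1) ^ 4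
          = 2 * (u ^ 2 + v ^ 2 + 1) ^ 2 + 8 * (u ^ 2 + v ^ 2 + 1) + 5
            + 16 * (u * v) ^ 2 := by ring
      have h2 : 0 ≤ 2 * (u ^ 2 + v ^ 2 + 1) ^ 2 + 8 * (u ^ 2 + v ^ 2 + 1) + 5
            + 16 * (u * v) ^ 2 := by positivity
      linarith
    rw [Real.log_mul (by positivity) (by positivity), Real.log_mul p1.ne' p2.ne',
      Real.log_mul p3.ne' p4.ne', Real.log_pow] at hprod
    push_cast at hprod ⊢
    linarith
  · rw [hFx]
    simp only [F, Fin.sum_univ_two, sqDist_latticeStep, sqDist_self, sub_self, mul_zero, add_zero,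
      zero_add]
    norm_num
    linarith

/-- A second-order upper bound of `(1 + u) ^ (-1 / 4)`. -/
theorem one_add_rpow_le {u : ℝ} (h1 : -(1 / 10) ≤ u) (h2 : u ≤ 1 / 5) :
    (1 + u) ^ (-(1 / 4) : ℝ) ≤ 1 - u / 4 + 3 / 16 * u ^ 2 := by
  have hQ : 0 < 1 - u / 4 + 3 / 16 * u ^ 2 := by nlinarith [sq_nonneg u]
  have hu : |u| ≤ 1 / 5 := abs_le.mpr ⟨by linarith, h2⟩
  have hhorner : ∀ c t : ℝ, |c| ≤ 1 / 2 → |t| ≤ 1 → |c + u * t| ≤ 1 := fun c t hc ht => by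
    have h3 := abs_add_le c (u * t)
    rw [abs_mul] at h3
    have h4 := mul_le_mul hu ht (abs_nonneg t) (by norm_num)
    linarith
  have hpoly : 1 ≤ (1 + u) * (1 - u / 4 + 3 / 16 * u ^ 2) ^ 4 := by
    -- the expansion starts with `1 + u ^ 2 / 8 + u ^ 3 / 2`; `T` collects the higher-order terms
    obtain ⟨T, hT, hTe⟩ : ∃ T : ℝ, |T| ≤ 1 ∧
        (1 + u) * (1 - u / 4 + 3 / 16 * u ^ 2) ^ 4 - 1 = u ^ 2 * (1 / 8 + u * (1 / 2 + u * T)) :=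
      ⟨-69 / 256 + u * (61 / 256 + u * (-159 / 2048 + u * (135 / 4096 + u * (-351 / 65536
        + u * (81 / 65536))))), by
        refine hhorner _ _ (by norm_num [abs_le]) (hhorner _ _ (by norm_num [abs_le])
          (hhorner _ _ (by norm_num [abs_le]) (hhorner _ _ (by norm_num [abs_le])
          (hhorner _ _ (by norm_num [abs_le]) (by norm_num [abs_le]))))), by ring⟩
    have h3 : 0 ≤ 1 / 8 + u * (1 / 2 + u * T) := by
      have h4 := abs_le.mp hT
      nlinarith [mul_nonneg (sq_nonneg u) (by linarith : 0 ≤ T + 1)]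
    nlinarith [mul_nonneg (sq_nonneg u) h3]
  have h3 : ((1 - u / 4 + 3 / 16 * u ^ 2) ^ 4)⁻¹ ≤ 1 + u := by
    rw [inv_le_iff_one_le_mul₀ (by positivity)]
    exact hpoly
  refine (Real.rpow_le_rpow_of_nonpos (by positivity) h3 (by norm_num)).trans (le_of_eq ?_)
  rw [← Real.rpow_natCast, ← Real.rpow_neg hQ.le, ← Real.rpow_mul hQ.le]
  norm_num

theorem add_rpow_le {a v : ℝ} (ha : 0 < a) (h1 : -(1 / 10) * a ≤ v) (h2 : v ≤ 1 / 5 * a) :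
    (a + v) ^ (-(1 / 4) : ℝ)
      ≤ a ^ (-(1 / 4) : ℝ) * (1 - v / a / 4 + 3 / 16 * (v / a) ^ 2) := by
  have h3 : a + v = a * (1 + v / a) := by field_simp
  have h4 : -(1 / 10) ≤ v / a := by rwa [le_div_iff₀ ha]
  have h5 : v / a ≤ 1 / 5 := by rwa [div_le_iff₀ ha]
  rw [h3, Real.mul_rpow ha.le (by linarith)]
  exact mul_le_mul_of_nonneg_left (one_add_rpow_le h4 h5) (by positivity)

/-- In dimension three and higher the walk is transient: a bounded function replaces the Green
function. -/
theorem le_sum_hitProb_of_three_le (hd : 3 ≤ d) (hn : 1 ≤ n) (x : latticeBall d n) :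
    (100 ^ (-(1 / 4) : ℝ) - 101 ^ (-(1 / 4) : ℝ)) / 100 ^ (-(1 / 4) : ℝ) / (2 * d ^ 2) * (n : ℝ)
      ≤ ∑ y, hitProb (walkKernel (latticeGraph d) (latticeBall d n)) x y := by
  have hd' : (3 : ℝ) ≤ d := by exact_mod_cast hd
  have hd1 : 1 ≤ d := by omega
  -- adding `100` makes the relative change of the base in one step small enough for `add_rpow_le`
  let F : (Fin d → ℤ) → ℝ := fun y => (sqDist x y + 100) ^ (-(1 / 4) : ℝ)
  have hpos : ∀ y, 0 < sqDist (x : Fin d → ℤ) y + 100 := fun y => by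
    linarith [sqDist_nonneg x.1 y]
  have hFx : F x = 100 ^ (-(1 / 4) : ℝ) := by simp [F, sqDist_self]
  have hδ : (0 : ℝ) ≤ 100 ^ (-(1 / 4) : ℝ) - 101 ^ (-(1 / 4) : ℝ) :=
    sub_nonneg.mpr (Real.rpow_le_rpow_of_nonpos (by norm_num) (by norm_num) (by norm_num))
  have key := mul_lifetime_latticeBall_le (F := F) (x := x)
    (δ := 100 ^ (-(1 / 4) : ℝ) - 101 ^ (-(1 / 4) : ℝ)) hd1
    (fun y i b => (Real.rpow_pos_of_pos (hpos _) _).le) (fun y => ?_) ?_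
  · have h3 := (mul_le_mul_of_nonneg_left (le_lifetime_latticeBall hd1 hn x) hδ).trans key
    rw [hFx, ← div_le_iff₀' (by positivity)] at h3
    refine le_trans (le_of_eq ?_) h3
    ring
  · set a := sqDist (x : Fin d → ℤ) y + 100
    have ha : 0 < a := hpos y
    set z : Fin d → ℝ := fun i => ((y : Fin d → ℤ) i : ℝ) - x.1 i
    have hz : ∀ i, z i ^ 2 + 100 ≤ a := fun i => by
      linarith [sq_le_sqDist x.1 y.1 i]
    have hstep : ∀ i, F (latticeStep y (i, true)) + F (latticeStep y (i, false))
        ≤ a ^ (-(1 / 4) : ℝ) * (2 - 1 / a / 2 + 3 / 16 * ((2 + 8 * z i ^ 2) / a ^ 2)) := by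
      intro i
      have h1 := add_rpow_le (v := 1 + 2 * z i) ha
        (by nlinarith [hz i, sq_nonneg (z i + 10)]) (by nlinarith [hz i, sq_nonneg (z i - 5)])
      have h2 := add_rpow_le (v := 1 - 2 * z i) ha
        (by nlinarith [hz i, sq_nonneg (z i - 10)]) (by nlinarith [hz i, sq_nonneg (z i + 5)])
      simp only [F, sqDist_latticeStep, if_true, Bool.false_eq_true, if_false]
      rw [show sqDist (x : Fin d → ℤ) y + 1 + 2 * (((y : Fin d → ℤ) i : ℝ) - x.1 i) + 100
          = a + (1 + 2 * z i) by simp only [a, z]; ring,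
        show sqDist (x : Fin d → ℤ) y + 1 + -2 * (((y : Fin d → ℤ) i : ℝ) - x.1 i) + 100
          = a + (1 - 2 * z i) by simp only [a, z]; ring]
      refine (add_le_add h1 h2).trans (le_of_eq ?_)
      field_simp
      ring
    refine (Finset.sum_le_sum fun i _ => hstep i).trans ?_
    rw [← Finset.mul_sum, mul_comm (2 * (d : ℝ))]
    refine mul_le_mul_of_nonneg_left ?_ (Real.rpow_pos_of_pos ha _).le
    rw [Finset.sum_add_distrib, ← Finset.mul_sum, ← Finset.sum_div, Finset.sum_add_distrib,
      ← Finset.mul_sum, show ∑ i, z i ^ 2 = a - 100 by simp [a, z, sqDist]]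
    simp only [Finset.sum_const, Finset.card_univ, Fintype.card_fin, nsmul_eq_mul]
    have ha100 : 100 ≤ a := by simp only [a]; linarith [sqDist_nonneg x.1 y.1]
    have : (3 : ℝ) / 16 * ((d * 2 + 8 * (a - 100)) / a ^ 2) ≤ d * (1 / a / 2) := by
      rw [show (d : ℝ) * (1 / a / 2) = (d * a / 2) / a ^ 2 by field_simp, ← mul_div_assoc]
      refine div_le_div_of_nonneg_right ?_ (by positivity)
      nlinarith
    linarith
  · rw [hFx]
    simp only [F, sqDist_latticeStep, sqDist_self, sub_self, mul_zero, add_zero, zero_add,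
      Finset.sum_const, Finset.card_univ, Fintype.card_fin, nsmul_eq_mul]
    norm_num
    linarith

/-- The logarithmic correction in dimension two: the hitting probabilities of a site of the ball of
radius `n` add up to at least a constant multiple of `n / greenScale d n`. -/
def greenScale (d n : ℕ) : ℝ := if d = 2 then Real.log n else 1

theorem exists_le_sum_hitProb (hd : 1 ≤ d) : ∃ c : ℝ, 0 < c ∧ ∀ n, 2 ≤ n → ∀ x : latticeBall d n,
    c * n ≤ greenScale d n
      * ∑ y, hitProb (walkKernel (latticeGraph d) (latticeBall d n)) x y := by
  obtain rfl | rfl | h : d = 1 ∨ d = 2 ∨ 3 ≤ d := by omega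
  · exact ⟨1 / 5, by norm_num, fun n hn x => by
      simpa [greenScale] using le_sum_hitProb_interval (by omega) x⟩
  · exact ⟨Real.log 2 / 48, by positivity, fun n hn x => by
      simpa [greenScale] using le_sum_hitProb_disc hn x⟩
  · refine ⟨(100 ^ (-(1 / 4) : ℝ) - 101 ^ (-(1 / 4) : ℝ)) / 100 ^ (-(1 / 4) : ℝ) / (2 * d ^ 2), ?_,
      fun n hn x => ?_⟩
    rotate_left
    · rw [greenScale, if_neg (by omega), one_mul]
      exact le_sum_hitProb_of_three_le h (by omega) x
    · have : (101 : ℝ) ^ (-(1 / 4) : ℝ) < 100 ^ (-(1 / 4) : ℝ) :=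
        Real.rpow_lt_rpow_of_neg (by norm_num) (by norm_num) (by norm_num)
      have h2 : (0 : ℝ) < d := by exact_mod_cast hd
      have := sub_pos.mpr this
      positivity

end Lattice

/-! ### Cutoff for lattice balls -/

section Lattice

variable {d : ℕ}

theorem ballScale_eq (hd : 1 ≤ d) (n : ℕ) :
    ballScale d n = (n : ℝ) ^ (d - 1) * greenScale d n := by
  obtain rfl | rfl | h : d = 1 ∨ d = 2 ∨ 3 ≤ d := by omega
  · simp [ballScale, greenScale]
  · simp [ballScale, greenScale]
  · rw [ballScale, greenScale, if_neg (by omega), if_neg (by omega), if_neg (by omega), mul_one]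

theorem le_card_latticeBall (hd : 1 ≤ d) (n : ℕ) : n ≤ (latticeBall d n).card := by
  let i : Fin d := ⟨0, hd⟩
  have h := Finset.card_le_card_of_injOn (s := Finset.range n) (t := latticeBall d n)
    (fun k => Pi.single i (k : ℤ)) (fun k hk => ?_) (fun k _ l _ hkl => by simpa using hkl)
  · simpa using h
  · have hk' : k < n := by simpa using hk
    simp only [Finset.mem_coe, mem_latticeBall, Pi.single_apply, ite_pow, Finset.sum_ite_eq',
      Finset.mem_univ, if_true, ne_eq, OfNat.ofNat_ne_zero, not_false_eq_true, zero_pow]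
    exact_mod_cast Nat.pow_le_pow_left hk'.le 2

theorem greenScale_bounds {n : ℕ} (hn : 3 ≤ n) :
    0 < greenScale d n ∧ greenScale d n ≤ Real.log n := by
  have h1 : 1 ≤ Real.log n := by
    rw [Real.le_log_iff_exp_le (by positivity)]
    have : (3 : ℝ) ≤ n := by exact_mod_cast hn
    linarith [Real.exp_one_lt_d9]
  unfold greenScale
  split_ifs
  · exact ⟨by linarith, le_rfl⟩
  · exact ⟨one_pos, h1⟩

theorem cutoff_latticeBall (hd : 1 ≤ d) {lam : ℕ → ℝ} (hlam0 : ∀ n, 1 ≤ n → 0 < lam n)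
    (hlam : Tendsto (fun n => lam n / ((latticeBall d n).card : ℝ)) atTop atTop) :
    HasCommonCutoff (fun n => graphChain (latticeGraph d) (latticeBall d n) (lam n))
      (fun n => Real.sqrt ((n : ℝ) ^ d * ballScale d n)) ∧
    (fun n => (mixingTime (tvDistance (graphChain (latticeGraph d) (latticeBall d n) (lam n)))
      (1 / 2) : ℝ) - ((latticeBall d n).card : ℝ)) =o[atTop]
        fun n => ((latticeBall d n).card : ℝ) := by
  obtain ⟨c, hc, hgreen⟩ := exists_le_sum_hitProb hd
  have hcardpos : ∀ n, 1 ≤ n → (0 : ℝ) < (latticeBall d n).card := fun n hn => by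
    exact_mod_cast lt_of_lt_of_le hn (le_card_latticeBall hd n)
  -- `ρ` is the inverse of the lower bound of the hitting probabilities from `hgreen`
  have key := cutoff_of_meanHit_ge (V := fun n => latticeBall d n)
    (K := fun n => walkKernel (latticeGraph d) (latticeBall d n)) (lam := lam)
    (ρ := fun n => (latticeBall d n).card * greenScale d n / (c * n))
    (w := fun n => Real.sqrt ((n : ℝ) ^ d * ballScale d n)) ?_ ?_ ?_ ?_ ?_ ?_
  · simpa only [Fintype.card_coe, graphChain_eq] using key
  · filter_upwards [eventually_ge_atTop 1] with n hn
    exact isAdmissible_latticeBall hd (hlam0 n hn)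
  · simpa only [Fintype.card_coe] using hlam
  · simp only [Fintype.card_coe]
    exact tendsto_atTop_mono (le_card_latticeBall hd) tendsto_id
  · filter_upwards [eventually_ge_atTop 3] with n hn
    have h1 := hcardpos n (by omega)
    have h2 := (greenScale_bounds (d := d) hn).1
    have h3 : (0 : ℝ) < n := by exact_mod_cast (by omega : 0 < n)
    refine ⟨by positivity, fun x => ?_⟩
    have : Nonempty (latticeBall d n) := ⟨x⟩
    have h4 := hgreen n (by omega) x
    rw [sum_hitProb_eq, Fintype.card_coe] at h4
    rw [div_mul_eq_mul_div, le_div_iff₀ (by positivity), one_mul]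
    linarith
  · have hlim : Tendsto (fun n : ℕ => 2 * d / c * (Real.log n ^ 2 / n)) atTop (𝓝 0) := by
      rw [← mul_zero (2 * d / c : ℝ)]
      exact (((Real.isLittleO_pow_log_id_atTop (n := 2)).tendsto_div_nhds_zero).comp
        tendsto_natCast_atTop_atTop).const_mul _
    refine squeeze_zero' ?_ ?_ hlim
    · filter_upwards [eventually_ge_atTop 3] with n hn
      have h1 := hcardpos n (by omega)
      have h2 := (greenScale_bounds (d := d) hn).1
      have h5 : 0 ≤ Real.log (Fintype.card (latticeBall d n)) := Real.log_natCast_nonneg _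
      positivity
    · filter_upwards [eventually_ge_atTop 3] with n hn
      have h1 := hcardpos n (by omega)
      obtain ⟨h2, h2'⟩ := greenScale_bounds (d := d) hn
      have h3 : (3 : ℝ) ≤ n := by exact_mod_cast hn
      have h4 : Real.log (latticeBall d n).card ≤ 2 * d * Real.log n := by
        have : ((latticeBall d n).card : ℝ) ≤ ((n : ℝ) ^ 2) ^ d :=
          card_latticeBall_le.trans (pow_le_pow_left₀ (by positivity) (by nlinarith) d)
        refine (Real.log_le_log h1 this).trans (le_of_eq ?_)
        rw [Real.log_pow, Real.log_pow]
        push_cast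
        ring
      have h5 : 0 ≤ Real.log (latticeBall d n).card := Real.log_natCast_nonneg _
      rw [Fintype.card_coe]
      calc ((latticeBall d n).card : ℝ) * greenScale d n / (c * n)
            * Real.log (latticeBall d n).card / (latticeBall d n).card
          = greenScale d n * Real.log (latticeBall d n).card / (c * n) := by field_simp
        _ ≤ Real.log n * (2 * d * Real.log n) / (c * n) := by
            refine div_le_div_of_nonneg_right ?_ (by positivity)
            exact mul_le_mul h2' h4 h5 (h2.le.trans h2')
        _ = 2 * d / c * (Real.log n ^ 2 / n) := by field_simp
  · refine IsBigO.of_bound (Real.sqrt (9 ^ d / c)) ?_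
    filter_upwards [eventually_ge_atTop 3] with n hn
    have h2 := (greenScale_bounds (d := d) hn).1
    have h3 : (3 : ℝ) ≤ n := by exact_mod_cast hn
    rw [Real.norm_of_nonneg (Real.sqrt_nonneg _), Real.norm_of_nonneg (Real.sqrt_nonneg _),
      ← Real.sqrt_mul (by positivity), Fintype.card_coe]
    refine Real.sqrt_le_sqrt ?_
    have h4 : ((latticeBall d n).card : ℝ) ≤ (3 * n) ^ d :=
      card_latticeBall_le.trans (pow_le_pow_left₀ (by positivity) (by linarith) d)
    have h5 : ((latticeBall d n).card : ℝ) ^ 2 ≤ 9 ^ d * (n ^ d * (n ^ (d - 1) * n)) := by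
      refine (pow_le_pow_left₀ (by positivity) h4 2).trans (le_of_eq ?_)
      rw [← pow_succ, Nat.sub_add_cancel hd, ← mul_pow, ← mul_pow, ← pow_mul, mul_comm d 2, pow_mul]
      congr 1
      ring
    rw [ballScale_eq hd]
    calc ((latticeBall d n).card : ℝ) * greenScale d n / (c * n) * (latticeBall d n).card
        = (latticeBall d n).card ^ 2 * (greenScale d n / (c * n)) := by ring
      _ ≤ 9 ^ d * (n ^ d * (n ^ (d - 1) * n)) * (greenScale d n / (c * n)) :=
          mul_le_mul_of_nonneg_right h5 (by positivity)
      _ = 9 ^ d / c * (n ^ d * (n ^ (d - 1) * greenScale d n)) := by field_simp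

end Lattice

/-! ### The four families of graphs -/

section Families

theorem abs_sepDistance_sub_tvDistance_le {V : Type*} [Fintype V] [DecidableEq V]
    {K : V → V → ℝ} {lam : ℝ} {ν : V → ℝ} (h : IsAdmissible K lam ν) (t : ℕ) :
    |sepDistance (transitionMatrix K lam ν) t - tvDistance (transitionMatrix K lam ν) t|
      ≤ (Fintype.card V : ℝ) / (1 + lam) * sepDistance (transitionMatrix K lam ν) t := by
  rw [h.sepDistance_eq, abs_of_nonneg (sub_nonneg.mpr (h.tvDistance_le t))]
  linarith [h.le_tvDistance t]

theorem cutoff_nonAmenable {W : Type*} [DecidableEq W] {G : SimpleGraph W} {D : ℕ}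
    {V : ℕ → Finset W} {lam : ℕ → ℝ} (hD : ∀ x, (G.neighborSet x).encard ≤ D)
    (hG : NonAmenable G) (hV : ∀ n, 1 ≤ n → (V n).card = n ∧ 0 < lam n)
    (hlam : Tendsto (fun n => lam n / ((V n).card : ℝ)) atTop atTop) :
    HasCommonCutoff (fun n => graphChain G (V n) (lam n))
      (fun n => (n : ℝ) * Real.sqrt (Real.log n)) ∧
    (fun n => (mixingTime (tvDistance (graphChain G (V n) (lam n))) (1 / 2) : ℝ))
      =Θ[atTop] (fun n : ℕ => (n : ℝ) * Real.log n) := by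
  have hfin : ∀ x, (G.neighborSet x).Finite := fun x => by
    rw [← Set.encard_lt_top_iff]
    exact (hD x).trans_lt (ENat.natCast_lt_top D)
  obtain ⟨nb, hnb⟩ := exists_isNeighborList hfin
  -- the bound `D + 1` is positive without further ado
  have hdeg : ∀ x, ((nb x).card : ℝ) ≤ D + 1 := fun x => by
    have h1 := hD x
    rw [← (hfin x).cast_ncard_eq, hnb.ncard] at h1
    have h2 : (nb x).card ≤ D := by exact_mod_cast h1
    have h3 : ((nb x).card : ℝ) ≤ D := by exact_mod_cast h2
    linarith
  unfold NonAmenable at hG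
  set κ := ⨅ S : {S : Finset W // S.Nonempty},
    ((outerBoundary G S.1).ncard : ℝ) / (S.1.card : ℝ)
  have hκ : ∀ T : Finset W, T.Nonempty → κ * T.card ≤ (outerBoundary G T).ncard := by
    intro T hT
    rw [← le_div_iff₀ (by exact_mod_cast hT.card_pos)]
    exact ciInf_le (f := fun S : {S : Finset W // S.Nonempty} =>
      ((outerBoundary G S.1).ncard : ℝ) / (S.1.card : ℝ))
      ⟨0, by rintro _ ⟨S, rfl⟩; positivity⟩ ⟨T, hT⟩
  have hbd : ∀ T : Finset W, T.Nonempty → ∃ x ∈ T, ∃ y ∉ T, G.Adj x y := by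
    intro T hT
    have h1 : (0 : ℝ) < T.card := by exact_mod_cast hT.card_pos
    have h2 : (0 : ℝ) < (outerBoundary G T).ncard := lt_of_lt_of_le (by positivity) (hκ T hT)
    obtain ⟨y, hy, x, hx, hxy⟩ := Set.nonempty_of_ncard_ne_zero
      (by exact_mod_cast h2.ne' : (outerBoundary G T).ncard ≠ 0)
    exact ⟨x, hx, y, hy, hxy⟩
  have hne : ∀ n, 1 ≤ n → (V n).Nonempty := fun n hn => by
    rw [← Finset.card_pos, (hV n hn).1]; exact hn
  have hadm : ∀ n, 1 ≤ n → IsAdmissible (walkKernel G (V n)) (lam n) (uniformLaw (V n)) :=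
    fun n hn => isAdmissible_walkKernel hnb (hne n hn) (hV n hn).2 fun T _ => hbd T
  have key := cutoff_of_sum_meanHit_le (V := fun n => V n) (K := fun n => walkKernel G (V n))
    (lam := lam) ?_ ?_ ?_ ?_
  · simpa only [graphChain_eq] using key
  · filter_upwards [eventually_ge_atTop 1] with n hn using hadm n hn
  · simpa only [Fintype.card_coe] using hlam
  · filter_upwards [eventually_ge_atTop 1] with n hn
    rw [Fintype.card_coe, (hV n hn).1]
  · refine ⟨8 * (D + 1) ^ 2 / κ ^ 2, ?_⟩
    filter_upwards [eventually_ge_atTop 1] with n hn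
    exact sum_meanHit_le_of_isoperimetric hnb hG hκ (by positivity) hdeg (hne n hn) (hadm n hn)

theorem card_univ_erase {W : Type*} [Fintype W] [DecidableEq W] {n : ℕ}
    (h : Fintype.card W = n + 1) (z : W) : (Finset.univ.erase z).card = n := by
  rw [Finset.card_erase_of_mem (Finset.mem_univ z), Finset.card_univ, h, Nat.add_sub_cancel]

theorem cutoff_transitive {W : ℕ → Type*} [∀ n, Fintype (W n)] [∀ n, DecidableEq (W n)]
    {G : ∀ n, SimpleGraph (W n)} {z : ∀ n, W n} {lam : ℕ → ℝ}
    (hG : ∀ n, 1 ≤ n → Fintype.card (W n) = n + 1 ∧ (G n).Connected ∧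
      VertexTransitive (G n) ∧ 0 < lam n)
    (hlam : Tendsto (fun n => lam n / ((Finset.univ.erase (z n)).card : ℝ)) atTop atTop) :
    HasCommonCutoff (fun n => graphChain (G n) (Finset.univ.erase (z n)) (lam n))
      (fun n => Real.sqrt n) ∧
    (fun n => (mixingTime (tvDistance
        (graphChain (G n) (Finset.univ.erase (z n)) (lam n))) (1 / 2) : ℝ) - (n : ℝ))
      =o[atTop] (fun n : ℕ => (n : ℝ)) := by
  have hcard : ∀ n, 1 ≤ n → (Finset.univ.erase (z n)).card = n := fun n hn =>
    card_univ_erase (hG n hn).1 _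
  have hcard' : ∀ᶠ n : ℕ in atTop,
      (Fintype.card (Finset.univ.erase (z n) : Finset (W n)) : ℝ) = n := by
    filter_upwards [eventually_ge_atTop 1] with n hn
    rw [Fintype.card_coe, hcard n hn]
  have hadm : ∀ n, 1 ≤ n → IsAdmissible (walkKernel (G n) (Finset.univ.erase (z n))) (lam n)
      (uniformLaw (Finset.univ.erase (z n) : Finset (W n))) := fun n hn => by
    obtain ⟨nb, hnb⟩ := exists_isNeighborList (G := G n) fun x => Set.toFinite _
    refine isAdmissible_walkKernel hnb (by rw [← Finset.card_pos, hcard n hn]; exact hn)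
      (hG n hn).2.2.2 fun T hTS hT => ?_
    obtain ⟨x, hx⟩ := hT
    obtain ⟨p⟩ := (hG n hn).2.1.preconnected x (z n)
    obtain ⟨e, -, h1, h2⟩ := p.exists_boundary_dart T hx fun h => by simpa using hTS h
    exact ⟨e.fst, h1, e.snd, h2, e.adj⟩
  have key := cutoff_of_meanHit_ge (V := fun n => (Finset.univ.erase (z n) : Finset (W n)))
    (K := fun n => walkKernel (G n) (Finset.univ.erase (z n))) (lam := lam) (ρ := fun _ => 2)
    (w := fun n => Real.sqrt n) ?_ ?_ ?_ ?_ ?_ ?_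
  · simp only [graphChain_eq]
    refine ⟨key.1, key.2.congr' ?_ hcard'⟩
    filter_upwards [hcard'] with n hn
    rw [hn]
  · filter_upwards [eventually_ge_atTop 1] with n hn using hadm n hn
  · simpa only [Fintype.card_coe] using hlam
  · refine tendsto_id.congr' ?_
    filter_upwards [hcard'] with n hn
    exact_mod_cast hn.symm
  · filter_upwards [eventually_ge_atTop 1] with n hn
    exact ⟨two_pos, half_le_meanHit_of_transitive (hG n hn).2.1 (hG n hn).2.2.1 (hadm n hn)⟩
  · have hlim : Tendsto (fun n : ℕ => 2 * (Real.log n / n)) atTop (𝓝 0) := by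
      rw [← mul_zero (2 : ℝ)]
      exact (Real.isLittleO_log_id_atTop.tendsto_div_nhds_zero.comp
        tendsto_natCast_atTop_atTop).const_mul _
    refine hlim.congr' ?_
    filter_upwards [hcard'] with n hn
    rw [hn, mul_div_assoc]
  · refine IsBigO.of_bound (Real.sqrt 2) ?_
    filter_upwards [hcard'] with n hn
    rw [hn, Real.sqrt_mul two_pos.le, norm_mul, Real.norm_of_nonneg (Real.sqrt_nonneg 2)]

theorem adj_of_ncard_neighborSet {W : Type*} [Fintype W] {G : SimpleGraph W} {z : W}
    (h : Fintype.card W = (G.neighborSet z).ncard + 1) {x : W} (hx : x ≠ z) : G.Adj x z := by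
  have h1 : G.neighborSet z ⊆ {z}ᶜ := fun y hy => by
    simpa using (G.ne_of_adj hy).symm
  have h2 : ({z}ᶜ : Set W).ncard ≤ (G.neighborSet z).ncard := by
    have := Set.ncard_add_ncard_compl ({z} : Set W)
    rw [Set.ncard_singleton, Nat.card_eq_fintype_card, h] at this
    omega
  have h3 : x ∈ G.neighborSet z := by
    rw [Set.eq_of_subset_of_ncard_le h1 h2]
    exact hx
  exact SimpleGraph.Adj.symm h3

theorem cutoff_wheel {d : ℕ} {W : ℕ → Type*} [∀ n, Fintype (W n)] [∀ n, DecidableEq (W n)]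
    {G : ∀ n, SimpleGraph (W n)} {z : ∀ n, W n} {lam : ℕ → ℝ}
    (hG : ∀ n, 1 ≤ n → Fintype.card (W n) = n + 1 ∧ ((G n).neighborSet (z n)).ncard = n ∧
      (∀ x, x ≠ z n → ((G n).neighborSet x).ncard ≤ d) ∧ 0 < lam n)
    (hlam : Tendsto (fun n => lam n / ((Finset.univ.erase (z n)).card : ℝ)) atTop atTop) :
    HasCommonCutoff (fun n => graphChain (G n) (Finset.univ.erase (z n)) (lam n))
      (fun n => (n : ℝ) * Real.sqrt (Real.log n)) ∧
    (fun n => (mixingTime (tvDistance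
        (graphChain (G n) (Finset.univ.erase (z n)) (lam n))) (1 / 2) : ℝ))
      =Θ[atTop] (fun n : ℕ => (n : ℝ) * Real.log n) := by
  have hcard : ∀ n, 1 ≤ n → (Finset.univ.erase (z n)).card = n := fun n hn =>
    card_univ_erase (hG n hn).1 _
  have hadj : ∀ n, 1 ≤ n → ∀ x, x ≠ z n → (G n).Adj x (z n) := fun n hn x hx =>
    adj_of_ncard_neighborSet (by rw [(hG n hn).1, (hG n hn).2.1]) hx
  have hadm : ∀ n, 1 ≤ n → IsAdmissible (walkKernel (G n) (Finset.univ.erase (z n))) (lam n)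
      (uniformLaw (Finset.univ.erase (z n) : Finset (W n))) := fun n hn => by
    obtain ⟨nb, hnb⟩ := exists_isNeighborList (G := G n) fun x => Set.toFinite _
    refine isAdmissible_walkKernel hnb (by rw [← Finset.card_pos, hcard n hn]; exact hn)
      (hG n hn).2.2.2 fun T hTS hT => ?_
    obtain ⟨x, hx⟩ := hT
    exact ⟨x, hx, z n, fun h => by simpa using hTS h,
      hadj n hn x (Finset.ne_of_mem_erase (hTS hx))⟩
  have key := cutoff_of_sum_meanHit_le (V := fun n => (Finset.univ.erase (z n) : Finset (W n)))
    (K := fun n => walkKernel (G n) (Finset.univ.erase (z n))) (lam := lam) ?_ ?_ ?_ ?_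
  · simpa only [graphChain_eq] using key
  · filter_upwards [eventually_ge_atTop 1] with n hn using hadm n hn
  · simpa only [Fintype.card_coe] using hlam
  · filter_upwards [eventually_ge_atTop 1] with n hn
    rw [Fintype.card_coe, hcard n hn]
  · refine ⟨d, ?_⟩
    filter_upwards [eventually_ge_atTop 1] with n hn
    exact sum_meanHit_le_of_wheel (hadj n hn) (hG n hn).2.2.1 (hadm n hn)

end Families

end

end ARW

theorem mainTheorem11 :
    -- Comparison of distances, for every ARW chain.
    (∀ (V : Type*) [Fintype V] [DecidableEq V] (K : V → V → ℝ) (lam : ℝ) (ν : V → ℝ),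
      ARW.IsAdmissible K lam ν →
      (∃! μ, ARW.IsInvariantLaw (ARW.transitionMatrix K lam ν) μ) ∧
      ∀ t : ℕ, |ARW.sepDistance (ARW.transitionMatrix K lam ν) t
            - ARW.tvDistance (ARW.transitionMatrix K lam ν) t|
          ≤ (Fintype.card V : ℝ) / (1 + lam)
            * ARW.sepDistance (ARW.transitionMatrix K lam ν) t) ∧
    -- Non-amenable graphs.
    (∀ (W : Type*) [DecidableEq W] [Infinite W] (G : SimpleGraph W) (D : ℕ)
        (V : ℕ → Finset W) (lam : ℕ → ℝ),
      (∀ x, (G.neighborSet x).encard ≤ D) → ARW.NonAmenable G →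
      (∀ n, 1 ≤ n → (V n).card = n ∧ 0 < lam n) →
      Tendsto (fun n => lam n / ((V n).card : ℝ)) atTop atTop →
      ARW.HasCommonCutoff (fun n => ARW.graphChain G (V n) (lam n))
        (fun n => (n : ℝ) * Real.sqrt (Real.log n)) ∧
      (fun n => (ARW.mixingTime (ARW.tvDistance (ARW.graphChain G (V n) (lam n))) (1 / 2) : ℝ))
        =Θ[atTop] (fun n : ℕ => (n : ℝ) * Real.log n)) ∧
    -- Vertex-transitive graphs with a sink.
    (∀ (W : ℕ → Type*) [∀ n, Fintype (W n)] [∀ n, DecidableEq (W n)]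
        (G : ∀ n, SimpleGraph (W n)) (z : ∀ n, W n) (lam : ℕ → ℝ),
      (∀ n, 1 ≤ n → Fintype.card (W n) = n + 1 ∧ (G n).Connected ∧
        ARW.VertexTransitive (G n) ∧ 0 < lam n) →
      Tendsto (fun n => lam n / ((Finset.univ.erase (z n)).card : ℝ)) atTop atTop →
      ARW.HasCommonCutoff
        (fun n => ARW.graphChain (G n) (Finset.univ.erase (z n)) (lam n))
        (fun n => Real.sqrt n) ∧
      (fun n => (ARW.mixingTime (ARW.tvDistance
          (ARW.graphChain (G n) (Finset.univ.erase (z n)) (lam n))) (1 / 2) : ℝ) - (n : ℝ))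
        =o[atTop] (fun n : ℕ => (n : ℝ))) ∧
    -- Wheel-like graphs.
    (∀ (d : ℕ) (W : ℕ → Type*) [∀ n, Fintype (W n)] [∀ n, DecidableEq (W n)]
        (G : ∀ n, SimpleGraph (W n)) (z : ∀ n, W n) (lam : ℕ → ℝ),
      (∀ n, 1 ≤ n → Fintype.card (W n) = n + 1 ∧ ((G n).neighborSet (z n)).ncard = n ∧
        (∀ x, x ≠ z n → ((G n).neighborSet x).ncard ≤ d) ∧ 0 < lam n) →
      Tendsto (fun n => lam n / ((Finset.univ.erase (z n)).card : ℝ)) atTop atTop →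
      ARW.HasCommonCutoff
        (fun n => ARW.graphChain (G n) (Finset.univ.erase (z n)) (lam n))
        (fun n => (n : ℝ) * Real.sqrt (Real.log n)) ∧
      (fun n => (ARW.mixingTime (ARW.tvDistance
          (ARW.graphChain (G n) (Finset.univ.erase (z n)) (lam n))) (1 / 2) : ℝ))
        =Θ[atTop] (fun n : ℕ => (n : ℝ) * Real.log n)) ∧
    -- Discrete Euclidean balls.
    (∀ (d : ℕ) (lam : ℕ → ℝ), 1 ≤ d → (∀ n, 1 ≤ n → 0 < lam n) →
      Tendsto (fun n => lam n / ((ARW.latticeBall d n).card : ℝ)) atTop atTop →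
      ARW.HasCommonCutoff
        (fun n => ARW.graphChain (ARW.latticeGraph d) (ARW.latticeBall d n) (lam n))
        (fun n => Real.sqrt ((n : ℝ) ^ d * ARW.ballScale d n)) ∧
      (fun n => (ARW.mixingTime (ARW.tvDistance (ARW.graphChain (ARW.latticeGraph d)
          (ARW.latticeBall d n) (lam n))) (1 / 2) : ℝ) - ((ARW.latticeBall d n).card : ℝ))
        =o[atTop] (fun n => ((ARW.latticeBall d n).card : ℝ))) := by
  refine ⟨fun V _ _ K lam ν h => ⟨h.existsUnique_invariantLaw,
      ARW.abs_sepDistance_sub_tvDistance_le h⟩,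
    fun W _ _ G D V lam hD hG hV hlam => ARW.cutoff_nonAmenable hD hG hV hlam,
    fun W _ _ G z lam hG hlam => ARW.cutoff_transitive hG hlam,
    fun d W _ _ G z lam hG hlam => ARW.cutoff_wheel hG hlam,
    fun d lam hd hlam0 hlam => ARW.cutoff_latticeBall hd hlam0 hlam⟩
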